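/- **Setting.** Let $G$ be a finite group. A spin chain $\mathcal A$ is given by on-site algebras $\mathcal A_j = \mathrm{End}(\mathbb C^{d_j})$, $j\in\mathbb Z$, with $1\le d_j\le d_{\max}$; $\mathcal A$ denotes the quasi-local $C^*$-algebra and $\mathcal A_X\subset\mathcal A$ the norm closed $*$-subalgebra generated by the $\mathcal A_j$, $j\in X$. A QCA of range $\le r$ is a $*$-automorphism $\alpha$ of $\mathcal A$ with $\alpha(\mathcal A_X)\subset\mathcal A_{X^{(r)}}$ for all $X\subset\mathbb Z$, where $X^{(r)}$ is the $r$-fattening of $X$. A block partitioned QCA is $\bigotimes_a \mathrm{Ad}(U_a)$ for unitaries $U_a\in\mathcal A_{I_a}$, where $\{I_a\}_{a \in \mathbb Z}$ is a partition of $\mathbb Z$ into intervals of bounded size; a finite depth quantum circuit (FDQC) is a finite composition of block partitioned QCAs. A symmetry on $\mathcal A$ is a group homomorphism $g\mapsto\alpha^{(g)}$ from $G$ to the QCAs of $\mathcal A$; it has range $\le R$ if every $\alpha^{(g)}$ has. It is decoupled if all $\alpha^{(g)}$ are block partitioned with common blocks. The stack $\alpha\otimes\beta$ is the symmetry with components $\alpha^{(g)}\otimes\beta^{(g)}$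 on the spin chain with on-site algebras $\mathcal A_j\otimes\mathcal B_j$. Write $\alpha'\sim_0\alpha$ if, up to an isomorphism of spin chains (mapping on-site algebras onto on-site algebras at the same site), $\alpha'^{(g)}=\gamma^{-1}\circ\alpha^{(g)}\circ\gamma$ for all $g$, for some FDQC $\gamma$; and $\alpha\sim\alpha'$ (stable equivalence) if $\alpha\otimes\beta\sim_0\alpha'\otimes\beta'$ for some symmetries $\beta,\beta'$ of range $0$. $\mathrm{Sym}_G$ is the collection of all $G$-symmetries on arbitrary spin chains. A right restriction of $\alpha$ at $j\in\mathbb Z$ with defect size $L \in \mathbb N$ is a family of $*$-automorphisms $\alpha_{\ge j}^{(g)}$, $g\in G$, that agree with $\alpha^{(g)}$ on $\mathcal A_{[j+L,\infty)}$ and are the identity on $\mathcal A_{(-\infty,j-L)}$. Associated fusion operators are unitaries $F(g,h)$ with $\alpha^{(g)}_{\ge j}\circ\alpha^{(h)}_{\ge j}=\mathrm{Ad}[F(g,h)]\circ\alpha^{(gh)}_{\ge j}$, and the associated phases $\omega_j(f,g,h)\in U(1)$ are determined by $$F(f,g)F(fg,h)=\omega_j(f,g,h)\,\alpha_{\ge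 j}^{(f)}\big(F(g,h)\big)F(f,gh).$$ **Proposition.** Every symmetry of range $\le R$ has a right restriction of defect size $2R$ at every site. Every right restriction at $j$ of defect size $L$ of such a symmetry has fusion operators in $\mathcal A_{[j-L,j+L+R]}$, and for all of its fusion operators the phases $\omega_j$ exist and are unique. The map $\omega_j:G^3\to U(1)$ is a 3-cocycle, $$1=\frac{\omega_j(g,h,k)\,\omega_j(f,gh,k)\,\omega_j(f,g,h)}{\omega_j(fg,h,k)\,\omega_j(f,g,hk)},$$ and its class $[\omega_j]\in H^3(G,U(1))$ (trivial action on $U(1)$) depends only on $\alpha$, i.e. it is independent of the site, the right restriction (of any defect size) and the fusion operators. This defines a unique map $\Omega:\mathrm{Sym}_G\to H^3(G,U(1))$, the anomaly. Moreover: 1. If $\alpha$ is decoupled, then $\Omega(\alpha)=[1]$. 2. If $\alpha,\beta$ are symmetries of range $\le R$ on the same spin chain $\mathcal A$ and there is an interval $I$ of $8R+1$ consecutive sites with $\alpha^{(g)}|_{\mathcal A_I}=\beta^{(g)}|_{\mathcal A_I}$ for all $g$, then $\Omega(\alpha)=\Omega(\beta)$. 3. $\Omega(\alpha\otimes\beta)=\Omega(\alpha)\cdot\Omega(\beta)$.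 4. If $\alpha\sim\beta$, then $\Omega(\alpha)=\Omega(\beta)$. In particular, stable equivalence is an equivalence relation on $\mathrm{Sym}_G$, the quotient $\mathrm{Sym}_G/\!\sim$ is a commutative monoid under stacking, and $\Omega$ descends to a homomorphism of monoids $\mathrm{Sym}_G/\!\sim\;\to H^3(G,U(1))$. -/

import Mathlib

open scoped Matrix Kronecker

noncomputable section

/-! ### Star homomorphisms out of matrix algebras -/

section MatrixUnits

theorem sum_single_self (l : Type*) [Fintype l] [DecidableEq l] :
    ∑ i : l, Matrix.single i i (1 : ℂ) = 1 := by
  ext a b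
  by_cases h : a = b
  · subst h
    simp [Matrix.sum_apply, Matrix.single_apply]
  · rw [Matrix.one_apply_ne h, Matrix.sum_apply]
    refine Finset.sum_eq_zero fun i _ => ?_
    rw [Matrix.single_apply, if_neg]
    rintro ⟨rfl, rfl⟩
    exact h rfl

variable {C : Type*} [Ring C] [StarRing C] [Algebra ℂ C] [StarModule ℂ C]

/-- The star homomorphism out of a matrix algebra given by a system of matrix units. -/
def matrixUnitsHom {n : Type*} [Fintype n] [DecidableEq n] (e : n → n → C)
    (hmul : ∀ i j k l, e i j * e k l = if j = k then e i l else 0)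
    (hstar : ∀ i j, star (e i j) = e j i) (hone : ∑ i, e i i = 1) :
    Matrix n n ℂ →⋆ₐ[ℂ] C where
  toFun M := ∑ i, ∑ j, M i j • e i j
  map_one' := by
    simp [Matrix.one_apply, ite_smul, hone]
  map_mul' M N := by
    change (∑ i, ∑ j, (M * N) i j • e i j) =
      (∑ i, ∑ j, M i j • e i j) * (∑ i, ∑ j, N i j • e i j)
    simp only [Matrix.mul_apply, Finset.sum_smul]
    rw [Finset.sum_mul]
    refine Finset.sum_congr rfl fun i _ => ?_
    rw [Finset.sum_mul, Finset.sum_comm]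
    refine Finset.sum_congr rfl fun j _ => ?_
    simp only [Finset.mul_sum, smul_mul_smul_comm, hmul, smul_ite, smul_zero]
    rw [Finset.sum_comm]
    simp
  map_zero' := by simp
  map_add' M N := by simp [add_smul, Finset.sum_add_distrib]
  commutes' r := by
    simp [Matrix.algebraMap_matrix_apply, ite_smul, Algebra.algebraMap_eq_smul_one r, ← hone,
      Finset.smul_sum]
  map_star' M := by
    simp only [star_sum, star_smul, hstar, Matrix.star_apply]
    rw [Finset.sum_comm]

theorem matrixUnitsHom_single {n : Type*} [Fintype n] [DecidableEq n] (e : n → n → C)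
    (hmul : ∀ i j k l, e i j * e k l = if j = k then e i l else 0)
    (hstar : ∀ i j, star (e i j) = e j i) (hone : ∑ i, e i i = 1) (i j : n) :
    matrixUnitsHom e hmul hstar hone (Matrix.single i j 1) = e i j := by
  change ∑ i', ∑ j', Matrix.single i j (1 : ℂ) i' j' • e i' j' = _
  rw [Finset.sum_eq_single i, Finset.sum_eq_single j] <;>
    simp +contextual [Matrix.single_apply, eq_comm]

theorem matrixHom_ext {n : Type*} [Fintype n] [DecidableEq n] {f g : Matrix n n ℂ →⋆ₐ[ℂ] C}
    (h : ∀ i j, f (Matrix.single i j 1) = g (Matrix.single i j 1)) : f = g := by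
  ext M
  rw [Matrix.matrix_eq_sum_single M]
  simp only [map_sum]
  refine Finset.sum_congr rfl fun i _ => Finset.sum_congr rfl fun j _ => ?_
  have : Matrix.single i j (M i j) = M i j • Matrix.single i j (1 : ℂ) := by simp
  rw [this, map_smul, map_smul, h]

/-- For an identification `ε` of the index set `k` with `n × m`, the star homomorphism
`M_k = M_n ⊗ M_m → C` given by two star homomorphisms with commuting ranges. -/
def matrixTensorHom {n m k : Type*} [Fintype n] [DecidableEq n] [Fintype m] [DecidableEq m]
    [Fintype k] [DecidableEq k] (ε : k ≃ n × m)
    (f : Matrix n n ℂ →⋆ₐ[ℂ] C) (g : Matrix m m ℂ →⋆ₐ[ℂ] C) (hfg : ∀ M N, Commute (f M) (g N)) :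
    Matrix k k ℂ →⋆ₐ[ℂ] C :=
  matrixUnitsHom
    (fun p q => f (Matrix.single (ε p).1 (ε q).1 1) * g (Matrix.single (ε p).2 (ε q).2 1))
    (by
      intro i j k l
      have h : ∀ a b c d : C, Commute c b → (a * b) * (c * d) = (a * c) * (b * d) := by
        intro a b c d hbc
        rw [mul_assoc, ← mul_assoc b, ← hbc.eq, mul_assoc, mul_assoc]
      rw [h _ _ _ _ (hfg _ _), ← map_mul, ← map_mul]
      by_cases h1 : j = k
      · subst h1; simp
      · have h2 : ε j ≠ ε k := fun hh => h1 (ε.injective hh)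
        by_cases h3 : (ε j).1 = (ε k).1
        · have h4 : (ε j).2 ≠ (ε k).2 := fun hh => h2 (Prod.ext h3 hh)
          simp [h1, h4]
        · simp [h1, h3])
    (by
      intro i j
      rw [star_mul, ← map_star, ← map_star]
      simp only [Matrix.star_eq_conjTranspose, Matrix.conjTranspose_single, star_one]
      exact (hfg _ _).symm.eq)
    (by
      rw [Equiv.sum_comp ε (fun p => f (Matrix.single p.1 p.1 1) * g (Matrix.single p.2 p.2 1)),
        Fintype.sum_prod_type]
      simp only [← Finset.mul_sum, ← map_sum]
      rw [← Finset.sum_mul, ← map_sum]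
      rw [sum_single_self, sum_single_self, map_one, map_one, one_mul])

/-- The embedding `M ↦ M ⊗ 1`. -/
def kronLeft {n m k : Type*} [Fintype n] [DecidableEq n] [Fintype m] [DecidableEq m]
    [Fintype k] [DecidableEq k] (ε : k ≃ n × m) : Matrix n n ℂ →⋆ₐ[ℂ] Matrix k k ℂ where
  toFun M := (M ⊗ₖ (1 : Matrix m m ℂ)).submatrix ε ε
  map_one' := by simp
  map_mul' M N := by
    rw [Matrix.submatrix_mul_equiv, ← Matrix.mul_kronecker_mul, one_mul]
  map_zero' := by simp
  map_add' M N := by rw [Matrix.add_kronecker]; rfl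
  commutes' r := by
    rw [Algebra.algebraMap_eq_smul_one, Algebra.algebraMap_eq_smul_one, Matrix.smul_kronecker,
      Matrix.one_kronecker_one, Matrix.submatrix_smul]
    simp
  map_star' M := by
    simp only [Matrix.star_eq_conjTranspose, Matrix.conjTranspose_submatrix,
      Matrix.conjTranspose_kronecker, Matrix.conjTranspose_one]

/-- The embedding `N ↦ 1 ⊗ N`. -/
def kronRight {n m k : Type*} [Fintype n] [DecidableEq n] [Fintype m] [DecidableEq m]
    [Fintype k] [DecidableEq k] (ε : k ≃ n × m) : Matrix m m ℂ →⋆ₐ[ℂ] Matrix k k ℂ where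
  toFun N := ((1 : Matrix n n ℂ) ⊗ₖ N).submatrix ε ε
  map_one' := by simp
  map_mul' M N := by
    rw [Matrix.submatrix_mul_equiv, ← Matrix.mul_kronecker_mul, one_mul]
  map_zero' := by simp
  map_add' M N := by rw [Matrix.kronecker_add]; rfl
  commutes' r := by
    rw [Algebra.algebraMap_eq_smul_one, Algebra.algebraMap_eq_smul_one, Matrix.kronecker_smul,
      Matrix.one_kronecker_one, Matrix.submatrix_smul]
    simp
  map_star' M := by
    simp only [Matrix.star_eq_conjTranspose, Matrix.conjTranspose_submatrix,
      Matrix.conjTranspose_kronecker, Matrix.conjTranspose_one]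

theorem kronLeft_mul_kronRight {n m k : Type*} [Fintype n] [DecidableEq n] [Fintype m]
    [DecidableEq m] [Fintype k] [DecidableEq k] (ε : k ≃ n × m) (M : Matrix n n ℂ)
    (N : Matrix m m ℂ) : kronLeft ε M * kronRight ε N = (M ⊗ₖ N).submatrix ε ε := by
  change (M ⊗ₖ (1 : Matrix m m ℂ)).submatrix ε ε * ((1 : Matrix n n ℂ) ⊗ₖ N).submatrix ε ε = _
  rw [Matrix.submatrix_mul_equiv, ← Matrix.mul_kronecker_mul, one_mul, mul_one]

theorem commute_kronLeft_kronRight {n m k : Type*} [Fintype n] [DecidableEq n] [Fintype m]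
    [DecidableEq m] [Fintype k] [DecidableEq k] (ε : k ≃ n × m) (M : Matrix n n ℂ)
    (N : Matrix m m ℂ) : Commute (kronLeft ε M) (kronRight ε N) := by
  rw [Commute, SemiconjBy, kronLeft_mul_kronRight]
  change _ = ((1 : Matrix n n ℂ) ⊗ₖ N).submatrix ε ε * (M ⊗ₖ (1 : Matrix m m ℂ)).submatrix ε ε
  rw [Matrix.submatrix_mul_equiv, ← Matrix.mul_kronecker_mul, one_mul, mul_one]

theorem single_eq_kron {n m k : Type*} [Fintype n] [DecidableEq n] [Fintype m]
    [DecidableEq m] [Fintype k] [DecidableEq k] (ε : k ≃ n × m) (p q : k) :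
    Matrix.single p q (1 : ℂ) = kronLeft ε (Matrix.single (ε p).1 (ε q).1 1) *
      kronRight ε (Matrix.single (ε p).2 (ε q).2 1) := by
  rw [kronLeft_mul_kronRight]
  ext a b
  have h1 : p = a ↔ (ε p).1 = (ε a).1 ∧ (ε p).2 = (ε a).2 := by
    rw [← ε.injective.eq_iff, Prod.ext_iff]
  have h2 : q = b ↔ (ε q).1 = (ε b).1 ∧ (ε q).2 = (ε b).2 := by
    rw [← ε.injective.eq_iff, Prod.ext_iff]
  simp only [Matrix.submatrix_apply, Matrix.kroneckerMap_apply, Matrix.single_apply, h1, h2]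
  split_ifs <;> simp_all

theorem kronLeft_single {n m k : Type*} [Fintype n] [DecidableEq n] [Fintype m]
    [DecidableEq m] [Fintype k] [DecidableEq k] (ε : k ≃ n × m) (a b : n) :
    kronLeft ε (Matrix.single a b 1) =
      ∑ c, Matrix.single (ε.symm (a, c)) (ε.symm (b, c)) (1 : ℂ) := by
  simp only [single_eq_kron ε, Equiv.apply_symm_apply]
  rw [← Finset.mul_sum, ← map_sum, sum_single_self, map_one, mul_one]

theorem kronRight_single {n m k : Type*} [Fintype n] [DecidableEq n] [Fintype m]
    [DecidableEq m] [Fintype k] [DecidableEq k] (ε : k ≃ n × m) (a b : m) :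
    kronRight ε (Matrix.single a b 1) =
      ∑ c, Matrix.single (ε.symm (c, a)) (ε.symm (c, b)) (1 : ℂ) := by
  simp only [single_eq_kron ε, Equiv.apply_symm_apply]
  rw [← Finset.sum_mul, ← map_sum, sum_single_self, map_one, one_mul]

theorem matrixTensorHom_kronLeft {n m k : Type*} [Fintype n] [DecidableEq n] [Fintype m]
    [DecidableEq m] [Fintype k] [DecidableEq k] (ε : k ≃ n × m)
    (f : Matrix n n ℂ →⋆ₐ[ℂ] C) (g : Matrix m m ℂ →⋆ₐ[ℂ] C) (hfg : ∀ M N, Commute (f M) (g N))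
    (M : Matrix n n ℂ) : matrixTensorHom ε f g hfg (kronLeft ε M) = f M := by
  suffices h : (matrixTensorHom ε f g hfg).comp (kronLeft ε) = f from DFunLike.congr_fun h M
  refine matrixHom_ext fun i j => ?_
  rw [StarAlgHom.comp_apply, kronLeft_single, map_sum, matrixTensorHom]
  simp only [matrixUnitsHom_single, Equiv.apply_symm_apply]
  rw [← Finset.mul_sum, ← map_sum, sum_single_self, map_one, mul_one]

theorem matrixTensorHom_kronRight {n m k : Type*} [Fintype n] [DecidableEq n] [Fintype m]
    [DecidableEq m] [Fintype k] [DecidableEq k] (ε : k ≃ n × m)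
    (f : Matrix n n ℂ →⋆ₐ[ℂ] C) (g : Matrix m m ℂ →⋆ₐ[ℂ] C) (hfg : ∀ M N, Commute (f M) (g N))
    (N : Matrix m m ℂ) : matrixTensorHom ε f g hfg (kronRight ε N) = g N := by
  suffices h : (matrixTensorHom ε f g hfg).comp (kronRight ε) = g from DFunLike.congr_fun h N
  refine matrixHom_ext fun i j => ?_
  rw [StarAlgHom.comp_apply, kronRight_single, map_sum, matrixTensorHom]
  simp only [matrixUnitsHom_single, Equiv.apply_symm_apply]
  rw [← Finset.sum_mul, ← map_sum, sum_single_self, map_one, one_mul]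

theorem matrixTensorHom_commute {n m k : Type*} [Fintype n] [DecidableEq n] [Fintype m]
    [DecidableEq m] [Fintype k] [DecidableEq k] (ε : k ≃ n × m)
    (f : Matrix n n ℂ →⋆ₐ[ℂ] C) (g : Matrix m m ℂ →⋆ₐ[ℂ] C) (hfg : ∀ M N, Commute (f M) (g N))
    (z : C) (hf : ∀ M, Commute (f M) z) (hg : ∀ N, Commute (g N) z) (M : Matrix k k ℂ) :
    Commute (matrixTensorHom ε f g hfg M) z := by
  change Commute (∑ p, ∑ q, M p q •
    (f (Matrix.single (ε p).1 (ε q).1 1) * g (Matrix.single (ε p).2 (ε q).2 1))) z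
  refine Commute.sum_left _ _ _ fun p _ => Commute.sum_left _ _ _ fun q _ => ?_
  exact Commute.smul_left (Commute.mul_left (hf _) (hg _)) _

theorem matrixTensorHom_mem {n m k : Type*} [Fintype n] [DecidableEq n] [Fintype m]
    [DecidableEq m] [Fintype k] [DecidableEq k] (ε : k ≃ n × m)
    (f : Matrix n n ℂ →⋆ₐ[ℂ] C) (g : Matrix m m ℂ →⋆ₐ[ℂ] C) (hfg : ∀ M N, Commute (f M) (g N))
    (S : StarSubalgebra ℂ C) (hf : ∀ M, f M ∈ S) (hg : ∀ N, g N ∈ S) (M : Matrix k k ℂ) :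
    matrixTensorHom ε f g hfg M ∈ S :=
  sum_mem fun _ _ => sum_mem fun _ _ => S.smul_mem (mul_mem (hf _) (hg _)) _

end MatrixUnits

/-! ### Spin chains -/

/-- A spin chain: an assignment of on-site dimensions `d_j ≥ 1`, bounded uniformly in `j ∈ ℤ`. The
on-site algebra at `j` is the algebra of `d_j × d_j` complex matrices. -/
structure SpinChain where
  dim : ℤ → ℕ
  dim_pos : ∀ j, 0 < dim j
  bounded : ∃ D, ∀ j, dim j ≤ D

namespace SpinChain

variable (c : SpinChain)

/-- The on-site algebra `A_j = End(ℂ^{d_j})`. -/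
abbrev OnSite (j : ℤ) : Type := Matrix (Fin (c.dim j)) (Fin (c.dim j)) ℂ

instance (j : ℤ) : Nonempty (Fin (c.dim j)) := ⟨⟨0, c.dim_pos j⟩⟩

/-- Configurations: a choice of basis vector at every site. -/
abbrev Conf : Type := ∀ j : ℤ, Fin (c.dim j)

/-- The Hilbert space `ℓ²` over all configurations, on which all on-site algebras act. It only serves
to define the norm of local observables; every finite tensor product of on-site algebras acts
faithfully on it. -/
abbrev Hilb : Type := lp (fun _ : c.Conf => ℂ) 2

variable {c}

open scoped Classical in
theorem unitOp_bound (j : ℤ) (a b : Fin (c.dim j)) (ψ : c.Hilb) (s : Finset c.Conf) :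
    ∑ σ ∈ s, ‖if σ j = a then ψ (Function.update σ j b) else 0‖ ^ (2 : ENNReal).toReal ≤
      ‖ψ‖ ^ (2 : ENNReal).toReal := by
  have h2 : (0 : ℝ) < (2 : ENNReal).toReal := by norm_num
  calc ∑ σ ∈ s, ‖if σ j = a then ψ (Function.update σ j b) else 0‖ ^ (2 : ENNReal).toReal
      = ∑ σ ∈ s with σ j = a, ‖ψ (Function.update σ j b)‖ ^ (2 : ENNReal).toReal := by
        rw [Finset.sum_filter]
        refine Finset.sum_congr rfl fun σ _ => ?_
        split_ifs
        · rfl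
        · simp
    _ = ∑ τ ∈ (s.filter fun σ => σ j = a).image (fun σ => Function.update σ j b),
          ‖ψ τ‖ ^ (2 : ENNReal).toReal := by
        rw [Finset.sum_image]
        intro σ hσ τ hτ h
        have hσ' : σ j = a := (Finset.mem_filter.mp hσ).2
        have hτ' : τ j = a := (Finset.mem_filter.mp hτ).2
        funext i
        by_cases hi : i = j
        · subst hi; rw [hσ', hτ']
        · have := congrFun h i
          simpa [Function.update_of_ne hi] using this
    _ ≤ _ := lp.sum_rpow_le_norm_rpow h2 ψ _

/-- The action on `ℓ²` of the matrix unit `E_{ab}` at site `j`. -/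
def unitOp (j : ℤ) (a b : Fin (c.dim j)) : c.Hilb →L[ℂ] c.Hilb :=
  LinearMap.mkContinuous
    { toFun := fun ψ => ⟨fun σ => if σ j = a then ψ (Function.update σ j b) else 0,
        memℓp_gen' (unitOp_bound j a b ψ)⟩
      map_add' := fun ψ φ => by
        ext σ
        change (if σ j = a then (ψ + φ) (Function.update σ j b) else 0) =
          (if σ j = a then ψ (Function.update σ j b) else 0) +
          (if σ j = a then φ (Function.update σ j b) else 0)
        split_ifs <;> simp
      map_smul' := fun r ψ => by
        ext σ
        change (if σ j = a then (r • ψ) (Function.update σ j b) else 0) =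
          r • (if σ j = a then ψ (Function.update σ j b) else 0)
        split_ifs <;> simp }
    1 (fun ψ => by
      rw [one_mul]
      exact lp.norm_le_of_forall_sum_le (by norm_num) (norm_nonneg _) (unitOp_bound j a b ψ))

theorem unitOp_apply (j : ℤ) (a b : Fin (c.dim j)) (ψ : c.Hilb) (σ : c.Conf) :
    unitOp j a b ψ σ = if σ j = a then ψ (Function.update σ j b) else 0 := rfl

theorem unitOp_mul (j : ℤ) (a b a' b' : Fin (c.dim j)) :
    unitOp j a b * unitOp j a' b' = if b = a' then unitOp j a b' else 0 := by
  ext ψ σ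
  rw [mul_apply_eq_comp, unitOp_apply, unitOp_apply]
  by_cases h : b = a'
  · simp [h, unitOp_apply]
  · simp [h]

theorem unitOp_sum (j : ℤ) : ∑ a, unitOp (c := c) j a a = 1 := by
  ext ψ σ
  rw [_root_.sum_apply, lp.coeFn_sum, Finset.sum_apply]
  simp only [unitOp_apply]
  rw [Finset.sum_eq_single (σ j)] <;> simp +contextual [eq_comm]

theorem unitOp_star (j : ℤ) (a b : Fin (c.dim j)) :
    star (unitOp (c := c) j a b) = unitOp j b a := by
  rw [ContinuousLinearMap.star_eq_adjoint]
  symm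
  rw [ContinuousLinearMap.eq_adjoint_iff]
  intro ψ φ
  rw [lp.inner_eq_tsum, lp.inner_eq_tsum]
  let e : c.Conf ≃ c.Conf := Function.Involutive.toPerm
    (fun σ => Function.update σ j (Equiv.swap a b (σ j))) (fun σ => by
      funext i
      by_cases hi : i = j
      · subst hi; simp
      · simp [Function.update_of_ne hi])
  rw [← Equiv.tsum_eq e]
  refine tsum_congr fun σ => ?_
  have he : e σ = Function.update σ j (Equiv.swap a b (σ j)) := rfl
  rw [he, unitOp_apply, unitOp_apply]
  by_cases h : σ j = a
  · subst h
    simp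
  · have h1 : Equiv.swap a b (σ j) ≠ b := fun hh => h (by
      have := congrArg (Equiv.swap a b) hh
      simpa using this)
    simp [h, h1]

theorem unitOp_comm {i j : ℤ} (hij : i ≠ j) (a b : Fin (c.dim i)) (a' b' : Fin (c.dim j)) :
    Commute (unitOp i a b) (unitOp j a' b') := by
  ext ψ σ
  rw [mul_apply_eq_comp, mul_apply_eq_comp]
  simp only [unitOp_apply, Function.update_of_ne hij, Function.update_of_ne hij.symm]
  rw [Function.update_comm hij]
  split_ifs <;> rfl

/-- The on-site algebra at `j` acting on `ℓ²`, as `M ⊗ 1`. -/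
def siteRep (j : ℤ) : c.OnSite j →⋆ₐ[ℂ] (c.Hilb →L[ℂ] c.Hilb) :=
  matrixUnitsHom (fun a b => unitOp j a b) (fun _ _ _ _ => unitOp_mul j _ _ _ _)
    (fun _ _ => unitOp_star j _ _) (unitOp_sum j)

theorem siteRep_comm {i j : ℤ} (hij : i ≠ j) (M : c.OnSite i) (N : c.OnSite j) :
    Commute (siteRep i M) (siteRep j N) :=
  Commute.sum_left _ _ _ fun _ _ => Commute.sum_left _ _ _ fun _ _ =>
    Commute.sum_right _ _ _ fun _ _ => Commute.sum_right _ _ _ fun _ _ =>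
      ((unitOp_comm hij _ _ _ _).smul_left _).smul_right _

variable (c)

/-- The quasi-local algebra inside the bounded operators: the norm closure of the star algebra
generated by all on-site algebras, i.e. of the union of the `A_S = ⊗_{j ∈ S} A_j`, `S` finite. -/
def quasiLocal : StarSubalgebra ℂ (c.Hilb →L[ℂ] c.Hilb) :=
  (StarAlgebra.adjoin ℂ (⋃ j, Set.range (siteRep (c := c) j))).topologicalClosure

/-- The spin chain algebra `A`, a unital C⋆-algebra. -/
def Alg : Type := c.quasiLocal

/-- The C⋆-algebra structure inherited from the bounded operators. -/
def algCStarAlgebra : CStarAlgebra c.Alg :=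
  StarSubalgebra.cstarAlgebra c.quasiLocal
    (h_closed := StarSubalgebra.isClosed_topologicalClosure _)

instance : CStarAlgebra c.Alg := c.algCStarAlgebra

variable {c}

theorem siteRep_mem (j : ℤ) (M : c.OnSite j) : siteRep j M ∈ c.quasiLocal :=
  StarSubalgebra.le_topologicalClosure _
    (StarAlgebra.subset_adjoin ℂ _ (Set.mem_iUnion.mpr ⟨j, M, rfl⟩))

/-- The inclusion of the on-site algebra at `j` into the spin chain algebra. -/
def site (j : ℤ) : c.OnSite j →⋆ₐ[ℂ] c.Alg :=
  StarAlgHom.codRestrict (siteRep j) c.quasiLocal (siteRep_mem j)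

theorem site_comm {i j : ℤ} (hij : i ≠ j) (M : c.OnSite i) (N : c.OnSite j) :
    Commute (site i M) (site j N) :=
  Subtype.ext (siteRep_comm hij M N)

variable (c)


/-- The inclusion of the spin chain algebra into the bounded operators. -/
def incl : c.Alg →⋆ₐ[ℂ] (c.Hilb →L[ℂ] c.Hilb) := c.quasiLocal.subtype

variable {c}

theorem incl_site (j : ℤ) (M : c.OnSite j) : c.incl (site j M) = siteRep j M := rfl

theorem incl_isometry : Isometry c.incl :=
  AddMonoidHomClass.isometry_of_norm _ fun _ => rfl

variable (c)

instance : Nontrivial c.Alg := by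
  classical
  obtain ⟨σ⟩ : Nonempty c.Conf := inferInstance
  refine ⟨⟨0, 1, fun h => ?_⟩⟩
  have h1 := congrArg c.incl h
  rw [map_zero, map_one] at h1
  have h2 : lp.single (E := fun _ : c.Conf => ℂ) 2 σ (1 : ℂ) σ = 0 := by
    have := congrArg (fun T : c.Hilb →L[ℂ] c.Hilb => T (lp.single 2 σ (1 : ℂ)) σ) h1
    simpa using this.symm
  rw [lp.single_apply_self] at h2
  exact one_ne_zero h2

/-- The subalgebra `A_X` of observables supported in `X ⊆ ℤ`: the norm closure of the star algebra
generated by the on-site algebras at the sites of `X`. -/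
def localAlg (X : Set ℤ) : StarSubalgebra ℂ c.Alg :=
  (StarAlgebra.adjoin ℂ (⋃ j ∈ X, Set.range (site (c := c) j))).topologicalClosure

variable {c}

theorem dense_sites :
    (StarAlgebra.adjoin ℂ (⋃ j, Set.range (site (c := c) j))).topologicalClosure = ⊤ := by
  rw [StarSubalgebra.eq_top_iff]
  intro x
  change x ∈ closure (StarAlgebra.adjoin ℂ (⋃ j, Set.range (site (c := c) j)) : Set c.Alg)
  rw [incl_isometry.isUniformInducing.isInducing.closure_eq_preimage_closure_image]
  have h : c.incl '' (StarAlgebra.adjoin ℂ (⋃ j, Set.range (site (c := c) j)) : Set c.Alg) =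
      (StarAlgebra.adjoin ℂ (⋃ j, Set.range (siteRep (c := c) j)) :
        Set (c.Hilb →L[ℂ] c.Hilb)) := by
    rw [← StarSubalgebra.coe_map, StarAlgHom.map_adjoin, Set.image_iUnion]
    congr 3
    funext j
    rw [← Set.range_comp]
    rfl
  rw [Set.mem_preimage, h]
  exact x.2

theorem continuous_hom {A B : Type*} [CStarAlgebra A] [CStarAlgebra B] (f : A →⋆ₐ[ℂ] B) :
    Continuous f :=
  AddMonoidHomClass.continuous_of_bound f 1 fun x => by
    rw [one_mul]; exact NonUnitalStarAlgHom.norm_apply_le f x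

/-- Star homomorphisms out of a spin chain algebra are determined by the on-site algebras. -/
theorem hom_ext {C : Type*} [CStarAlgebra C] {f g : c.Alg →⋆ₐ[ℂ] C}
    (h : ∀ j M, f (site j M) = g (site j M)) : f = g := by
  have h1 : (StarAlgebra.adjoin ℂ (⋃ j, Set.range (site (c := c) j))).topologicalClosure ≤
      StarAlgHom.equalizer f g := by
    refine StarSubalgebra.topologicalClosure_minimal (StarAlgebra.adjoin_le ?_)
      (isClosed_eq (continuous_hom f) (continuous_hom g))
    refine Set.iUnion_subset fun j => ?_
    rintro _ ⟨M, rfl⟩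
    exact h j M
  rw [dense_sites] at h1
  ext x
  exact h1 (StarSubalgebra.mem_top (x := x))

theorem exists_matrix_range {C : Type*} [Ring C] [StarRing C] [Algebra ℂ C] [StarModule ℂ C]
    (φ : ∀ j, c.OnSite j →⋆ₐ[ℂ] C)
    (hφ : ∀ i j, i ≠ j → ∀ M N, Commute (φ i M) (φ j N)) (S : Finset ℤ) :
    ∃ n : ℕ, 0 < n ∧ ∃ Ψ : Matrix (Fin n) (Fin n) ℂ →⋆ₐ[ℂ] C,
      (∀ j ∈ S, ∀ M, φ j M ∈ Ψ.range) ∧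
      Ψ.range ≤ StarAlgebra.adjoin ℂ (⋃ j ∈ S, Set.range (φ j)) := by
  classical
  induction S using Finset.induction_on with
  | empty =>
    refine ⟨1, one_pos, matrixUnitsHom (fun _ _ => 1) (fun i j k l => ?_) (fun _ _ => star_one C)
      (by simp), by simp, ?_⟩
    · simp [Subsingleton.elim j k]
    · rintro _ ⟨M, rfl⟩
      change (∑ i, ∑ j, M i j • (1 : C)) ∈ _
      refine sum_mem fun i _ => sum_mem fun j _ => ?_
      exact StarSubalgebra.smul_mem _ (one_mem _) _
  | insert i S hi ih =>
    obtain ⟨n, hn, Ψ, h1, h2⟩ := ih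
    have hcomm : ∀ M N, Commute (Ψ M) (φ i N) := by
      intro M N
      have h3 : StarAlgebra.adjoin ℂ (⋃ j ∈ S, Set.range (φ j)) ≤
          StarSubalgebra.centralizer ℂ (Set.range (φ i)) := by
        refine StarAlgebra.adjoin_le (Set.iUnion₂_subset fun j hj => ?_)
        rintro _ ⟨M', rfl⟩
        have hne : i ≠ j := fun h => hi (h ▸ hj)
        rw [SetLike.mem_coe, StarSubalgebra.mem_centralizer_iff]
        rintro _ ⟨N', rfl⟩
        rw [← map_star]
        exact ⟨hφ i j hne _ _, hφ i j hne _ _⟩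
      have h4 := h3 (h2 ⟨M, rfl⟩)
      rw [StarSubalgebra.mem_centralizer_iff] at h4
      exact (h4 _ ⟨N, rfl⟩).1.symm
    have hsub : StarAlgebra.adjoin ℂ (⋃ j ∈ S, Set.range (φ j)) ≤
        StarAlgebra.adjoin ℂ (⋃ j ∈ insert i S, Set.range (φ j)) :=
      StarAlgebra.adjoin_mono (Set.biUnion_subset_biUnion_left fun j hj =>
        Finset.mem_insert_of_mem hj)
    refine ⟨n * c.dim i, Nat.mul_pos hn (c.dim_pos i),
      matrixTensorHom finProdFinEquiv.symm Ψ (φ i) hcomm, ?_, ?_⟩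
    · intro j hj M
      rcases Finset.mem_insert.mp hj with rfl | hj
      · exact ⟨_, matrixTensorHom_kronRight _ _ _ hcomm M⟩
      · obtain ⟨M', hM'⟩ := h1 j hj M
        refine ⟨kronLeft finProdFinEquiv.symm M', ?_⟩
        rw [← hM']
        exact matrixTensorHom_kronLeft _ _ _ hcomm M'
    · rintro _ ⟨M, rfl⟩
      refine matrixTensorHom_mem _ _ _ _ _ (fun M => hsub (h2 ⟨M, rfl⟩)) (fun N => ?_) M
      exact StarAlgebra.subset_adjoin ℂ _
        (Set.mem_biUnion (Finset.mem_insert_self i S) ⟨N, rfl⟩)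

theorem mem_adjoin_finite {C : Type*} [Ring C] [StarRing C] [Algebra ℂ C] [StarModule ℂ C]
    (φ : ∀ j, c.OnSite j →⋆ₐ[ℂ] C) {x : C}
    (hx : x ∈ StarAlgebra.adjoin ℂ (⋃ j, Set.range (φ j))) :
    ∃ S : Finset ℤ, x ∈ StarAlgebra.adjoin ℂ (⋃ j ∈ S, Set.range (φ j)) := by
  classical
  have hmono : ∀ S T : Finset ℤ, S ⊆ T → StarAlgebra.adjoin ℂ (⋃ j ∈ S, Set.range (φ j)) ≤
      StarAlgebra.adjoin ℂ (⋃ j ∈ T, Set.range (φ j)) := fun S T h =>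
    StarAlgebra.adjoin_mono (Set.biUnion_subset_biUnion_left h)
  induction hx using StarAlgebra.adjoin_induction with
  | mem x hx =>
    obtain ⟨j, M, rfl⟩ := Set.mem_iUnion.mp hx
    exact ⟨{j}, StarAlgebra.subset_adjoin ℂ _
      (Set.mem_biUnion (Finset.mem_singleton_self j) ⟨M, rfl⟩)⟩
  | algebraMap r => exact ⟨∅, algebraMap_mem _ r⟩
  | add x y _ _ hx hy =>
    obtain ⟨S, hS⟩ := hx
    obtain ⟨T, hT⟩ := hy
    exact ⟨S ∪ T, add_mem (hmono _ _ Finset.subset_union_left hS)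
      (hmono _ _ Finset.subset_union_right hT)⟩
  | mul x y _ _ hx hy =>
    obtain ⟨S, hS⟩ := hx
    obtain ⟨T, hT⟩ := hy
    exact ⟨S ∪ T, mul_mem (hmono _ _ Finset.subset_union_left hS)
      (hmono _ _ Finset.subset_union_right hT)⟩
  | star x _ hx =>
    obtain ⟨S, hS⟩ := hx
    exact ⟨S, star_mem hS⟩

/-- The universal property of the spin chain algebra: star homomorphisms of the on-site algebras
into a C⋆-algebra whose ranges commute with one another extend to the spin chain algebra. -/
theorem exists_lift {C : Type*} [CStarAlgebra C] (φ : ∀ j, c.OnSite j →⋆ₐ[ℂ] C)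
    (hφ : ∀ i j, i ≠ j → ∀ M N, Commute (φ i M) (φ j N)) :
    ∃ Φ : c.Alg →⋆ₐ[ℂ] C, ∀ j M, Φ (site j M) = φ j M := by
  let ψ : ∀ j, c.OnSite j →⋆ₐ[ℂ] c.Alg × C := fun j => (site j).prod (φ j)
  have hψ : ∀ i j, i ≠ j → ∀ M N, Commute (ψ i M) (ψ j N) := fun i j hij M N =>
    Prod.ext (site_comm hij M N) (hφ i j hij M N)
  let Γ₀ : StarSubalgebra ℂ (c.Alg × C) := StarAlgebra.adjoin ℂ (⋃ j, Set.range (ψ j))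
  let Γ := Γ₀.topologicalClosure
  have hΓ₀ : ∀ x ∈ Γ₀, ‖x.2‖ ≤ ‖x.1‖ := by
    intro x hx
    obtain ⟨S, hS⟩ := mem_adjoin_finite ψ hx
    obtain ⟨n, hn, Ψ, h1, -⟩ := exists_matrix_range ψ hψ S
    have h2 : StarAlgebra.adjoin ℂ (⋃ j ∈ S, Set.range (ψ j)) ≤ Ψ.range := by
      refine StarAlgebra.adjoin_le (Set.iUnion₂_subset fun j hj => ?_)
      rintro _ ⟨M, rfl⟩
      exact h1 j hj M
    obtain ⟨M, rfl⟩ := h2 hS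
    have : Nonempty (Fin n) := ⟨⟨0, hn⟩⟩
    let f : Matrix (Fin n) (Fin n) ℂ →⋆ₐ[ℂ] c.Alg := (StarAlgHom.fst ℂ c.Alg C).comp Ψ
    let g : Matrix (Fin n) (Fin n) ℂ →⋆ₐ[ℂ] C := (StarAlgHom.snd ℂ c.Alg C).comp Ψ
    have hf : Function.Injective f := RingHom.injective (f : Matrix (Fin n) (Fin n) ℂ →+* c.Alg)
    open scoped Matrix.Norms.L2Operator in
    calc ‖(Ψ M).2‖ = ‖g M‖ := rfl
      _ ≤ ‖M‖ := NonUnitalStarAlgHom.norm_apply_le g M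
      _ = ‖f M‖ := (NonUnitalStarAlgHom.norm_map f hf M).symm
      _ = ‖(Ψ M).1‖ := rfl
  have hΓ : ∀ x ∈ Γ, ‖x.2‖ ≤ ‖x.1‖ := by
    have h1 : closure (Γ₀ : Set (c.Alg × C)) ⊆ {x | ‖x.2‖ ≤ ‖x.1‖} :=
      closure_minimal hΓ₀ (isClosed_le (by fun_prop) (by fun_prop))
    exact fun x hx => h1 hx
  let p : Γ →⋆ₐ[ℂ] c.Alg := (StarAlgHom.fst ℂ c.Alg C).comp Γ.subtype
  have hp : Isometry p := AddMonoidHomClass.isometry_of_norm _ fun x => by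
    change ‖(x : c.Alg × C).1‖ = ‖(x : c.Alg × C)‖
    rw [Prod.norm_def, max_eq_left (hΓ x x.2)]
  have hψΓ : ∀ j M, ψ j M ∈ Γ := fun j M => StarSubalgebra.le_topologicalClosure _
    (StarAlgebra.subset_adjoin ℂ _ (Set.mem_iUnion.mpr ⟨j, M, rfl⟩))
  have hsurj : Function.Surjective p := by
    have hcl : IsClosed (p.range : Set c.Alg) := by
      have : CompleteSpace Γ := inferInstance
      have h1 := hp.isClosedEmbedding.isClosed_range
      exact h1
    have h1 : (StarAlgebra.adjoin ℂ (⋃ j, Set.range (site (c := c) j))).topologicalClosure ≤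
        p.range := by
      refine StarSubalgebra.topologicalClosure_minimal (StarAlgebra.adjoin_le
        (Set.iUnion_subset fun j => ?_)) hcl
      rintro _ ⟨M, rfl⟩
      exact ⟨⟨ψ j M, hψΓ j M⟩, rfl⟩
    rw [dense_sites] at h1
    exact fun x => h1 (StarSubalgebra.mem_top (x := x))
  let e : Γ ≃⋆ₐ[ℂ] c.Alg := StarAlgEquiv.ofBijective p ⟨hp.injective, hsurj⟩
  refine ⟨(StarAlgHom.snd ℂ c.Alg C).comp (Γ.subtype.comp (e.symm : c.Alg →⋆ₐ[ℂ] Γ)), ?_⟩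
  intro j M
  have h1 : e.symm (site j M) = ⟨ψ j M, hψΓ j M⟩ := by
    rw [← e.symm_apply_apply ⟨ψ j M, hψΓ j M⟩]
    rfl
  change ((e.symm (site j M) : Γ) : c.Alg × C).2 = φ j M
  rw [h1]
  rfl

/-- The extension of commuting star homomorphisms of the on-site algebras. -/
def lift {C : Type*} [CStarAlgebra C] (φ : ∀ j, c.OnSite j →⋆ₐ[ℂ] C)
    (hφ : ∀ i j, i ≠ j → ∀ M N, Commute (φ i M) (φ j N)) : c.Alg →⋆ₐ[ℂ] C :=
  (exists_lift φ hφ).choose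

theorem lift_site {C : Type*} [CStarAlgebra C] (φ : ∀ j, c.OnSite j →⋆ₐ[ℂ] C)
    (hφ : ∀ i j, i ≠ j → ∀ M N, Commute (φ i M) (φ j N)) (j : ℤ) (M : c.OnSite j) :
    lift φ hφ (site j M) = φ j M :=
  (exists_lift φ hφ).choose_spec j M


/-! ### Stacking of spin chains -/

/-- The stack `A ⊗ B` of two spin chains, with on-site algebras `A_j ⊗ B_j`. -/
def stack (c c' : SpinChain) : SpinChain where
  dim j := c.dim j * c'.dim j
  dim_pos j := Nat.mul_pos (c.dim_pos j) (c'.dim_pos j)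
  bounded := by
    obtain ⟨D, hD⟩ := c.bounded
    obtain ⟨D', hD'⟩ := c'.bounded
    exact ⟨D * D', fun j => Nat.mul_le_mul (hD j) (hD' j)⟩

variable {c c' : SpinChain}

/-- The identification of the basis of `ℂ^{d_j d'_j}` with that of `ℂ^{d_j} ⊗ ℂ^{d'_j}`. -/
def stackIndex (c c' : SpinChain) (j : ℤ) :
    Fin ((c.stack c').dim j) ≃ Fin (c.dim j) × Fin (c'.dim j) :=
  (finProdFinEquiv (m := c.dim j) (n := c'.dim j)).symm

/-- The embedding `A → A ⊗ B`, `a ↦ a ⊗ 1`. -/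
def inl (c c' : SpinChain) : c.Alg →⋆ₐ[ℂ] (c.stack c').Alg :=
  lift (fun j => (site (c := c.stack c') j).comp (kronLeft (stackIndex c c' j)))
    (fun _ _ hij _ _ => site_comm hij _ _)

/-- The embedding `B → A ⊗ B`, `b ↦ 1 ⊗ b`. -/
def inr (c c' : SpinChain) : c'.Alg →⋆ₐ[ℂ] (c.stack c').Alg :=
  lift (fun j => (site (c := c.stack c') j).comp (kronRight (stackIndex c c' j)))
    (fun _ _ hij _ _ => site_comm hij _ _)

theorem inl_site (j : ℤ) (M : c.OnSite j) :
    inl c c' (site j M) = site (c := c.stack c') j (kronLeft (stackIndex c c' j) M) :=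
  lift_site _ _ j M

theorem inr_site (j : ℤ) (M : c'.OnSite j) :
    inr c c' (site j M) = site (c := c.stack c') j (kronRight (stackIndex c c' j) M) :=
  lift_site _ _ j M

/-- An element commuting with the image of every on-site algebra (hence with its adjoints) commutes
with the image of the whole spin chain algebra. -/
theorem commute_of_sites {C : Type*} [CStarAlgebra C] (f : c.Alg →⋆ₐ[ℂ] C) (y : C)
    (h : ∀ j M, Commute (f (site j M)) y) (x : c.Alg) : Commute (f x) y := by
  have h1 : (StarAlgebra.adjoin ℂ (⋃ j, Set.range (site (c := c) j))).topologicalClosure ≤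
      (StarSubalgebra.centralizer ℂ {y}).comap f := by
    refine StarSubalgebra.topologicalClosure_minimal (StarAlgebra.adjoin_le ?_) ?_
    · refine Set.iUnion_subset fun j => ?_
      rintro _ ⟨M, rfl⟩
      rw [SetLike.mem_coe, StarSubalgebra.mem_comap, StarSubalgebra.mem_centralizer_iff]
      rintro _ rfl
      refine ⟨(h j M).symm, ?_⟩
      have := congrArg star (h j (star M)).eq
      simpa [map_star] using this
    · rw [StarSubalgebra.coe_comap, StarSubalgebra.coe_centralizer]
      exact (Set.isClosed_centralizer _).preimage (continuous_hom f)
  rw [dense_sites] at h1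
  have h2 := h1 (StarSubalgebra.mem_top (x := x))
  rw [StarSubalgebra.mem_comap, StarSubalgebra.mem_centralizer_iff] at h2
  exact (h2 y rfl).1.symm

theorem inl_inr_commute (x : c.Alg) (y : c'.Alg) : Commute (inl c c' x) (inr c c' y) := by
  refine commute_of_sites _ _ (fun j M => ?_) x
  refine (commute_of_sites _ _ (fun i N => ?_) y).symm
  rw [inl_site, inr_site]
  by_cases hij : i = j
  · subst hij
    exact ((commute_kronLeft_kronRight _ _ _).map (site (c := c.stack c') i)).symm
  · exact site_comm hij _ _

theorem stack_hom_ext {C : Type*} [CStarAlgebra C] {f g : (c.stack c').Alg →⋆ₐ[ℂ] C}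
    (hl : ∀ x, f (inl c c' x) = g (inl c c' x)) (hr : ∀ y, f (inr c c' y) = g (inr c c' y)) :
    f = g := by
  refine hom_ext fun j M => ?_
  have : f.comp (site (c := c.stack c') j) = g.comp (site (c := c.stack c') j) := by
    refine matrixHom_ext fun p q => ?_
    rw [StarAlgHom.comp_apply, StarAlgHom.comp_apply, single_eq_kron (stackIndex c c' j), map_mul,
      map_mul, map_mul, ← inl_site, ← inr_site, hl, hr]
  exact DFunLike.congr_fun this M

/-- The star homomorphism `A ⊗ B → C` with `a ⊗ b ↦ F a * G b`, for star homomorphisms with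
commuting ranges. -/
def stackLift {C : Type*} [CStarAlgebra C] (F : c.Alg →⋆ₐ[ℂ] C) (G : c'.Alg →⋆ₐ[ℂ] C)
    (h : ∀ x y, Commute (F x) (G y)) : (c.stack c').Alg →⋆ₐ[ℂ] C :=
  lift (fun j => matrixTensorHom (stackIndex c c' j) (F.comp (site j)) (G.comp (site j))
      (fun _ _ => h _ _))
    (by
      intro i j hij M N
      have hF : ∀ M' N', Commute (F (site i M')) (F (site j N')) := fun M' N' =>
        (site_comm hij M' N').map F
      have hG : ∀ M' N', Commute (G (site i M')) (G (site j N')) := fun M' N' =>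
        (site_comm hij M' N').map G
      refine matrixTensorHom_commute _ _ _ _ _ (fun M' => ?_) (fun M' => ?_) M
      · exact (matrixTensorHom_commute _ _ _ _ _ (fun N' => (hF M' N').symm)
          (fun N' => (h _ _).symm) N).symm
      · exact (matrixTensorHom_commute _ _ _ _ _ (fun N' => h _ _)
          (fun N' => (hG M' N').symm) N).symm)

theorem stackLift_inl {C : Type*} [CStarAlgebra C] (F : c.Alg →⋆ₐ[ℂ] C) (G : c'.Alg →⋆ₐ[ℂ] C)
    (h : ∀ x y, Commute (F x) (G y)) (x : c.Alg) : stackLift F G h (inl c c' x) = F x := by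
  suffices hh : (stackLift F G h).comp (inl c c') = F from DFunLike.congr_fun hh x
  refine hom_ext fun j M => ?_
  rw [StarAlgHom.comp_apply, inl_site, stackLift, lift_site]
  exact matrixTensorHom_kronLeft _ _ _ _ M

theorem stackLift_inr {C : Type*} [CStarAlgebra C] (F : c.Alg →⋆ₐ[ℂ] C) (G : c'.Alg →⋆ₐ[ℂ] C)
    (h : ∀ x y, Commute (F x) (G y)) (y : c'.Alg) : stackLift F G h (inr c c' y) = G y := by
  suffices hh : (stackLift F G h).comp (inr c c') = G from DFunLike.congr_fun hh y
  refine hom_ext fun j M => ?_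
  rw [StarAlgHom.comp_apply, inr_site, stackLift, lift_site]
  exact matrixTensorHom_kronRight _ _ _ _ M

/-- The endomorphism `f ⊗ g` of `A ⊗ B`. -/
def stackHom (f : c.Alg →⋆ₐ[ℂ] c.Alg) (g : c'.Alg →⋆ₐ[ℂ] c'.Alg) :
    (c.stack c').Alg →⋆ₐ[ℂ] (c.stack c').Alg :=
  stackLift ((inl c c').comp f) ((inr c c').comp g) (fun _ _ => inl_inr_commute _ _)

theorem stackHom_inl (f : c.Alg →⋆ₐ[ℂ] c.Alg) (g : c'.Alg →⋆ₐ[ℂ] c'.Alg) (x : c.Alg) :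
    stackHom f g (inl c c' x) = inl c c' (f x) := stackLift_inl _ _ _ _

theorem stackHom_inr (f : c.Alg →⋆ₐ[ℂ] c.Alg) (g : c'.Alg →⋆ₐ[ℂ] c'.Alg) (y : c'.Alg) :
    stackHom f g (inr c c' y) = inr c c' (g y) := stackLift_inr _ _ _ _

theorem stackHom_comp (f f' : c.Alg →⋆ₐ[ℂ] c.Alg) (g g' : c'.Alg →⋆ₐ[ℂ] c'.Alg) :
    (stackHom f g).comp (stackHom f' g') = stackHom (f.comp f') (g.comp g') := by
  refine stack_hom_ext (fun x => ?_) (fun y => ?_)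
  · simp only [StarAlgHom.comp_apply, stackHom_inl]
  · simp only [StarAlgHom.comp_apply, stackHom_inr]

theorem stackHom_id : stackHom (StarAlgHom.id ℂ c.Alg) (StarAlgHom.id ℂ c'.Alg) =
    StarAlgHom.id ℂ (c.stack c').Alg := by
  refine stack_hom_ext (fun x => ?_) (fun y => ?_)
  · rw [stackHom_inl]; rfl
  · rw [stackHom_inr]; rfl

/-- The automorphism `a ⊗ b` of `A ⊗ B`. -/
def stackAut (a : c.Alg ≃⋆ₐ[ℂ] c.Alg) (b : c'.Alg ≃⋆ₐ[ℂ] c'.Alg) :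
    (c.stack c').Alg ≃⋆ₐ[ℂ] (c.stack c').Alg :=
  StarAlgEquiv.ofBijective (stackHom (a : c.Alg →⋆ₐ[ℂ] c.Alg) (b : c'.Alg →⋆ₐ[ℂ] c'.Alg)) <| by
    have h : ∀ (a₁ a₂ : c.Alg ≃⋆ₐ[ℂ] c.Alg) (b₁ b₂ : c'.Alg ≃⋆ₐ[ℂ] c'.Alg),
        (∀ x, a₁ (a₂ x) = x) → (∀ y, b₁ (b₂ y) = y) → ∀ z,
          stackHom (a₁ : c.Alg →⋆ₐ[ℂ] c.Alg) (b₁ : c'.Alg →⋆ₐ[ℂ] c'.Alg)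
            (stackHom (a₂ : c.Alg →⋆ₐ[ℂ] c.Alg) (b₂ : c'.Alg →⋆ₐ[ℂ] c'.Alg) z) = z := by
      intro a₁ a₂ b₁ b₂ ha hb z
      rw [← StarAlgHom.comp_apply, stackHom_comp]
      have h1 : (a₁ : c.Alg →⋆ₐ[ℂ] c.Alg).comp (a₂ : c.Alg →⋆ₐ[ℂ] c.Alg) =
          StarAlgHom.id ℂ c.Alg := by ext x; exact ha x
      have h2 : (b₁ : c'.Alg →⋆ₐ[ℂ] c'.Alg).comp (b₂ : c'.Alg →⋆ₐ[ℂ] c'.Alg) =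
          StarAlgHom.id ℂ c'.Alg := by ext x; exact hb x
      rw [h1, h2, stackHom_id]
      rfl
    exact Function.bijective_iff_has_inverse.mpr
      ⟨stackHom (a.symm : c.Alg →⋆ₐ[ℂ] c.Alg) (b.symm : c'.Alg →⋆ₐ[ℂ] c'.Alg),
        h a.symm a b.symm b a.symm_apply_apply b.symm_apply_apply,
        h a a.symm b b.symm a.apply_symm_apply b.apply_symm_apply⟩

theorem stackAut_inl (a : c.Alg ≃⋆ₐ[ℂ] c.Alg) (b : c'.Alg ≃⋆ₐ[ℂ] c'.Alg) (x : c.Alg) :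
    stackAut a b (inl c c' x) = inl c c' (a x) := stackHom_inl _ _ _

theorem stackAut_inr (a : c.Alg ≃⋆ₐ[ℂ] c.Alg) (b : c'.Alg ≃⋆ₐ[ℂ] c'.Alg) (y : c'.Alg) :
    stackAut a b (inr c c' y) = inr c c' (b y) := stackHom_inr _ _ _

theorem stackAut_ext {f g : (c.stack c').Alg ≃⋆ₐ[ℂ] (c.stack c').Alg}
    (hl : ∀ x, f (inl c c' x) = g (inl c c' x)) (hr : ∀ y, f (inr c c' y) = g (inr c c' y)) :
    f = g := by
  have h : (f : (c.stack c').Alg →⋆ₐ[ℂ] (c.stack c').Alg) =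
      (g : (c.stack c').Alg →⋆ₐ[ℂ] (c.stack c').Alg) := stack_hom_ext hl hr
  ext x
  exact DFunLike.congr_fun h x

/-! ### Quantum cellular automata and circuits -/

/-- The `r`-fattening of `X ⊆ ℤ`. -/
def fatten (X : Set ℤ) (r : ℕ) : Set ℤ := {j | ∃ i ∈ X, |j - i| ≤ r}

/-- The automorphism `a` satisfies `a(A_X) ⊆ A_{X^{(r)}}` for all `X ⊆ ℤ`, i.e. it is a quantum
cellular automaton of range at most `r`. -/
def HasRange (a : c.Alg ≃⋆ₐ[ℂ] c.Alg) (r : ℕ) : Prop :=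
  ∀ X : Set ℤ, ∀ x ∈ c.localAlg X, a x ∈ c.localAlg (fatten X r)

/-- Quantum cellular automata. -/
def IsQCA (a : c.Alg ≃⋆ₐ[ℂ] c.Alg) : Prop := ∃ r, HasRange a r

/-- `Ad(U) : x ↦ U x U*`. -/
abbrev Ad (U : unitary c.Alg) : c.Alg ≃⋆ₐ[ℂ] c.Alg := Unitary.conjStarAlgAut ℂ c.Alg U

/-- A partition of `ℤ` into nonempty intervals of bounded size, given by its increasing sequence of
left end points: the blocks are `I_a = [left a, left (a + 1))`. -/
structure BlockPartition where
  left : ℤ → ℤ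
  strictMono : StrictMono left
  bounded : ∃ K : ℤ, ∀ a, left (a + 1) - left a ≤ K

/-- The blocks of a partition into intervals. -/
def BlockPartition.block (P : BlockPartition) (a : ℤ) : Set ℤ :=
  Set.Ico (P.left a) (P.left (a + 1))

/-- `b = ⨂_a Ad(U_a)` for unitaries `U_a ∈ A_{I_a}`, where `I_a` are the blocks of `P`: the
automorphism `b` acts on each `A_{I_a}` as `Ad(U_a)`. -/
def IsBlockPartitionedOn (P : BlockPartition) (b : c.Alg ≃⋆ₐ[ℂ] c.Alg) : Prop :=
  ∃ U : ℤ → unitary c.Alg, ∀ a, (U a : c.Alg) ∈ c.localAlg (P.block a) ∧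
    ∀ x ∈ c.localAlg (P.block a), b x = Ad (U a) x

/-- Block partitioned quantum cellular automata. -/
def IsBlockPartitioned (b : c.Alg ≃⋆ₐ[ℂ] c.Alg) : Prop := ∃ P, IsBlockPartitionedOn P b

/-- Finite depth quantum circuits: finite compositions of block partitioned automata. -/
def IsFDQC (b : c.Alg ≃⋆ₐ[ℂ] c.Alg) : Prop :=
  ∃ l : List (c.Alg ≃⋆ₐ[ℂ] c.Alg), (∀ a ∈ l, IsBlockPartitioned a) ∧ b = l.prod

/-- Isomorphisms of spin chains: star isomorphisms that map each on-site algebra onto the on-site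
algebra at the same site. -/
def IsOnSiteIso (φ : c.Alg ≃⋆ₐ[ℂ] c'.Alg) : Prop :=
  ∀ j x, φ x ∈ c'.localAlg {j} ↔ x ∈ c.localAlg {j}

theorem localAlg_mono {X Y : Set ℤ} (h : X ⊆ Y) : c.localAlg X ≤ c.localAlg Y :=
  StarSubalgebra.topologicalClosure_mono
    (StarAlgebra.adjoin_mono (Set.biUnion_subset_biUnion_left h))

theorem site_mem_localAlg {X : Set ℤ} {j : ℤ} (hj : j ∈ X) (M : c.OnSite j) :
    site j M ∈ c.localAlg X :=
  StarSubalgebra.le_topologicalClosure _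
    (StarAlgebra.subset_adjoin ℂ _ (Set.mem_biUnion hj ⟨M, rfl⟩))

theorem hom_localAlg_mem {C : Type*} [CStarAlgebra C] (f : c.Alg →⋆ₐ[ℂ] C) (X : Set ℤ)
    (S : StarSubalgebra ℂ C) (hS : IsClosed (S : Set C)) (h : ∀ j ∈ X, ∀ M, f (site j M) ∈ S)
    {x : c.Alg} (hx : x ∈ c.localAlg X) : f x ∈ S := by
  have h1 : c.localAlg X ≤ S.comap f := by
    refine StarSubalgebra.topologicalClosure_minimal (StarAlgebra.adjoin_le ?_)
      (hS.preimage (continuous_hom f))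
    refine Set.iUnion₂_subset fun j hj => ?_
    rintro _ ⟨M, rfl⟩
    exact h j hj M
  exact h1 hx

theorem isClosed_localAlg (X : Set ℤ) : IsClosed (c.localAlg X : Set c.Alg) :=
  StarSubalgebra.isClosed_topologicalClosure _

theorem HasRange.mono {a : c.Alg ≃⋆ₐ[ℂ] c.Alg} {r s : ℕ} (h : HasRange a r) (hrs : r ≤ s) :
    HasRange a s := fun X x hx =>
  localAlg_mono (X := fatten X r) (fun _ hj => by
    obtain ⟨i, hi, hij⟩ := hj
    exact ⟨i, hi, hij.trans (by exact_mod_cast hrs)⟩) (h X x hx)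

theorem HasRange.stackAut {a : c.Alg ≃⋆ₐ[ℂ] c.Alg} {b : c'.Alg ≃⋆ₐ[ℂ] c'.Alg} {r : ℕ}
    (ha : HasRange a r) (hb : HasRange b r) : HasRange (stackAut a b) r := by
  intro X x hx
  refine hom_localAlg_mem (SpinChain.stackAut a b : (c.stack c').Alg →⋆ₐ[ℂ] (c.stack c').Alg) X _
    (isClosed_localAlg _) (fun j hj M => ?_) hx
  have hl : ∀ M, SpinChain.stackAut a b (inl c c' (site j M)) ∈
      (c.stack c').localAlg (fatten X r) := by
    intro M
    rw [stackAut_inl]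
    refine hom_localAlg_mem (inl c c') (fatten X r) _ (isClosed_localAlg _) (fun i hi N => ?_)
      (ha X _ (site_mem_localAlg hj M))
    rw [inl_site]
    exact site_mem_localAlg hi _
  have hr : ∀ M, SpinChain.stackAut a b (inr c c' (site j M)) ∈
      (c.stack c').localAlg (fatten X r) := by
    intro M
    rw [stackAut_inr]
    refine hom_localAlg_mem (inr c c') (fatten X r) _ (isClosed_localAlg _) (fun i hi N => ?_)
      (hb X _ (site_mem_localAlg hj M))
    rw [inr_site]
    exact site_mem_localAlg hi _
  change SpinChain.stackAut a b (site j M) ∈ _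
  rw [Matrix.matrix_eq_sum_single M]
  simp only [map_sum]
  refine sum_mem fun p _ => sum_mem fun q _ => ?_
  have h1 : Matrix.single p q (M p q) = M p q • Matrix.single p q (1 : ℂ) := by simp
  rw [h1, map_smul, map_smul, single_eq_kron (stackIndex c c' j), map_mul, map_mul, ← inl_site,
    ← inr_site]
  exact StarSubalgebra.smul_mem _ (mul_mem (hl _) (hr _)) _

end SpinChain

/-! ### Locality preserving symmetries -/

open SpinChain

/-- A (locality preserving) `G`-symmetry on the spin chain `c`: a group homomorphism from `G` to the
quantum cellular automata. -/
structure Symm (G : Type*) [Group G] (c : SpinChain) where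
  hom : G →* (c.Alg ≃⋆ₐ[ℂ] c.Alg)
  isQCA : ∀ g, IsQCA (hom g)

namespace Symm

variable {G : Type*} [Group G] {c c' : SpinChain}

instance : CoeFun (Symm G c) (fun _ => G → (c.Alg ≃⋆ₐ[ℂ] c.Alg)) := ⟨fun α => α.hom⟩

/-- The range of the symmetry is at most `R`. -/
def RangeLE (α : Symm G c) (R : ℕ) : Prop := ∀ g, HasRange (α g) R

/-- The symmetry is decoupled: all components are block partitioned, with common blocks. -/
def IsDecoupled (α : Symm G c) : Prop := ∃ P : BlockPartition, ∀ g, IsBlockPartitionedOn P (α g)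

/-- The stack `α ⊗ β` of two symmetries. -/
def stack (α : Symm G c) (β : Symm G c') : Symm G (c.stack c') where
  hom :=
    { toFun := fun g => stackAut (α g) (β g)
      map_one' := stackAut_ext (fun x => by rw [stackAut_inl, map_one]; rfl)
        (fun y => by rw [stackAut_inr, map_one]; rfl)
      map_mul' := fun g h => stackAut_ext
        (fun x => by
          rw [stackAut_inl, map_mul, StarAlgEquiv.mul_apply, StarAlgEquiv.mul_apply, stackAut_inl,
            stackAut_inl])
        (fun y => by
          rw [stackAut_inr, map_mul, StarAlgEquiv.mul_apply, StarAlgEquiv.mul_apply, stackAut_inr,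
            stackAut_inr]) }
  isQCA g := by
    obtain ⟨r, hr⟩ := α.isQCA g
    obtain ⟨s, hs⟩ := β.isQCA g
    exact ⟨max r s, (hr.mono (le_max_left r s)).stackAut (hs.mono (le_max_right r s))⟩

/-- `α' ∼₀ α`: up to an isomorphism of the underlying spin chains, `α' = γ⁻¹ ∘ α ∘ γ` for a finite
depth quantum circuit `γ`. (If `c = c'`, then isomorphisms of the spin chain are themselves
circuits of depth one.) -/
def Equivalent (α' : Symm G c') (α : Symm G c) : Prop :=
  ∃ φ : c'.Alg ≃⋆ₐ[ℂ] c.Alg, IsOnSiteIso φ ∧ ∃ γ : c.Alg ≃⋆ₐ[ℂ] c.Alg, IsFDQC γ ∧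
    ∀ g x, φ (α' g x) = γ⁻¹ (α g (γ (φ x)))

/-- A right restriction of `α` at `j` with defect size `L`. -/
def IsRightRestriction (α : Symm G c) (j : ℤ) (L : ℕ) (ρ : G → (c.Alg ≃⋆ₐ[ℂ] c.Alg)) : Prop :=
  ∀ g, (∀ x ∈ c.localAlg (Set.Ici (j + L)), ρ g x = α g x) ∧
    ∀ x ∈ c.localAlg (Set.Iio (j - L)), ρ g x = x

end Symm

/-- Fusion operators associated to the automorphisms `ρ g`: unitaries with
`ρ g ∘ ρ h = Ad(F(g, h)) ∘ ρ (g h)`. -/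
def IsFusion {G : Type*} [Group G] {c : SpinChain} (ρ : G → (c.Alg ≃⋆ₐ[ℂ] c.Alg))
    (F : G → G → unitary c.Alg) : Prop :=
  ∀ g h, ρ g * ρ h = Ad (F g h) * ρ (g * h)

/-- The phases `ω` relating the fusion operators `F` of `ρ`:
`F(f, g) F(fg, h) = ω(f, g, h) ρ_f(F(g, h)) F(f, gh)`. -/
def IsFusionPhase {G : Type*} [Group G] {c : SpinChain} (ρ : G → (c.Alg ≃⋆ₐ[ℂ] c.Alg))
    (F : G → G → unitary c.Alg) (ω : G → G → G → Circle) : Prop :=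
  ∀ f g h, (F f g : c.Alg) * F (f * g) h =
    (ω f g h : ℂ) • (ρ f (F g h : c.Alg) * (F f (g * h) : c.Alg))

/-- All `G`-symmetries on arbitrary spin chains. -/
abbrev AllSymm (G : Type*) [Group G] : Type _ := Σ c : SpinChain, Symm G c

/-- Stable equivalence: equivalence after stacking with symmetries of range `0`. -/
def StableEquiv {G : Type*} [Group G] (α α' : AllSymm G) : Prop :=
  ∃ β β' : AllSymm G, β.2.RangeLE 0 ∧ β'.2.RangeLE 0 ∧
    (α.2.stack β.2).Equivalent (α'.2.stack β'.2)

/-! ### The third cohomology group -/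

/-- The group cohomology `H³(G, U(1))`, for the trivial action on `U(1)`, written multiplicatively. -/
abbrev H3 (G : Type) [Group G] : Type :=
  Multiplicative (groupCohomology (Rep.trivial ℤ G (Additive Circle)) 3)

/-- The cocycle condition for `ω : G³ → U(1)`. -/
def IsThreeCocycle {G : Type*} [Group G] (ω : G → G → G → Circle) : Prop :=
  ∀ f g h k, 1 = (ω g h k * ω f (g * h) k * ω f g h) / (ω (f * g) h k * ω f g (h * k))

/-- `ω` as an inhomogeneous cochain. -/
def cochain {G : Type} [Group G] (ω : G → G → G → Circle) :
    (Fin 3 → G) → Rep.trivial ℤ G (Additive Circle) :=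
  fun v => Additive.ofMul (ω (v 0) (v 1) (v 2))

theorem d_cochain {G : Type} [Group G] {ω : G → G → G → Circle} (hω : IsThreeCocycle ω) :
    inhomogeneousCochains.d (Rep.trivial ℤ G (Additive Circle)) 3 (cochain ω)
      = 0 := by
  funext v
  rw [inhomogeneousCochains.d_hom_apply]
  have h := hω (v 0) (v 1) (v 2) (v 3)
  simp only [Fin.sum_univ_succ, cochain]
  change Additive.ofMul (ω (v 1) (v 2) (v 3)) +
      ((-1 : ℤ) ^ (0 + 1) • Additive.ofMul (ω (v 0 * v 1) (v 2) (v 3)) +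
        ((-1 : ℤ) ^ (1 + 1) • Additive.ofMul (ω (v 0) (v 1 * v 2) (v 3)) +
          ((-1 : ℤ) ^ (2 + 1) • Additive.ofMul (ω (v 0) (v 1) (v 2 * v 3)) +
            ((-1 : ℤ) ^ (3 + 1) • Additive.ofMul (ω (v 0) (v 1) (v 2)) + 0)))) = 0
  have h' := congrArg Additive.ofMul h
  simp only [ofMul_one, ofMul_div, ofMul_mul] at h'
  refine Eq.trans ?_ h'.symm
  simp only [pow_succ, pow_zero, mul_neg, mul_one, neg_neg, neg_smul, one_smul]
  abel

/-- The class in `H³(G, U(1))` of a 3-cocycle. -/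
def cocycleClass {G : Type} [Group G] (ω : G → G → G → Circle) (hω : IsThreeCocycle ω) : H3 G :=
  Multiplicative.ofAdd (groupCohomology.π (Rep.trivial ℤ G (Additive Circle)) 3
    (groupCohomology.cocyclesMk (cochain ω) (d_cochain hω)))

/-- `Ω` assigns to every symmetry the class of the phases `ω_j` obtained from an arbitrary choice of
site, defect size, right restriction and fusion operators. -/
def IsAnomaly {G : Type} [Group G] (Ω : AllSymm G → H3 G) : Prop :=
  ∀ (c : SpinChain) (α : Symm G c) (j : ℤ) (L : ℕ) (ρ : G → (c.Alg ≃⋆ₐ[ℂ] c.Alg))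
    (F : G → G → unitary c.Alg) (ω : G → G → G → Circle) (hω : IsThreeCocycle ω),
    α.IsRightRestriction j L ρ → IsFusion ρ F → IsFusionPhase ρ F ω →
      cocycleClass ω hω = Ω ⟨c, α⟩

end

/-! The anomaly measures the failure of a restricted symmetry to be associative. A right restriction
`ρ` of `α` need not be a homomorphism, but `ρ g * ρ k * (ρ (g * k))⁻¹` fixes every site away from
the cut. An automorphism that fixes all sites outside a finite set is conjugation with a unitary
supported there (`exists_eq_Ad`, a form of Skolem–Noether), and this produces the fusion operators.
Since the algebra has trivial center, an implementing unitary is unique up to a phase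
(`exists_phase_of_Ad_eq`). Both sides of the relation that defines `ω` implement `ρ f * ρ g * ρ h *
(ρ (f * g * h))⁻¹`, so `ω` exists and is unique. Reordering a product of three fusion operators in
two ways gives the cocycle equation. Other fusion operators change `ω` by a coboundary. Any other
restriction has the form `Ad (V g) * ρ g` once both are seen with a common defect size, and it
admits fusion operators with the same `ω`.

The hard point is the existence of a restriction. It should be the identity on the sites below `b`,
equal `α g` on the sites from `m` on, and map the sites in `[b, m)` onto the boundary algebra, that
is, onto the observables on `[b, ∞)` that commute with `α g (A_{≥ m})`. By Wedderburn theory both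
the source and the boundary algebra are full matrix algebras, so only their dimensions have to
agree. This holds if `α g (A_{≥ m}) ∩ A_{< m + R}` has the dimension of `A_[m, m + R)`. The ratio of
these two dimensions is an index which is multiplicative on powers of `g`. Since `g` has finite
order, it equals one (`Symm.RangeLE.finrank_eq`). The pieces are then glued
(`RangeBoth.exists_glue`).

Support statements are handled throughout by Haag duality (`mem_localAlg_iff`), which translates
them into commutation relations. It is proved by averaging over the finite group of signed
permutation matrices, a contraction onto the commutant of a matrix algebra.

The properties of the anomaly follow by choosing suitable restrictions. The boundary algebra depends
on the symmetry only near `m`, so two symmetries that agree on a long interval can be cut with the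
same data and share their fusion operators. A symmetry that preserves a half-line algebra can be cut
sharply without losing the homomorphism property, so its phases are trivial; this covers decoupled
symmetries and those of range zero. Restrictions and fusion operators can be tensored, and they can
be transported along circuits and on-site isomorphisms without changing `ω`. -/

noncomputable section

open SpinChain

/-! ### Averaging over signed permutation matrices -/

section Average

/-- The signed permutation matrix with signs `s` and permutation `σ`. -/
def signedPerm {n : Type*} [DecidableEq n] (k : (n → ℤˣ) × Equiv.Perm n) : Matrix n n ℂ :=
  Matrix.of fun i j => if k.2 j = i then ((k.1 i : ℤ) : ℂ) else 0

variable {n : Type*} [Fintype n] [DecidableEq n]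

/-- The signed permutation matrices form a finite group of unitaries. This closure is what makes the
average over them invariant under conjugation. -/
theorem signedPerm_mul (k l : (n → ℤˣ) × Equiv.Perm n) :
    signedPerm k * signedPerm l = signedPerm (k.1 * fun i => l.1 (k.2.symm i), k.2 * l.2) := by
  ext i j
  rw [Matrix.mul_apply, Finset.sum_eq_single (k.2.symm i)]
  · simp only [signedPerm, Matrix.of_apply, Equiv.apply_symm_apply, if_true, Pi.mul_apply,
      Equiv.Perm.mul_apply]
    by_cases h : k.2 (l.2 j) = i
    · have h' : l.2 j = k.2.symm i := by rw [← h, Equiv.symm_apply_apply]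
      simp [h']
    · have h' : ¬ l.2 j = k.2.symm i := fun h' => h (by rw [h', Equiv.apply_symm_apply])
      simp [h, h']
  · intro b _ hb
    have : k.2 b ≠ i := fun h => hb (by rw [← h, Equiv.symm_apply_apply])
    simp [signedPerm, this]
  · simp

theorem signedPerm_star_mul (k : (n → ℤˣ) × Equiv.Perm n) :
    star (signedPerm k) * signedPerm k = 1 := by
  ext i j
  rw [Matrix.mul_apply, Finset.sum_eq_single (k.2 j)]
  · have h : ((k.1 (k.2 j) : ℤ) : ℂ) * ((k.1 (k.2 j) : ℤ) : ℂ) = 1 := by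
      rw [← Int.cast_mul, ← Units.val_mul, Int.units_mul_self]; simp
    by_cases hij : i = j
    · subst hij
      simp [signedPerm, Matrix.star_apply, h]
    · simp [signedPerm, Matrix.star_apply, hij]
  · intro b _ hb
    simp [signedPerm, hb.symm]
  · simp

/-- Flipping the sign at `i` and subtracting from the identity gives twice the projection `E_ii`,
and a transposition moves it to `E_ij`. Hence the signed permutations span the matrix algebra, and a
finite group suffices to detect its commutant. -/
theorem single_eq_signedPerm (i j : n) :
    Matrix.single i j (1 : ℂ) =
      (2⁻¹ : ℂ) • ((signedPerm (1, 1) - signedPerm (Function.update 1 i (-1), 1)) *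
      signedPerm (1, Equiv.swap i j)) := by
  rw [sub_mul, signedPerm_mul, signedPerm_mul]
  ext a b
  simp only [signedPerm, Matrix.smul_apply, Matrix.sub_apply, Matrix.of_apply, Matrix.single_apply,
    one_mul, Pi.mul_apply, Pi.one_apply, mul_one]
  by_cases ha : i = a
  · subst ha
    have : Equiv.swap i j b = i ↔ j = b := by
      rw [Equiv.swap_apply_eq_iff, Equiv.swap_apply_left, eq_comm]
    by_cases hb : j = b
    · simp [hb]; norm_num
    · simp [this, hb]
  · simp [ha, Function.update_of_ne (Ne.symm ha)]

variable {C : Type*} [Ring C] [StarRing C] [Algebra ℂ C]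

theorem commute_matrix_of_signedPerm (f : Matrix n n ℂ →⋆ₐ[ℂ] C) (y : C)
    (h : ∀ k, Commute (f (signedPerm k)) y) (M : Matrix n n ℂ) : Commute (f M) y := by
  rw [Matrix.matrix_eq_sum_single M]
  simp only [map_sum]
  refine Commute.sum_left _ _ _ fun i _ => Commute.sum_left _ _ _ fun j _ => ?_
  have : Matrix.single i j (M i j) = M i j • Matrix.single i j (1 : ℂ) := by simp
  rw [this, single_eq_signedPerm, map_smul, map_smul, map_mul, map_sub]
  exact ((((h _).sub_left (h _)).mul_left (h _)).smul_left _).smul_left _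

/-- The average of `x` over conjugations with signed permutation matrices, a contraction onto the
commutant of the matrix algebra. -/
def average (f : Matrix n n ℂ →⋆ₐ[ℂ] C) (x : C) : C :=
  ((Fintype.card ((n → ℤˣ) × Equiv.Perm n) : ℂ)⁻¹) •
    ∑ k, f (signedPerm k) * x * star (f (signedPerm k))

/-- Conjugating the average with a group element only permutes its summands. -/
theorem commute_average (f : Matrix n n ℂ →⋆ₐ[ℂ] C) (x : C) (M : Matrix n n ℂ) :
    Commute (f M) (average f x) := by
  refine commute_matrix_of_signedPerm f _ (fun k => ?_) M
  refine Commute.smul_right ?_ _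
  -- Left translation by `k` in the group law of `signedPerm_mul`.
  let e : ((n → ℤˣ) × Equiv.Perm n) ≃ ((n → ℤˣ) × Equiv.Perm n) :=
    { toFun := fun l => (k.1 * fun i => l.1 (k.2.symm i), k.2 * l.2)
      invFun := fun l => (fun i => (k.1 (k.2 i))⁻¹ * l.1 (k.2 i), k.2⁻¹ * l.2)
      left_inv := fun l => by ext <;> simp [← mul_assoc]
      right_inv := fun l => by ext <;> simp [← mul_assoc] }
  rw [Commute, SemiconjBy, Finset.mul_sum, Finset.sum_mul, ← Equiv.sum_comp e
    fun l => f (signedPerm l) * x * star (f (signedPerm l)) * f (signedPerm k)]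
  refine Finset.sum_congr rfl fun l _ => ?_
  have he : f (signedPerm (e l)) = f (signedPerm k) * f (signedPerm l) := by
    rw [← map_mul, signedPerm_mul]; rfl
  have hk : star (f (signedPerm k)) * f (signedPerm k) = 1 := by
    rw [← map_star, ← map_mul, signedPerm_star_mul, map_one]
  rw [he, star_mul]
  simp only [mul_assoc, hk, mul_one]

theorem average_sub (f : Matrix n n ℂ →⋆ₐ[ℂ] C) (x y : C) :
    average f (x - y) = average f x - average f y := by
  simp only [average, mul_sub, sub_mul, Finset.sum_sub_distrib, smul_sub]

theorem signedPerm_mul_star (k : (n → ℤˣ) × Equiv.Perm n) :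
    signedPerm k * star (signedPerm k) = 1 :=
  mul_eq_one_comm.mp (signedPerm_star_mul k)

theorem average_eq_self (f : Matrix n n ℂ →⋆ₐ[ℂ] C) (x : C) (h : ∀ M, Commute (f M) x) :
    average f x = x := by
  have : ∀ k, f (signedPerm k) * x * star (f (signedPerm k)) = x := fun k => by
    rw [(h _).eq, mul_assoc, ← map_star, ← map_mul, signedPerm_mul_star, map_one, mul_one]
  simp only [average, this, Finset.sum_const, Finset.card_univ]
  rw [← Nat.cast_smul_eq_nsmul ℂ, smul_smul, inv_mul_cancel₀, one_smul]
  exact_mod_cast Fintype.card_ne_zero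

variable [StarModule ℂ C] in
theorem average_mem (f : Matrix n n ℂ →⋆ₐ[ℂ] C) (S : StarSubalgebra ℂ C) (hf : f.range ≤ S)
    {x : C} (hx : x ∈ S) : average f x ∈ S :=
  S.smul_mem (sum_mem fun _ _ => mul_mem (mul_mem (hf ⟨_, rfl⟩) hx) (star_mem (hf ⟨_, rfl⟩))) _

/-- The average is a convex combination of unitary conjugates of `x`, all of the same norm. -/
theorem norm_average_le {C : Type*} [CStarAlgebra C] (f : Matrix n n ℂ →⋆ₐ[ℂ] C) (x : C) :
    ‖average f x‖ ≤ ‖x‖ := by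
  have h : ∀ k, ‖f (signedPerm k) * x * star (f (signedPerm k))‖ = ‖x‖ := fun k => by
    have hu : f (signedPerm k) ∈ unitary C := by
      rw [Unitary.mem_iff, ← map_star, ← map_mul, ← map_mul, signedPerm_star_mul,
        signedPerm_mul_star, map_one]
      exact ⟨rfl, rfl⟩
    rw [CStarRing.norm_mul_mem_unitary _ (Unitary.star_mem hu), CStarRing.norm_mem_unitary_mul _ hu]
  rw [average, norm_smul]
  calc _ ≤ ‖((Fintype.card ((n → ℤˣ) × Equiv.Perm n) : ℂ)⁻¹)‖ *
        ∑ k : (n → ℤˣ) × Equiv.Perm n, ‖x‖ := by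
        refine mul_le_mul_of_nonneg_left ((norm_sum_le _ _).trans ?_) (norm_nonneg _)
        exact (Finset.sum_congr rfl fun k _ => h k).le
    _ = ‖x‖ := by
        rw [Finset.sum_const, Finset.card_univ, nsmul_eq_mul, ← mul_assoc, norm_inv,
          Complex.norm_natCast, inv_mul_cancel₀, one_mul]
        exact_mod_cast Fintype.card_ne_zero

end Average

/-! ### Splitting off matrix algebras -/

section Splitting

variable {C : Type*} [Ring C] [StarRing C] [Algebra ℂ C]
variable {n : Type*} [Fintype n] [DecidableEq n]

/-- The coefficient at the matrix unit `e_ij` of an element of `C = M_n ⊗ M_n'`. -/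
def coeff (Ψ : Matrix n n ℂ →⋆ₐ[ℂ] C) (i j : n) : C →ₗ[ℂ] C :=
  ∑ k, (LinearMap.mulLeft ℂ (Ψ (Matrix.single k i 1))) ∘ₗ
    (LinearMap.mulRight ℂ (Ψ (Matrix.single j k 1)))

theorem coeff_apply (Ψ : Matrix n n ℂ →⋆ₐ[ℂ] C) (i j : n) (x : C) :
    coeff Ψ i j x = ∑ k, Ψ (Matrix.single k i 1) * x * Ψ (Matrix.single j k 1) := by
  simp [coeff, LinearMap.sum_apply, mul_assoc]

theorem commute_matrix_of_single (f : Matrix n n ℂ →⋆ₐ[ℂ] C) (y : C)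
    (h : ∀ i j, Commute (f (Matrix.single i j 1)) y) (M : Matrix n n ℂ) : Commute (f M) y := by
  rw [Matrix.matrix_eq_sum_single M]
  simp only [map_sum]
  refine Commute.sum_left _ _ _ fun i _ => Commute.sum_left _ _ _ fun j _ => ?_
  have : Matrix.single i j (M i j) = M i j • Matrix.single i j (1 : ℂ) := by simp
  rw [this, map_smul]
  exact (h i j).smul_left _

/-- Multiplying the sum by `E_ab` on the left keeps only `k = b`, on the right only `k = a`. Both
give `E_ai x E_jb`. -/
theorem commute_coeff (Ψ : Matrix n n ℂ →⋆ₐ[ℂ] C) (i j : n) (x : C) (M : Matrix n n ℂ) :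
    Commute (Ψ M) (coeff Ψ i j x) := by
  refine commute_matrix_of_single Ψ _ (fun a b => ?_) M
  rw [coeff_apply, Commute, SemiconjBy, Finset.mul_sum, Finset.sum_mul,
    Finset.sum_eq_single b, Finset.sum_eq_single a]
  · rw [← mul_assoc, ← mul_assoc, ← map_mul, mul_assoc _ (Ψ _) (Ψ _), ← map_mul]
    simp
  · intro k _ hk
    rw [mul_assoc _ (Ψ _) (Ψ _), ← map_mul, Matrix.single_mul_single_of_ne _ _ _ _ hk]; simp
  · simp
  · intro k _ hk
    rw [← mul_assoc, ← mul_assoc, ← map_mul, Matrix.single_mul_single_of_ne _ _ _ _ hk.symm]; simp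
  · simp

/-- Together with `coeff_sum_mul` this is the factorization of an algebra that contains `M_n` as
`M_n` tensored with the commutant of `M_n`. The summand at `(i, j)` is `E_ii x E_jj`. -/
theorem eq_sum_coeff (Ψ : Matrix n n ℂ →⋆ₐ[ℂ] C) (x : C) :
    x = ∑ i, ∑ j, Ψ (Matrix.single i j 1) * coeff Ψ i j x := by
  have h : ∀ i j, Ψ (Matrix.single i j 1) * coeff Ψ i j x =
      Ψ (Matrix.single i i 1) * x * Ψ (Matrix.single j j 1) := fun i j => by
    rw [coeff_apply, Finset.mul_sum, Finset.sum_eq_single j]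
    · rw [← mul_assoc, ← mul_assoc, ← map_mul]; simp
    · intro k _ hk
      rw [← mul_assoc, ← mul_assoc, ← map_mul, Matrix.single_mul_single_of_ne _ _ _ _ hk.symm]; simp
    · simp
  simp only [h, ← Finset.mul_sum, ← map_sum, sum_single_self, map_one, mul_one, ← Finset.sum_mul,
    one_mul]

theorem coeff_sum_mul (Ψ : Matrix n n ℂ →⋆ₐ[ℂ] C) (y : n → n → C)
    (hy : ∀ i j M, Commute (Ψ M) (y i j)) (a b : n) :
    coeff Ψ a b (∑ i, ∑ j, Ψ (Matrix.single i j 1) * y i j) = y a b := by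
  have h : ∀ k, Ψ (Matrix.single k a 1) * (∑ i, ∑ j, Ψ (Matrix.single i j 1) * y i j) *
      Ψ (Matrix.single b k 1) = Ψ (Matrix.single k k 1) * y a b := fun k => by
    rw [Finset.mul_sum, Finset.sum_mul, Finset.sum_eq_single a]
    · rw [Finset.mul_sum, Finset.sum_mul, Finset.sum_eq_single b]
      · rw [mul_assoc, mul_assoc, ← (hy a b _).eq, ← mul_assoc, ← mul_assoc, ← map_mul, ← map_mul]
        simp
      · intro j _ hj
        rw [mul_assoc, mul_assoc, ← (hy a j _).eq, ← mul_assoc (Ψ (Matrix.single a j 1)), ← map_mul,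
          Matrix.single_mul_single_of_ne _ _ _ _ hj]; simp
      · simp
    · intro i _ hi
      rw [Finset.mul_sum]
      simp only [← mul_assoc, ← map_mul, Matrix.single_mul_single_of_ne _ _ _ _ hi.symm]
      simp
    · simp
  simp only [coeff_apply, h]
  rw [← Finset.sum_mul, ← map_sum, sum_single_self, map_one, one_mul]

theorem coeff_mul (Ψ : Matrix n n ℂ →⋆ₐ[ℂ] C) (A : Matrix n n ℂ) (y : C)
    (hy : ∀ M, Commute (Ψ M) y) (a b : n) : coeff Ψ a b (Ψ A * y) = A a b • y := by
  have h : Ψ A * y = ∑ i, ∑ j, Ψ (Matrix.single i j 1) * (A i j • y) := by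
    conv_lhs => rw [Matrix.matrix_eq_sum_single A]
    simp only [map_sum, Finset.sum_mul]
    refine Finset.sum_congr rfl fun i _ => Finset.sum_congr rfl fun j _ => ?_
    have : Matrix.single i j (A i j) = A i j • Matrix.single i j (1 : ℂ) := by simp
    rw [this, map_smul, mul_smul_comm, smul_mul_assoc]
  rw [h, coeff_sum_mul Ψ (fun i j => A i j • y) (fun i j M => (hy M).smul_right _)]

variable [StarModule ℂ C]

theorem coeff_mem (Ψ : Matrix n n ℂ →⋆ₐ[ℂ] C) {S : StarSubalgebra ℂ C} (hΨ : Ψ.range ≤ S)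
    {x : C} (hx : x ∈ S) (i j : n) : coeff Ψ i j x ∈ S := by
  rw [coeff_apply]
  exact sum_mem fun k _ => mul_mem (mul_mem (hΨ ⟨_, rfl⟩) hx) (hΨ ⟨_, rfl⟩)

/-- The dimension of an algebra containing a full matrix algebra. -/
theorem finrank_eq_card_sq_mul (Ψ : Matrix n n ℂ →⋆ₐ[ℂ] C) (S T : StarSubalgebra ℂ C)
    (hΨ : Ψ.range ≤ S) (hT : ∀ x, x ∈ T ↔ x ∈ S ∧ ∀ M, Commute (Ψ M) x)
    [FiniteDimensional ℂ S] :
    Module.finrank ℂ S = Fintype.card n ^ 2 * Module.finrank ℂ T := by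
  -- Taking coefficients identifies `S` with the `n × n` matrices over the relative commutant `T`.
  let e : S ≃ₗ[ℂ] (n → n → T) :=
    { toFun := fun x i j => ⟨coeff Ψ i j x, (hT _).2 ⟨coeff_mem Ψ hΨ x.2 i j,
        commute_coeff Ψ i j x⟩⟩
      invFun := fun y => ⟨∑ i, ∑ j, Ψ (Matrix.single i j 1) * (y i j : C),
        sum_mem fun i _ => sum_mem fun j _ => mul_mem (hΨ ⟨_, rfl⟩) ((hT _).1 (y i j).2).1⟩
      map_add' := fun x y => by
        funext i j; exact Subtype.ext (map_add (coeff Ψ i j) (x : C) (y : C))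
      map_smul' := fun r x => by
        funext i j; exact Subtype.ext (map_smul (coeff Ψ i j) r (x : C))
      left_inv := fun x => Subtype.ext (eq_sum_coeff Ψ (x : C)).symm
      right_inv := fun y => by
        funext i j
        exact Subtype.ext (coeff_sum_mul Ψ (fun i j => (y i j : C))
          (fun i j => ((hT _).1 (y i j).2).2) i j) }
  have : FiniteDimensional ℂ T := by
    have hle : Subalgebra.toSubmodule T.toSubalgebra ≤ Subalgebra.toSubmodule S.toSubalgebra :=
      fun x hx => ((hT x).1 hx).1
    have : FiniteDimensional ℂ (Subalgebra.toSubmodule S.toSubalgebra) :=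
      inferInstanceAs (FiniteDimensional ℂ S)
    exact Submodule.finiteDimensional_of_le hle
  rw [e.finrank_eq, Module.finrank_pi_fintype]
  simp only [Module.finrank_pi_fintype, Finset.sum_const, Finset.card_univ, smul_eq_mul]
  ring

end Splitting

theorem isClosed_range_matrixHom {C : Type*} [CStarAlgebra C] {n : Type*} [Fintype n]
    [DecidableEq n] (f : Matrix n n ℂ →⋆ₐ[ℂ] C) : IsClosed (f.range : Set C) := by
  have h : (f.range : Set C) = (LinearMap.range (f : Matrix n n ℂ →ₗ[ℂ] C) : Set C) := rfl
  rw [h]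
  exact Submodule.closed_of_finiteDimensional _

namespace SpinChain

variable {c : SpinChain}

/-! ### Commutants of local algebras -/

theorem commute_of_localAlg {C : Type*} [CStarAlgebra C] (f : c.Alg →⋆ₐ[ℂ] C) {X : Set ℤ} {z : C}
    (h : ∀ j ∈ X, ∀ M, Commute (f (site j M)) z) {x : c.Alg} (hx : x ∈ c.localAlg X) :
    Commute (f x) z := by
  have h1 := hom_localAlg_mem f X (StarSubalgebra.centralizer ℂ {z}) (by
      rw [StarSubalgebra.coe_centralizer]; exact Set.isClosed_centralizer _) (fun j hj M => by
      rw [StarSubalgebra.mem_centralizer_iff]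
      rintro _ rfl
      refine ⟨(h j hj M).symm, ?_⟩
      have := congrArg star (h j hj (star M)).eq
      simpa [map_star] using this) hx
  rw [StarSubalgebra.mem_centralizer_iff] at h1
  exact (h1 z rfl).1.symm

theorem commute_localAlg {X Y : Set ℤ} (hXY : Disjoint X Y) {x y : c.Alg} (hx : x ∈ c.localAlg X)
    (hy : y ∈ c.localAlg Y) : Commute x y := by
  refine commute_of_localAlg (StarAlgHom.id ℂ c.Alg) (fun j hj M => ?_) hx
  refine (commute_of_localAlg (StarAlgHom.id ℂ c.Alg) (fun i hi N => ?_) hy).symm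
  exact site_comm (fun h : i = j => Set.disjoint_left.mp hXY hj (h ▸ hi)) N M

/-- For finitely many sites no closure is needed, because the range of a matrix algebra is
finite-dimensional and therefore closed. -/
theorem exists_matrixHom_range_eq (c : SpinChain) (S : Finset ℤ) :
    ∃ n : ℕ, 0 < n ∧ ∃ Ψ : Matrix (Fin n) (Fin n) ℂ →⋆ₐ[ℂ] c.Alg,
      Ψ.range = c.localAlg (S : Set ℤ) := by
  obtain ⟨n, hn, Ψ, h1, h2⟩ := exists_matrix_range (c := c) (C := c.Alg) (fun j => site j)
    (fun i j hij M N => site_comm hij M N) S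
  refine ⟨n, hn, Ψ, le_antisymm (h2.trans (StarSubalgebra.le_topologicalClosure _)) ?_⟩
  refine StarSubalgebra.topologicalClosure_minimal (StarAlgebra.adjoin_le
    (Set.iUnion₂_subset fun j hj => ?_)) (isClosed_range_matrixHom Ψ)
  rintro _ ⟨M, rfl⟩
  exact h1 j hj M

/-- Haag duality inside the finite tensor product `A_S ⊗ A_T`. A diagonal coefficient map fixes
every `x` that commutes with `A_S`, and it sends `a ⊗ b` to a scalar multiple of `b`. -/
theorem mem_localAlg_of_commute_of_finite {S T : Finset ℤ} (hST : Disjoint S T) {x : c.Alg}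
    (hx : x ∈ c.localAlg (S ∪ T : Set ℤ)) (h : ∀ y ∈ c.localAlg (S : Set ℤ), Commute y x) :
    x ∈ c.localAlg (T : Set ℤ) := by
  obtain ⟨n, hn, Ψ, hΨ⟩ := exists_matrixHom_range_eq c S
  obtain ⟨m, hm, Φ, hΦ⟩ := exists_matrixHom_range_eq c T
  have hcomm : ∀ M N, Commute (Ψ M) (Φ N) := fun M N =>
    commute_localAlg (Finset.disjoint_coe.mpr hST) (hΨ ▸ ⟨M, rfl⟩) (hΦ ▸ ⟨N, rfl⟩)
  have hle : c.localAlg (S ∪ T : Set ℤ) ≤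
      (matrixTensorHom finProdFinEquiv.symm Ψ Φ hcomm).range := by
    refine StarSubalgebra.topologicalClosure_minimal (StarAlgebra.adjoin_le
      (Set.iUnion₂_subset fun j hj => ?_)) (isClosed_range_matrixHom _)
    rintro _ ⟨M, rfl⟩
    rcases hj with hj | hj
    · have h1 : site j M ∈ Ψ.range := hΨ ▸ site_mem_localAlg hj M
      obtain ⟨M', hM'⟩ := h1
      exact ⟨kronLeft finProdFinEquiv.symm M', (matrixTensorHom_kronLeft _ _ _ hcomm M').trans hM'⟩
    · have h1 : site j M ∈ Φ.range := hΦ ▸ site_mem_localAlg hj M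
      obtain ⟨M', hM'⟩ := h1
      exact ⟨kronRight finProdFinEquiv.symm M',
        (matrixTensorHom_kronRight _ _ _ hcomm M').trans hM'⟩
  let i₀ : Fin n := ⟨0, hn⟩
  have hx1 : coeff Ψ i₀ i₀ x = x := by
    have := coeff_mul Ψ 1 x (fun M => h _ (hΨ ▸ ⟨M, rfl⟩)) i₀ i₀
    simpa using this
  obtain ⟨M, rfl⟩ := hle hx
  rw [← hx1]
  change coeff Ψ i₀ i₀ (∑ p, ∑ q, M p q • (Ψ (Matrix.single _ _ 1) * Φ (Matrix.single _ _ 1))) ∈ _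
  simp only [map_sum, map_smul]
  refine sum_mem fun p _ => sum_mem fun q _ => StarSubalgebra.smul_mem _ ?_ _
  rw [coeff_mul Ψ _ _ (fun M => hcomm M _)]
  exact StarSubalgebra.smul_mem _ (hΦ ▸ ⟨_, rfl⟩) _

/-- Haag duality: an observable commuting with all sites outside `X` is supported in `X`. -/
theorem mem_localAlg_iff {X : Set ℤ} {x : c.Alg} :
    x ∈ c.localAlg X ↔ ∀ j ∉ X, ∀ M, Commute (site j M) x := by
  classical
  refine ⟨fun hx j hj M => commute_localAlg (Set.disjoint_singleton_left.mpr hj)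
    (site_mem_localAlg (Set.mem_singleton j) M) hx, fun h => ?_⟩
  have hcl := isClosed_localAlg (c := c) X
  rw [← SetLike.mem_coe, ← hcl.closure_eq, Metric.mem_closure_iff]
  intro ε hε
  have hx : x ∈ (StarAlgebra.adjoin ℂ (⋃ j, Set.range (site (c := c) j))).topologicalClosure := by
    rw [dense_sites]; exact StarSubalgebra.mem_top
  obtain ⟨y, hy, hxy⟩ := Metric.mem_closure_iff.mp hx ε hε
  obtain ⟨S, hS⟩ := mem_adjoin_finite (fun j => site (c := c) j) hy
  obtain ⟨n, hn, Ψ, hΨ⟩ := exists_matrixHom_range_eq c (S.filter (· ∉ X))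
  have hΨx : ∀ M, Commute (Ψ M) x := fun M =>
    commute_of_localAlg (StarAlgHom.id ℂ c.Alg) (X := (S.filter (· ∉ X) : Set ℤ))
      (fun j hj N => h j (Finset.mem_filter.mp hj).2 N) (hΨ ▸ ⟨M, rfl⟩)
  have hunion : (S : Set ℤ) = ((S.filter (· ∉ X) : Finset ℤ) : Set ℤ) ∪
      ((S.filter (· ∈ X) : Finset ℤ) : Set ℤ) := by
    ext j; simp; tauto
  -- A local approximation `y` of `x` is averaged over its sites outside `X`. The result is
  -- supported in `X`. Averaging fixes `x` and is a contraction, so the distance to `x` stays below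
  -- `ε`.
  refine ⟨average Ψ y, ?_, ?_⟩
  · refine localAlg_mono (X := ((S.filter (· ∈ X) : Finset ℤ) : Set ℤ))
      (fun j hj => (Finset.mem_filter.mp hj).2) ?_
    refine mem_localAlg_of_commute_of_finite (S := S.filter (· ∉ X)) ?_ ?_ ?_
    · rw [Finset.disjoint_left]
      intro j hj hj'
      exact (Finset.mem_filter.mp hj).2 (Finset.mem_filter.mp hj').2
    · rw [← hunion]
      refine average_mem Ψ _ ?_ (StarSubalgebra.le_topologicalClosure _ hS)
      rw [hΨ]
      exact localAlg_mono (Finset.coe_subset.mpr (Finset.filter_subset _ _))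
    · intro z hz
      rw [← hΨ] at hz
      obtain ⟨M, rfl⟩ := hz
      exact commute_average Ψ y M
  · rw [dist_eq_norm] at hxy ⊢
    rw [← average_eq_self Ψ x hΨx, ← average_sub]
    exact (norm_average_le _ _).trans_lt hxy

theorem localAlg_empty {x : c.Alg} (hx : x ∈ c.localAlg ∅) : ∃ r : ℂ, x = algebraMap ℂ c.Alg r := by
  obtain ⟨n, hn, Ψ, h1, h2⟩ := exists_matrix_range (c := c) (C := c.Alg) (fun j => site j)
    (fun i j hij M N => site_comm hij M N) ∅
  have hle : c.localAlg ∅ ≤ Ψ.range := by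
    refine StarSubalgebra.topologicalClosure_minimal (StarAlgebra.adjoin_le (by simp))
      (isClosed_range_matrixHom Ψ)
  have h3 := h2 (hle hx)
  simp only [Finset.notMem_empty, Set.iUnion_of_empty, Set.iUnion_empty] at h3
  obtain ⟨r, hr⟩ := StarSubalgebra.mem_bot.mp
    ((StarAlgebra.adjoin_le (Set.empty_subset _) : _ ≤ (⊥ : StarSubalgebra ℂ c.Alg)) h3)
  exact ⟨r, hr.symm⟩

/-- The spin chain algebra has trivial center. -/
theorem exists_eq_algebraMap_of_commute {x : c.Alg} (h : ∀ j M, Commute (site j M) x) :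
    ∃ r : ℂ, x = algebraMap ℂ c.Alg r :=
  localAlg_empty (mem_localAlg_iff.mpr fun j _ M => h j M)

theorem mem_localAlg_inter {X Y : Set ℤ} {x : c.Alg} (hX : x ∈ c.localAlg X)
    (hY : x ∈ c.localAlg Y) : x ∈ c.localAlg (X ∩ Y) := by
  rw [mem_localAlg_iff] at *
  intro j hj M
  by_cases h : j ∈ X
  · exact hY j (fun h' => hj ⟨h, h'⟩) M
  · exact hX j h M

theorem finiteDimensional_localAlg (S : Finset ℤ) :
    FiniteDimensional ℂ (c.localAlg (S : Set ℤ)) := by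
  obtain ⟨n, hn, Ψ, hΨ⟩ := exists_matrixHom_range_eq c S
  rw [← hΨ]
  exact inferInstanceAs (FiniteDimensional ℂ (LinearMap.range Ψ.toAlgHom.toLinearMap))

/-! ### Star homomorphisms out of a spin chain algebra -/

/-- Matrix algebras are simple, so a unital homomorphism is injective and hence isometric on each
finite set of sites. The equality of norms passes to the closure. -/
theorem isometry_hom {C : Type*} [CStarAlgebra C] [Nontrivial C] (f : c.Alg →⋆ₐ[ℂ] C) :
    Isometry f := by
  refine AddMonoidHomClass.isometry_of_norm _ fun x => ?_
  have hcl : IsClosed {x : c.Alg | ‖f x‖ = ‖x‖} :=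
    isClosed_eq (continuous_hom f).norm continuous_norm
  have hsub : (StarAlgebra.adjoin ℂ (⋃ j, Set.range (site (c := c) j)) : Set c.Alg) ⊆
      {x : c.Alg | ‖f x‖ = ‖x‖} := by
    intro y hy
    obtain ⟨S, hS⟩ := mem_adjoin_finite (fun j => site (c := c) j) hy
    obtain ⟨n, hn, Ψ, hΨ⟩ := exists_matrixHom_range_eq c S
    have hy' : y ∈ Ψ.range := hΨ ▸ StarSubalgebra.le_topologicalClosure _ hS
    obtain ⟨M, rfl⟩ := hy'
    have : Nonempty (Fin n) := ⟨⟨0, hn⟩⟩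
    have h1 : Function.Injective Ψ := RingHom.injective (Ψ : Matrix (Fin n) (Fin n) ℂ →+* c.Alg)
    have h2 : Function.Injective (f.comp Ψ) :=
      RingHom.injective (f.comp Ψ : Matrix (Fin n) (Fin n) ℂ →+* C)
    open scoped Matrix.Norms.L2Operator in
    calc ‖f (Ψ M)‖ = ‖(f.comp Ψ) M‖ := rfl
      _ = ‖M‖ := NonUnitalStarAlgHom.norm_map (f.comp Ψ) h2 M
      _ = ‖Ψ M‖ := (NonUnitalStarAlgHom.norm_map Ψ h1 M).symm
  have h := closure_minimal hsub hcl
  have hx : x ∈ (StarAlgebra.adjoin ℂ (⋃ j, Set.range (site (c := c) j))).topologicalClosure := by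
    rw [dense_sites]; exact StarSubalgebra.mem_top
  exact h hx

/-- Injectivity is automatic. The range of an isometry is closed, so it suffices that it contains
the sites. -/
theorem bijective_hom {c' : SpinChain} (f : c.Alg →⋆ₐ[ℂ] c'.Alg)
    (h : ∀ j M, site j M ∈ f.range) : Function.Bijective f := by
  refine ⟨(isometry_hom f).injective, fun x => ?_⟩
  have hcl : IsClosed (f.range : Set c'.Alg) :=
    (isometry_hom f).isClosedEmbedding.isClosed_range
  have h1 : (StarAlgebra.adjoin ℂ (⋃ j, Set.range (site (c := c') j))).topologicalClosure ≤
      f.range := by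
    refine StarSubalgebra.topologicalClosure_minimal (StarAlgebra.adjoin_le
      (Set.iUnion_subset fun j => ?_)) hcl
    rintro _ ⟨M, rfl⟩
    exact h j M
  rw [dense_sites] at h1
  exact h1 (StarSubalgebra.mem_top (x := x))

theorem aut_ext {c' : SpinChain} {f g : c.Alg ≃⋆ₐ[ℂ] c'.Alg}
    (h : ∀ j M, f (site j M) = g (site j M)) : f = g := by
  have h1 : (f : c.Alg →⋆ₐ[ℂ] c'.Alg) = (g : c.Alg →⋆ₐ[ℂ] c'.Alg) := hom_ext h
  ext x
  exact DFunLike.congr_fun h1 x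

/-! ### Inner automorphisms -/

theorem exists_pos_of_star_mul_self_eq {A : Type*} [CStarAlgebra A] [Nontrivial A] {w : A}
    (hw : w ≠ 0) {r : ℂ} (h : star w * w = algebraMap ℂ A r) : ∃ s : ℝ, 0 < s ∧ r = s := by
  have h1 : star r = r := by
    apply (algebraMap ℂ A).injective
    rw [algebraMap_star_comm, ← h, star_mul, star_star]
  have h2 : r = (r.re : ℂ) := (Complex.conj_eq_iff_re.mp h1).symm
  have h3 : star w * w = algebraMap ℝ A r.re := by
    rw [h, h2]
    rfl
  have h4 : 0 ≤ r.re := by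
    refine spectrum_star_mul_self_nonneg (b := w) _ ?_
    rw [h3, spectrum.scalar_eq]
    rfl
  refine ⟨r.re, lt_of_le_of_ne h4 fun h5 => hw ?_, h2⟩
  rw [← h5, map_zero] at h3
  exact CStarRing.star_mul_self_eq_zero_iff w |>.mp h3

/-- An automorphism which fixes all sites outside a finite set `Y` is inner, implemented by a
unitary supported in `Y`. -/
theorem exists_eq_Ad (χ : c.Alg ≃⋆ₐ[ℂ] c.Alg) (Y : Finset ℤ)
    (h : ∀ j ∉ Y, ∀ M, χ (site j M) = site j M) :
    ∃ U : unitary c.Alg, (U : c.Alg) ∈ c.localAlg (Y : Set ℤ) ∧ χ = Ad U := by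
  obtain ⟨n, hn, Ψ, hΨ⟩ := exists_matrixHom_range_eq c Y
  -- By Haag duality `χ` preserves `A_Y`, since it fixes the sites outside `Y` with which `A_Y`
  -- commutes.
  have hmem : ∀ x ∈ c.localAlg (Y : Set ℤ), χ x ∈ c.localAlg (Y : Set ℤ) := fun x hx => by
    rw [mem_localAlg_iff] at hx ⊢
    intro j hj M
    rw [← h j hj M]
    exact (hx j hj M).map χ
  have hmem' : ∀ x ∈ c.localAlg (Y : Set ℤ), χ.symm x ∈ c.localAlg (Y : Set ℤ) := fun x hx => by
    rw [mem_localAlg_iff] at hx ⊢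
    intro j hj M
    have := (hx j hj M).map χ.symm
    rwa [← h j hj M, χ.symm_apply_apply] at this
  let e : Fin n → Fin n → c.Alg := fun i j => Ψ (Matrix.single i j 1)
  have he : ∀ i j, e i j ∈ c.localAlg (Y : Set ℤ) := fun i j => hΨ ▸ ⟨_, rfl⟩
  have hee : ∀ i j k, e i j * e j k = e i k := fun i j k => by
    simp only [e, ← map_mul]; simp
  have hee' : ∀ i j k l, j ≠ k → e i j * e k l = 0 := fun i j k l hjk => by
    simp only [e, ← map_mul]; rw [Matrix.single_mul_single_of_ne _ _ _ _ hjk, map_zero]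
  let z : Fin n := ⟨0, hn⟩
  have hsum : ∑ i, e i i = 1 := by
    simp only [e, ← map_sum]; rw [sum_single_self, map_one]
  have hne : Nontrivial (Matrix (Fin n) (Fin n) ℂ) := by
    have : Nonempty (Fin n) := ⟨z⟩
    infer_instance
  have hΨi : Function.Injective Ψ := by
    have : Nonempty (Fin n) := ⟨z⟩
    exact RingHom.injective (Ψ : Matrix (Fin n) (Fin n) ℂ →+* c.Alg)
  have hzz : χ (e z z) ≠ 0 := by
    intro h0
    have h1 : Matrix.single z z (1 : ℂ) = 0 :=
      hΨi ((χ.injective (h0.trans (map_zero χ).symm)).trans (map_zero Ψ).symm)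
    have := congrFun (congrFun h1 z) z
    simp at this
  -- This choice of `p` makes the intertwiner `W` nonzero, since `W * e z z * e z p = χ (e z z) * e
  -- p p`.
  obtain ⟨p, hp⟩ : ∃ p, χ (e z z) * e p p ≠ 0 := by
    by_contra! hcon
    apply hzz
    rw [← mul_one (χ (e z z)), ← hsum, Finset.mul_sum]
    exact Finset.sum_eq_zero fun i _ => hcon i
  -- The Skolem–Noether intertwiner, with `W * x = χ x * W` on `A_Y`. It is a scalar multiple of a
  -- unitary because `star W * W` lies in the center of `A_Y`.
  let W : c.Alg := ∑ i, χ (e i z) * e p i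
  have hW : W ∈ c.localAlg (Y : Set ℤ) := sum_mem fun i _ => mul_mem (hmem _ (he _ _)) (he _ _)
  have hWe : ∀ i j, W * e i j = χ (e i j) * W := fun i j => by
    simp only [W, Finset.sum_mul, Finset.mul_sum]
    rw [Finset.sum_eq_single i, Finset.sum_eq_single j]
    · rw [mul_assoc, hee, ← mul_assoc, ← map_mul, hee]
    · intro k _ hk
      rw [← mul_assoc, ← map_mul, hee' _ _ _ _ hk.symm, map_zero, zero_mul]
    · simp
    · intro k _ hk
      rw [mul_assoc, hee' _ _ _ _ hk, mul_zero]
    · simp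
  have hW0 : W ≠ 0 := by
    intro h0
    apply hp
    have h1 := hWe z z
    have h2 : W * e z z = χ (e z z) * e p z := by
      simp only [W, Finset.sum_mul]
      rw [Finset.sum_eq_single z]
      · rw [mul_assoc, hee]
      · intro k _ hk
        rw [mul_assoc, hee' _ _ _ _ hk, mul_zero]
      · simp
    rw [h0, zero_mul] at h2
    rw [← hee p z p, ← mul_assoc, ← h2, zero_mul]
  have hWx : ∀ x ∈ c.localAlg (Y : Set ℤ), W * x = χ x * W := by
    intro x hx
    rw [← hΨ] at hx
    obtain ⟨M, rfl⟩ := hx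
    change W * Ψ M = χ (Ψ M) * W
    rw [Matrix.matrix_eq_sum_single M]
    simp only [map_sum, Finset.mul_sum, Finset.sum_mul]
    refine Finset.sum_congr rfl fun i _ => Finset.sum_congr rfl fun j _ => ?_
    have : Matrix.single i j (M i j) = M i j • Matrix.single i j (1 : ℂ) := by simp
    rw [this, map_smul, map_smul, mul_smul_comm, smul_mul_assoc]
    exact congrArg _ (hWe i j)
  have hsc : ∀ x : c.Alg, x ∈ c.localAlg (Y : Set ℤ) →
      (∀ y ∈ c.localAlg (Y : Set ℤ), Commute y x) → ∃ r : ℂ, x = algebraMap ℂ c.Alg r := by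
    intro x hx hxy
    refine exists_eq_algebraMap_of_commute fun j M => ?_
    by_cases hj : j ∈ Y
    · exact hxy _ (site_mem_localAlg hj M)
    · exact mem_localAlg_iff.mp hx j hj M
  have hWs : ∀ x ∈ c.localAlg (Y : Set ℤ), star W * χ x = x * star W := fun x hx => by
    have := congrArg star (hWx (star x) (star_mem hx))
    rw [star_mul, star_mul, star_star, map_star, star_star] at this
    exact this.symm
  obtain ⟨r, hr⟩ := hsc (star W * W) (mul_mem (star_mem hW) hW) fun y hy => by
    rw [Commute, SemiconjBy, ← mul_assoc, ← hWs y hy, mul_assoc, mul_assoc, hWx y hy]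
  obtain ⟨s, hs, rfl⟩ := exists_pos_of_star_mul_self_eq hW0 hr
  let U : c.Alg := ((Real.sqrt s)⁻¹ : ℂ) • W
  have hss : ((Real.sqrt s)⁻¹ : ℂ) * ((Real.sqrt s)⁻¹ : ℂ) * s = 1 := by
    rw [← mul_inv, ← Complex.ofReal_mul, Real.mul_self_sqrt hs.le, inv_mul_cancel₀]
    exact_mod_cast hs.ne'
  have hstarU : star U = ((Real.sqrt s)⁻¹ : ℂ) • star W := by
    simp [U, star_smul]
  have hUU : star U * U = 1 := by
    rw [hstarU, smul_mul_smul_comm, hr, Algebra.algebraMap_eq_smul_one, smul_smul, hss, one_smul]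
  have hUx : ∀ x ∈ c.localAlg (Y : Set ℤ), U * x = χ x * U := fun x hx => by
    simp only [U, smul_mul_assoc, mul_smul_comm, hWx x hx]
  have hUs : ∀ x ∈ c.localAlg (Y : Set ℤ), star U * χ x = x * star U := fun x hx => by
    simp only [hstarU, smul_mul_assoc, mul_smul_comm, hWs x hx]
  have hU : U ∈ c.localAlg (Y : Set ℤ) := StarSubalgebra.smul_mem _ hW _
  obtain ⟨t, ht⟩ := hsc (U * star U) (mul_mem hU (star_mem hU)) fun y hy => by
    have h1 := hmem' y hy
    rw [← χ.apply_symm_apply y, Commute, SemiconjBy, ← mul_assoc, ← hUx _ h1, mul_assoc, mul_assoc,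
      hUs _ h1]
  -- The product `U * star U` is also a scalar, and `U = (U * star U) * U` with `U ≠ 0` forces this
  -- scalar to be one.
  have hUU' : U * star U = 1 := by
    have h1 : U = U * star U * U := by rw [mul_assoc, hUU, mul_one]
    have hU0 : U ≠ 0 := fun h0 => by rw [h0, mul_zero] at hUU; exact zero_ne_one hUU
    rw [ht, Algebra.algebraMap_eq_smul_one, smul_mul_assoc, one_mul] at h1
    have h2 : (t - 1) • U = 0 := by rw [sub_smul, one_smul, ← h1, sub_self]
    have h3 : t = 1 := sub_eq_zero.mp ((smul_eq_zero.mp h2).resolve_right hU0)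
    rw [ht, h3, map_one]
  refine ⟨⟨U, Unitary.mem_iff.mpr ⟨hUU, hUU'⟩⟩, hU, aut_ext fun j M => ?_⟩
  rw [Unitary.conjStarAlgAut_apply]
  change χ (site j M) = U * site j M * star U
  by_cases hj : j ∈ Y
  · rw [hUx _ (site_mem_localAlg hj M), mul_assoc, hUU', mul_one]
  · rw [h j hj M, ← (mem_localAlg_iff.mp hU j hj M).eq, mul_assoc, hUU', mul_one]

/-! ### Phases and the action of automorphisms on unitaries -/

/-- Phases as unitaries. -/
def phase (c : SpinChain) : Circle →* unitary c.Alg where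
  toFun z := ⟨algebraMap ℂ c.Alg z, by
    rw [Unitary.mem_iff, ← algebraMap_star_comm, ← map_mul, ← map_mul]
    have h : (star (z : ℂ)) * z = 1 := by
      rw [mul_comm]
      simp [Complex.mul_conj, Circle.normSq_coe]
    rw [h, mul_comm, h, map_one]
    exact ⟨rfl, rfl⟩⟩
  map_one' := Subtype.ext (by simp)
  map_mul' _ _ := Subtype.ext (by simp)

theorem coe_phase_mul (z : Circle) (U : unitary c.Alg) :
    ((phase c z * U : unitary c.Alg) : c.Alg) = (z : ℂ) • (U : c.Alg) :=
  (Algebra.smul_def _ _).symm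

theorem phase_injective : Function.Injective (phase c) := fun _ _ h =>
  Circle.ext ((algebraMap ℂ c.Alg).injective (congrArg Subtype.val h))

theorem mul_phase (U : unitary c.Alg) (z : Circle) : U * phase c z = phase c z * U :=
  Subtype.ext (Algebra.commutes _ _).symm

theorem mul_phase_mul (U : unitary c.Alg) (z : Circle) (V : unitary c.Alg) :
    U * (phase c z * V) = phase c z * (U * V) := by
  rw [← mul_assoc, mul_phase, mul_assoc]

/-- The action of a star homomorphism on unitaries. -/
def mapU {c' : SpinChain} (f : c.Alg →⋆ₐ[ℂ] c'.Alg) : unitary c.Alg →* unitary c'.Alg where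
  toFun U := ⟨f U, Unitary.mem_iff.mpr ⟨by
    rw [← map_star, ← map_mul, Unitary.star_mul_self_of_mem U.2, map_one], by
    rw [← map_star, ← map_mul, Unitary.mul_star_self_of_mem U.2, map_one]⟩⟩
  map_one' := Subtype.ext (map_one f)
  map_mul' U V := Subtype.ext (map_mul f (U : c.Alg) V)

theorem coe_mapU {c' : SpinChain} (f : c.Alg →⋆ₐ[ℂ] c'.Alg) (U : unitary c.Alg) :
    (mapU f U : c'.Alg) = f U := rfl

theorem mapU_phase {c' : SpinChain} (f : c.Alg →⋆ₐ[ℂ] c'.Alg) (z : Circle) :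
    mapU f (phase c z) = phase c' z :=
  Subtype.ext (AlgHomClass.commutes f _)

/-- The action of an automorphism on unitaries. -/
abbrev autU (a : c.Alg ≃⋆ₐ[ℂ] c.Alg) : unitary c.Alg →* unitary c.Alg :=
  mapU (a : c.Alg →⋆ₐ[ℂ] c.Alg)

theorem Ad_mul (U V : unitary c.Alg) : Ad (U * V) = Ad U * Ad V := map_mul _ _ _

theorem Ad_inv (U : unitary c.Alg) : Ad U⁻¹ = (Ad U)⁻¹ := map_inv _ _

theorem autU_mul (a b : c.Alg ≃⋆ₐ[ℂ] c.Alg) (U : unitary c.Alg) :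
    autU (a * b) U = autU a (autU b U) := rfl

theorem autU_Ad (U V : unitary c.Alg) : autU (Ad U) V = U * V * U⁻¹ := rfl

theorem Ad_autU (a : c.Alg ≃⋆ₐ[ℂ] c.Alg) (U : unitary c.Alg) :
    Ad (autU a U) * a = a * Ad U := by
  ext x
  rw [StarAlgEquiv.mul_apply, StarAlgEquiv.mul_apply, Unitary.conjStarAlgAut_apply,
    Unitary.conjStarAlgAut_apply, map_mul, map_mul, map_star]
  rfl

/-- The quotient `V⁻¹ * U` is central, hence a scalar, and unitarity puts it on the unit circle. -/
theorem exists_phase_of_Ad_eq {U V : unitary c.Alg} (h : Ad U = Ad V) :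
    ∃ z : Circle, U = phase c z * V := by
  have h1 : Ad (V⁻¹ * U) = 1 := by rw [Ad_mul, Ad_inv, h, inv_mul_cancel]
  have h2 : ∀ x : c.Alg, Commute x ((V⁻¹ * U : unitary c.Alg) : c.Alg) := fun x => by
    have h3 := DFunLike.congr_fun h1 x
    rw [Unitary.conjStarAlgAut_apply] at h3
    change _ = x at h3
    have h4 := congrArg (· * ((V⁻¹ * U : unitary c.Alg) : c.Alg)) h3
    rw [mul_assoc, Unitary.star_mul_self_of_mem (V⁻¹ * U).2, mul_one] at h4
    exact h4.symm
  obtain ⟨r, hr⟩ := exists_eq_algebraMap_of_commute fun j M => h2 (site j M)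
  have hr1 : ‖r‖ = 1 := by
    have := CStarRing.norm_coe_unitary (V⁻¹ * U)
    rwa [hr, norm_algebraMap'] at this
  obtain ⟨z, rfl⟩ : ∃ z : Circle, (z : ℂ) = r :=
    ⟨⟨r, by
      rw [Submonoid.unitSphere, ← SetLike.mem_coe]
      exact mem_sphere_zero_iff_norm.mpr hr1⟩, rfl⟩
  have h3 : V⁻¹ * U = phase c z := Subtype.ext hr
  exact ⟨z, by rw [← mul_phase, ← h3, mul_inv_cancel_left]⟩

end SpinChain

/-! ### Fusion operators and their phases -/

section Fusion

variable {G : Type*} [Group G] {c : SpinChain} {ρ : G → (c.Alg ≃⋆ₐ[ℂ] c.Alg)}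
  {F : G → G → unitary c.Alg} {ω : G → G → G → Circle}

theorem isFusionPhase_iff : IsFusionPhase ρ F ω ↔ ∀ f g h,
    F f g * F (f * g) h = phase c (ω f g h) * (autU (ρ f) (F g h) * F f (g * h)) := by
  refine forall_congr' fun f => forall_congr' fun g => forall_congr' fun h => ?_
  rw [← Subtype.coe_inj, coe_phase_mul]
  rfl

theorem IsFusion.mul_autU (hF : IsFusion ρ F) (g h : G) (V : unitary c.Alg) :
    F g h * autU (ρ (g * h)) V = autU (ρ g) (autU (ρ h) V) * F g h := by
  rw [← autU_mul, hF g h, autU_mul, autU_Ad, inv_mul_cancel_right]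

/-- Both bracketings of a triple product implement the same automorphism `ρ f * ρ g * ρ h * (ρ (f *
g * h))⁻¹`, so they differ by a phase. -/
theorem IsFusion.existsUnique_phase (hF : IsFusion ρ F) : ∃! ω, IsFusionPhase ρ F ω := by
  have h : ∀ f g h, ∃ z : Circle,
      F f g * F (f * g) h = phase c z * (autU (ρ f) (F g h) * F f (g * h)) := fun f g h => by
    refine exists_phase_of_Ad_eq (mul_right_cancel (b := ρ (f * g * h)) ?_)
    rw [Ad_mul, Ad_mul, mul_assoc, ← hF, ← mul_assoc, ← hF, mul_assoc (Ad _) (Ad _), mul_assoc f,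
      ← hF, ← mul_assoc, Ad_autU, mul_assoc (ρ f) (ρ g), mul_assoc (ρ f) (Ad _), ← hF]
  choose ω hω using h
  refine ⟨ω, isFusionPhase_iff.mpr hω, fun ω' hω' => ?_⟩
  funext f g h
  have := isFusionPhase_iff.mp hω' f g h
  rw [hω, mul_left_inj] at this
  exact (phase_injective this).symm

/-- The pentagon argument: `F f g * F (f * g) h * F (f * g * h) k` is brought to the normal form `X`
along two routes. One collects two phases and the other three. -/
theorem IsFusionPhase.isThreeCocycle (hF : IsFusion ρ F) (hω : IsFusionPhase ρ F ω) :
    IsThreeCocycle ω := by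
  rw [isFusionPhase_iff] at hω
  intro f g h k
  rw [eq_comm, div_eq_one]
  apply phase_injective (c := c)
  let X := autU (ρ f) (autU (ρ g) (F h k)) * (autU (ρ f) (F g (h * k)) * F f (g * (h * k)))
  have h1 : F f g * (F (f * g) h * F (f * g * h) k) =
      phase c (ω (f * g) h k * ω f g (h * k)) * X := by
    rw [hω, mul_phase_mul, ← mul_assoc (F f g), hF.mul_autU, mul_assoc, hω, mul_phase_mul, map_mul,
      mul_assoc]
  have h2 : F f g * (F (f * g) h * F (f * g * h) k) =
      phase c (ω g h k * ω f (g * h) k * ω f g h) * X := by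
    calc _ = phase c (ω f g h) * (autU (ρ f) (F g h) * F f (g * h)) * F (f * g * h) k := by
          rw [← mul_assoc, hω]
      _ = phase c (ω f g h) * (autU (ρ f) (F g h) * (F f (g * h) * F (f * (g * h)) k)) := by
          simp only [mul_assoc]
      _ = phase c (ω f g h) * (phase c (ω f (g * h) k) *
          (autU (ρ f) (F g h * F (g * h) k) * F f (g * h * k))) := by
          rw [hω, mul_phase_mul, map_mul, mul_assoc (autU _ _)]
      _ = phase c (ω f g h) * (phase c (ω f (g * h) k) * (phase c (ω g h k) * X)) := by
          simp only [hω, map_mul, mapU_phase, X, mul_assoc]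
      _ = _ := by
          rw [← mul_assoc, ← mul_assoc, ← map_mul, ← map_mul, mul_comm (ω g h k * _),
            mul_comm (ω g h k), mul_assoc]
  rw [h1] at h2
  exact (mul_right_cancel h2).symm

/-- `ω'` differs from `ω` by the coboundary of `lam`. -/
def Cobounds (lam : G → G → Circle) (ω ω' : G → G → G → Circle) : Prop :=
  ∀ f g h, ω' f g h = lam f g * lam (f * g) h * (lam g h)⁻¹ * (lam f (g * h))⁻¹ * ω f g h

/-- For fixed `ρ` the two families of fusion operators differ by phases `lam g h`. An automorphism
fixes scalars, so the phase of `F' g h` inside `ρ f` comes out unchanged. -/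
theorem exists_cobounds {F' : G → G → unitary c.Alg} {ω' : G → G → G → Circle}
    (hF : IsFusion ρ F) (hω : IsFusionPhase ρ F ω) (hF' : IsFusion ρ F')
    (hω' : IsFusionPhase ρ F' ω') : ∃ lam, Cobounds lam ω ω' := by
  have h : ∀ g h, ∃ z : Circle, F' g h = phase c z * F g h := fun g h =>
    exists_phase_of_Ad_eq (mul_right_cancel (b := ρ (g * h)) (by rw [← hF, ← hF']))
  choose lam hlam using h
  refine ⟨lam, fun f g h => ?_⟩
  have h1 := isFusionPhase_iff.mp hω' f g h
  rw [isFusionPhase_iff] at hω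
  simp only [hlam, map_mul, mapU_phase] at h1
  rw [mul_assoc, mul_phase_mul, hω, mul_assoc (phase c (lam g h)), mul_phase_mul (autU _ _)] at h1
  simp only [← mul_assoc (phase c _) (phase c _), ← map_mul] at h1
  have h2 := phase_injective (mul_right_cancel h1)
  rw [eq_mul_inv_iff_mul_eq.mpr h2.symm, mul_inv]
  simp only [mul_assoc, mul_comm, mul_left_comm]

/-- Modifying the restrictions by inner automorphisms does not change the phases. -/
theorem exists_fusion_of_Ad_mul (hF : IsFusion ρ F) (hω : IsFusionPhase ρ F ω)
    (V : G → unitary c.Alg) :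
    ∃ F', IsFusion (fun g => Ad (V g) * ρ g) F' ∧ IsFusionPhase (fun g => Ad (V g) * ρ g) F' ω := by
  -- These operators arise by moving `Ad (V h)` to the left through `ρ g`. In the phase relation
  -- every `V` cancels.
  refine ⟨fun g h => V g * autU (ρ g) (V h) * F g h * (V (g * h))⁻¹, fun g h => ?_, ?_⟩
  · rw [Ad_mul, Ad_mul, Ad_mul, Ad_inv, mul_assoc _ (Ad (V (g * h)))⁻¹, inv_mul_cancel_left,
      mul_assoc _ (Ad (F g h)), ← hF, mul_assoc (Ad (V g)) (Ad (autU _ _)),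
      ← mul_assoc (Ad (autU _ _)), Ad_autU]
    simp only [mul_assoc]
  · rw [isFusionPhase_iff] at hω ⊢
    intro f g h
    have h1 := hF.mul_autU f g (V h)
    have h2 := hω f g h
    simp only [autU_mul, autU_Ad, map_mul, map_inv]
    calc _ = V f * autU (ρ f) (V g) * (F f g * autU (ρ (f * g)) (V h)) * F (f * g) h *
          (V (f * g * h))⁻¹ := by group
      _ = V f * autU (ρ f) (V g) * autU (ρ f) (autU (ρ g) (V h)) * (F f g * F (f * g) h) *
          (V (f * g * h))⁻¹ := by rw [h1]; group
      _ = _ := by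
        rw [h2, mul_phase_mul, mul_assoc (phase c _)]
        congr 1
        group

end Fusion

/-! ### Classes of cocycles -/

section Cohomology

variable {G : Type} [Group G]

theorem iCocycles_injective (n : ℕ) : Function.Injective
    (groupCohomology.iCocycles (Rep.trivial ℤ G (Additive Circle)) n) :=
  (ModuleCat.mono_iff_injective _).mp inferInstance

theorem cocycleClass_mul {ω ω' ω'' : G → G → G → Circle} (hω : IsThreeCocycle ω)
    (hω' : IsThreeCocycle ω') (hω'' : IsThreeCocycle ω'')
    (h : ∀ f g h, ω'' f g h = ω f g h * ω' f g h) :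
    cocycleClass ω'' hω'' = cocycleClass ω hω * cocycleClass ω' hω' := by
  have h1 : groupCohomology.cocyclesMk (cochain ω'') (d_cochain hω'') =
      groupCohomology.cocyclesMk (cochain ω) (d_cochain hω) +
        groupCohomology.cocyclesMk (cochain ω') (d_cochain hω') := by
    apply iCocycles_injective
    rw [map_add, groupCohomology.iCocycles_mk, groupCohomology.iCocycles_mk,
      groupCohomology.iCocycles_mk]
    funext v
    exact congrArg Additive.ofMul (h (v 0) (v 1) (v 2))
  rw [cocycleClass, h1, map_add]
  rfl

/-- The constant cocycle equals its own square, so its class is an idempotent in a group. -/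
theorem cocycleClass_one {ω : G → G → G → Circle} (hω : IsThreeCocycle ω)
    (h : ∀ f g h, ω f g h = 1) : cocycleClass ω hω = 1 := by
  have h1 := cocycleClass_mul hω hω hω (fun f g k => by simp [h])
  exact left_eq_mul.mp h1

/-- `lam` as an inhomogeneous cochain. -/
def cochainTwo (lam : G → G → Circle) : (Fin 2 → G) → Rep.trivial ℤ G (Additive Circle) :=
  fun v => Additive.ofMul (lam (v 0) (v 1))

theorem d_cochainTwo (lam : G → G → Circle) :
    inhomogeneousCochains.d (Rep.trivial ℤ G (Additive Circle)) 2 (cochainTwo lam) =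
      cochain fun f g h => lam g h * (lam (f * g) h)⁻¹ * lam f (g * h) * (lam f g)⁻¹ := by
  funext v
  rw [inhomogeneousCochains.d_hom_apply]
  simp only [Fin.sum_univ_succ, cochainTwo, cochain]
  have key : ∀ a b d e : Additive Circle, a + ((-1 : ℤ) ^ (0 + 1) • b +
      ((-1 : ℤ) ^ (1 + 1) • d + ((-1 : ℤ) ^ (2 + 1) • e + 0))) = a + -b + d + -e := by
    intro a b d e
    simp only [pow_succ, pow_zero, mul_neg, mul_one, neg_neg, neg_smul, one_smul]
    abel
  exact key (Additive.ofMul (lam (v 1) (v 2))) (Additive.ofMul (lam (v 0 * v 1) (v 2)))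
    (Additive.ofMul (lam (v 0) (v 1 * v 2))) (Additive.ofMul (lam (v 0) (v 1)))

/-- In additive notation the sign convention of the inhomogeneous differential turns `Cobounds lam ω
ω'` into `ω = ω' + d lam`. -/
theorem cocycleClass_eq_of_cobounds {ω ω' : G → G → G → Circle} (hω : IsThreeCocycle ω)
    (hω' : IsThreeCocycle ω') {lam : G → G → Circle} (h : Cobounds lam ω ω') :
    cocycleClass ω hω = cocycleClass ω' hω' := by
  have h1 : groupCohomology.cocyclesMk (cochain ω) (d_cochain hω) =
      groupCohomology.cocyclesMk (cochain ω') (d_cochain hω') +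
        groupCohomology.toCocycles (Rep.trivial ℤ G (Additive Circle)) 2 3 (cochainTwo lam) := by
    apply iCocycles_injective
    rw [map_add, groupCohomology.iCocycles_mk, groupCohomology.iCocycles_mk]
    have h2 : groupCohomology.iCocycles (Rep.trivial ℤ G (Additive Circle)) 3
        (groupCohomology.toCocycles (Rep.trivial ℤ G (Additive Circle)) 2 3 (cochainTwo lam)) =
        inhomogeneousCochains.d (Rep.trivial ℤ G (Additive Circle)) 2 (cochainTwo lam) := by
      rw [← CategoryTheory.comp_apply, HomologicalComplex.toCycles_i,
        groupCohomology.inhomogeneousCochains.d_def]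
    rw [h2, d_cochainTwo]
    funext v
    refine congrArg Additive.ofMul (a₁ := ω (v 0) (v 1) (v 2))
      (a₂ := ω' (v 0) (v 1) (v 2) * (lam (v 1) (v 2) * (lam (v 0 * v 1) (v 2))⁻¹ *
        lam (v 0) (v 1 * v 2) * (lam (v 0) (v 1))⁻¹)) ?_
    rw [h]
    generalize lam (v 1) (v 2) = a, lam (v 0 * v 1) (v 2) = b, lam (v 0) (v 1 * v 2) = d,
      lam (v 0) (v 1) = e, ω (v 0) (v 1) (v 2) = w
    calc w = w * (e * e⁻¹) * (b * b⁻¹) * (a⁻¹ * a) * (d⁻¹ * d) := by simp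
      _ = _ := by simp only [mul_assoc, mul_comm, mul_left_comm]
  have h3 : groupCohomology.π (Rep.trivial ℤ G (Additive Circle)) 3
      (groupCohomology.toCocycles (Rep.trivial ℤ G (Additive Circle)) 2 3
        (cochainTwo lam)) = 0 := by
    rw [← CategoryTheory.comp_apply]
    exact congrArg (fun f : (groupCohomology.inhomogeneousCochains
      (Rep.trivial ℤ G (Additive Circle))).X 2 ⟶ _ => f.hom (cochainTwo lam))
      (HomologicalComplex.toCycles_comp_homologyπ _ 2 3)
  rw [cocycleClass, cocycleClass, h1, map_add, h3, add_zero]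

end Cohomology

/-! ### Finite-dimensional C⋆-algebras with trivial center -/

section Wedderburn

variable {A : Type*} [CStarAlgebra A]

theorem eq_zero_of_isNilpotent_star_mul_self {x : A} (h : IsNilpotent (star x * x)) : x = 0 := by
  -- For self-adjoint `y` the C⋆-identity gives `y = 0` from `y ^ 2 = 0`, and repeated squaring
  -- covers every power of two.
  have key : ∀ (n : ℕ) (y : A), IsSelfAdjoint y → y ^ 2 ^ n = 0 → y = 0 := by
    intro n
    induction n with
    | zero => intro y _ hy; simpa using hy
    | succ n ih =>
      intro y hsa hy
      have h1 : y ^ 2 = 0 := ih (y ^ 2) (hsa.pow 2) (by rw [← pow_mul, ← pow_succ']; exact hy)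
      rw [← CStarRing.star_mul_self_eq_zero_iff, hsa.star_eq, ← sq, h1]
  obtain ⟨n, hn⟩ := h
  rw [← CStarRing.star_mul_self_eq_zero_iff]
  refine key n _ (IsSelfAdjoint.star_mul_self x) ?_
  obtain ⟨m, hm⟩ := Nat.exists_eq_add_of_le (Nat.lt_two_pow_self (n := n)).le
  rw [hm, pow_add, hn, zero_mul]

/-- The Jacobson radical of an Artinian ring is nilpotent. If it contains `x`, then it contains
`star x * x`, which is therefore nilpotent, and this forces `x = 0`. -/
theorem isSemisimpleRing_of_finiteDimensional [FiniteDimensional ℂ A] : IsSemisimpleRing A := by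
  have := IsArtinianRing.of_finite ℂ A
  rw [IsArtinianRing.isSemisimpleRing_iff_jacobson, eq_bot_iff]
  intro x hx
  obtain ⟨n, hn⟩ := IsSemiprimaryRing.isNilpotent (R := A)
  refine eq_zero_of_isNilpotent_star_mul_self ⟨n, ?_⟩
  have h1 := Ideal.pow_mem_pow ((Ring.jacobson A).mul_mem_left (star x) hx) n
  rw [hn] at h1
  exact h1

/-- An algebra homomorphism of a matrix algebra into a finite-dimensional C⋆-algebra can be
conjugated to a star homomorphism. -/
theorem exists_starHom_of_algHom [FiniteDimensional ℂ A] {n : Type*} [Fintype n] [DecidableEq n]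
    (θ : Matrix n n ℂ →ₐ[ℂ] A) :
    ∃ s t : A, s * t = 1 ∧ t * s = 1 ∧ ∃ Ψ : Matrix n n ℂ →⋆ₐ[ℂ] A, ∀ M, Ψ M = s * θ M * t := by
  let _ := CStarAlgebra.spectralOrder A
  have _ := CStarAlgebra.spectralOrderedRing A
  let e : n → n → A := fun i j => θ (Matrix.single i j 1)
  have hee : ∀ i j k l, e i j * e k l = if j = k then e i l else 0 := fun i j k l => by
    simp only [e, ← map_mul]
    split_ifs with h
    · subst h; simp
    · rw [Matrix.single_mul_single_of_ne _ _ _ _ h, map_zero]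
  have hsum : ∑ i, e i i = 1 := by simp only [e, ← map_sum]; rw [sum_single_self, map_one]
  -- The unitarian trick. The positive element `T` satisfies `T * e a b = star (e b a) * T`, so
  -- conjugation with its square root turns the `e i j` into matrix units compatible with the star.
  let T : A := ∑ i, ∑ k, star (e i k) * e i k
  have hT : 0 ≤ T := Finset.sum_nonneg fun i _ => Finset.sum_nonneg fun k _ =>
    star_mul_self_nonneg _
  have hTe : ∀ a b, T * e a b = star (e b a) * T := fun a b => by
    simp only [T, Finset.sum_mul, Finset.mul_sum]
    refine Finset.sum_congr rfl fun i _ => ?_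
    have h1 : ∀ k, star (e i k) * e i k * e a b = if k = a then star (e i a) * e i b else 0 :=
      fun k => by
        rw [mul_assoc, hee]
        split_ifs with h
        · rw [h]
        · rw [mul_zero]
    have h2 : ∀ k, star (e b a) * (star (e i k) * e i k) =
        if k = b then star (e i a) * e i b else 0 := fun k => by
      rw [← mul_assoc, ← star_mul, hee]
      split_ifs with h
      · rw [h]
      · rw [star_zero, zero_mul]
    simp [h1, h2]
  -- If `T * v = 0`, then every positive summand `star (e i k * v) * (e i k * v)` vanishes, and the
  -- `e i i` sum to one. In finite dimension injectivity makes `T` right invertible.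
  have hinj : Function.Injective (LinearMap.mulLeft ℂ T) := by
    rw [injective_iff_map_eq_zero]
    intro v hv
    have h1 : ∑ i, ∑ k, star (e i k * v) * (e i k * v) = 0 := by
      calc _ = star v * (T * v) := by
            simp only [T, Finset.sum_mul, Finset.mul_sum, star_mul, mul_assoc]
        _ = 0 := by rw [show T * v = 0 from hv, mul_zero]
    have h2 : ∀ i k, e i k * v = 0 := fun i k => by
      rw [Finset.sum_eq_zero_iff_of_nonneg
        (fun i _ => Finset.sum_nonneg fun k _ => star_mul_self_nonneg _)] at h1
      have h3 := h1 i (Finset.mem_univ i)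
      rw [Finset.sum_eq_zero_iff_of_nonneg (fun k _ => star_mul_self_nonneg _)] at h3
      exact (CStarRing.star_mul_self_eq_zero_iff _).mp (h3 k (Finset.mem_univ k))
    rw [← one_mul v, ← hsum, Finset.sum_mul]
    exact Finset.sum_eq_zero fun i _ => h2 i i
  obtain ⟨w, hw⟩ := LinearMap.injective_iff_surjective.mp hinj 1
  let s := CFC.sqrt T
  have hss : s * s = T := CFC.sqrt_mul_sqrt_self T hT
  have hs : star s = s := (CFC.sqrt_nonneg T).isSelfAdjoint.star_eq
  have hst : s * (s * w) = 1 := by rw [← mul_assoc, hss]; exact hw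
  have hts : star (s * w) * s = 1 := by
    have := congrArg star hst
    rwa [star_mul, hs, star_one] at this
  -- `s` is self-adjoint, so the adjoint of its right inverse is a left inverse, and the two
  -- coincide.
  have hts' : s * w * s = 1 := by
    rwa [left_inv_eq_right_inv hts hst] at hts
  obtain ⟨t, ht⟩ : ∃ t, t = s * w := ⟨_, rfl⟩
  rw [← ht] at hst hts hts'
  have hstt : star t = t := left_inv_eq_right_inv hts hst
  refine ⟨s, t, hst, hts', matrixUnitsHom (fun i j => s * e i j * t) ?_ ?_ ?_, fun M => ?_⟩
  · intro i j k l
    calc s * e i j * t * (s * e k l * t) = s * (e i j * (t * s) * e k l) * t := by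
          simp only [mul_assoc]
      _ = _ := by
          rw [hts', mul_one, hee]
          split_ifs <;> simp
  · intro i j
    rw [star_mul (s * e i j) t, hstt, star_mul, hs]
    calc t * (star (e i j) * s) = t * (star (e i j) * (s * s)) * t := by
          simp only [mul_assoc, hst, mul_one]
      _ = t * (s * s) * e j i * t := by rw [hss, ← hTe]; simp only [mul_assoc]
      _ = _ := by rw [← mul_assoc t, hts', one_mul]
  · rw [← Finset.sum_mul, ← Finset.mul_sum, hsum, mul_one, hst]
  · change ∑ i, ∑ j, M i j • (s * e i j * t) = _
    conv_rhs => rw [Matrix.matrix_eq_sum_single M]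
    simp only [map_sum, Finset.mul_sum, Finset.sum_mul]
    refine Finset.sum_congr rfl fun i _ => Finset.sum_congr rfl fun j _ => ?_
    have : Matrix.single i j (M i j) = M i j • Matrix.single i j (1 : ℂ) := by simp
    rw [this, map_smul, mul_smul_comm, smul_mul_assoc]

/-- By Wedderburn–Artin the algebra is a product of matrix algebras. Trivial center leaves a single
factor, and the algebraic isomorphism is then corrected to one that respects the star. -/
theorem exists_bijective_matrixHom [FiniteDimensional ℂ A] [Nontrivial A]
    (hA : ∀ z : A, (∀ y, Commute y z) → ∃ r : ℂ, z = algebraMap ℂ A r) :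
    ∃ n : ℕ, 0 < n ∧ ∃ Ψ : Matrix (Fin n) (Fin n) ℂ →⋆ₐ[ℂ] A, Function.Bijective Ψ := by
  have := isSemisimpleRing_of_finiteDimensional (A := A)
  obtain ⟨m, d, hd, ⟨e⟩⟩ := IsSemisimpleRing.exists_algEquiv_pi_matrix_of_isAlgClosed ℂ A
  have hm : m = 1 := by
    have h0 : m ≠ 0 := by
      rintro rfl
      have : Subsingleton A := e.toEquiv.subsingleton
      exact not_subsingleton A this
    by_contra hm1
    let a : Fin m := ⟨0, by omega⟩
    let b : Fin m := ⟨1, by omega⟩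
    have hab : b ≠ a := by simp [a, b]
    -- With two blocks, the unit of one of them would be a central element that is not a scalar.
    let p : Π i, Matrix (Fin (d i)) (Fin (d i)) ℂ := Pi.single a 1
    obtain ⟨r, hr⟩ := hA (e.symm p) fun y => by
      obtain ⟨y, rfl⟩ := e.symm.surjective y
      refine Commute.map (f := e.symm) ?_
      refine Pi.commute_iff.mpr fun i => ?_
      by_cases hi : i = a
      · subst hi; simp [p]
      · simp [p, hi]
    have h1 : p = algebraMap ℂ _ r := by
      rw [← e.apply_symm_apply p, hr, AlgEquiv.commutes]
    have := hd a
    have := hd b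
    have h2 := congrFun h1 b
    have h3 := congrFun h1 a
    simp only [p, Pi.single_eq_of_ne hab, Pi.algebraMap_apply, Pi.single_eq_same] at h2 h3
    have h4 : r = 0 := by
      have := congrFun (congrFun h2 0) 0
      simpa [Matrix.algebraMap_matrix_apply] using this.symm
    rw [h4, map_zero] at h3
    exact one_ne_zero h3
  subst hm
  have := hd 0
  let e' : Matrix (Fin (d 0)) (Fin (d 0)) ℂ ≃ₐ[ℂ] A :=
    (e.trans (AlgEquiv.ofBijective
      (Pi.evalAlgHom ℂ (fun i => Matrix (Fin (d i)) (Fin (d i)) ℂ) 0)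
      ⟨fun x y hxy => funext fun i => by rw [Subsingleton.elim i 0]; exact hxy,
        fun y => ⟨Pi.single (M := fun i => Matrix (Fin (d i)) (Fin (d i)) ℂ) 0 y,
          Pi.single_eq_same (M := fun i => Matrix (Fin (d i)) (Fin (d i)) ℂ) 0 y⟩⟩)).symm
  obtain ⟨s, t, hst, hts, Ψ, hΨ⟩ := exists_starHom_of_algHom e'.toAlgHom
  refine ⟨d 0, Nat.pos_of_neZero _, Ψ, fun M N hMN => ?_, fun x => ⟨e'.symm (t * x * s), ?_⟩⟩
  · rw [hΨ, hΨ] at hMN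
    have h1 : t * (s * e' M * t) * s = t * (s * e' N * t) * s := congrArg (fun x => t * x * s) hMN
    have h2 : ∀ x, t * (s * x * t) * s = x := fun x => by
      calc _ = t * s * x * (t * s) := by simp only [mul_assoc]
        _ = x := by rw [hts, one_mul, mul_one]
    rw [h2, h2] at h1
    exact e'.injective h1
  · rw [hΨ]
    change s * e' (e'.symm _) * t = x
    rw [e'.apply_symm_apply]
    calc _ = s * t * x * (s * t) := by simp only [mul_assoc]
      _ = x := by rw [hst, one_mul, mul_one]

/-- A finite-dimensional star subalgebra with trivial center is a matrix algebra. -/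
theorem exists_matrixHom_range_eq_of_center [Nontrivial A] (B : StarSubalgebra ℂ A)
    [FiniteDimensional ℂ B]
    (hB : ∀ z ∈ B, (∀ y ∈ B, Commute y z) → ∃ r : ℂ, z = algebraMap ℂ A r) :
    ∃ n : ℕ, 0 < n ∧ ∃ Ψ : Matrix (Fin n) (Fin n) ℂ →⋆ₐ[ℂ] A, Ψ.range = B := by
  have hcl : IsClosed (B : Set A) := by
    have : FiniteDimensional ℂ (Subalgebra.toSubmodule B.toSubalgebra) :=
      inferInstanceAs (FiniteDimensional ℂ B)
    exact Submodule.closed_of_finiteDimensional (Subalgebra.toSubmodule B.toSubalgebra)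
  let _ : CStarAlgebra B := StarSubalgebra.cstarAlgebra B (h_closed := hcl)
  obtain ⟨n, hn, Ψ, hΨ⟩ := exists_bijective_matrixHom (A := B) fun z hz => by
    obtain ⟨r, hr⟩ := hB z z.2 fun y hy => congrArg Subtype.val (hz ⟨y, hy⟩).eq
    exact ⟨r, Subtype.ext hr⟩
  refine ⟨n, hn, B.subtype.comp Ψ, le_antisymm ?_ fun x hx => ?_⟩
  · rintro _ ⟨M, rfl⟩
    exact (Ψ M).2
  · obtain ⟨M, hM⟩ := hΨ.2 ⟨x, hx⟩
    exact ⟨M, congrArg Subtype.val hM⟩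

end Wedderburn

/-! ### Homomorphisms on local algebras, and the images of half-line algebras. -/

namespace SpinChain

variable {c : SpinChain}

theorem eq_on_localAlg {C : Type*} [CStarAlgebra C] {f g : c.Alg →⋆ₐ[ℂ] C} {X : Set ℤ}
    (h : ∀ j ∈ X, ∀ M, f (site j M) = g (site j M)) {x : c.Alg} (hx : x ∈ c.localAlg X) :
    f x = g x := by
  have h1 : c.localAlg X ≤ StarAlgHom.equalizer f g := by
    refine StarSubalgebra.topologicalClosure_minimal (StarAlgebra.adjoin_le
      (Set.iUnion₂_subset fun j hj => ?_)) (isClosed_eq (continuous_hom f) (continuous_hom g))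
    rintro _ ⟨M, rfl⟩
    exact h j hj M
  exact h1 hx

theorem aut_eq_on_localAlg {c' : SpinChain} {f g : c.Alg ≃⋆ₐ[ℂ] c'.Alg} {X : Set ℤ}
    (h : ∀ j ∈ X, ∀ M, f (site j M) = g (site j M)) {x : c.Alg} (hx : x ∈ c.localAlg X) :
    f x = g x :=
  eq_on_localAlg (f := (f : c.Alg →⋆ₐ[ℂ] c'.Alg)) (g := (g : c.Alg →⋆ₐ[ℂ] c'.Alg)) h hx

/-! ### Half-line algebras -/

theorem finiteDimensional_of_le_localAlg {B : StarSubalgebra ℂ c.Alg} (S : Finset ℤ)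
    (h : B ≤ c.localAlg (S : Set ℤ)) : FiniteDimensional ℂ B := by
  have h1 : FiniteDimensional ℂ (Subalgebra.toSubmodule (c.localAlg (S : Set ℤ)).toSubalgebra) :=
    finiteDimensional_localAlg (c := c) S
  exact Submodule.finiteDimensional_of_le (S₁ := Subalgebra.toSubmodule B.toSubalgebra)
    (S₂ := Subalgebra.toSubmodule (c.localAlg (S : Set ℤ)).toSubalgebra) h

theorem le_localAlg_Ico {B : StarSubalgebra ℂ c.Alg} {m n : ℤ} (h1 : B ≤ c.localAlg (Set.Ici m))
    (h2 : B ≤ c.localAlg (Set.Iio n)) : B ≤ c.localAlg (Finset.Ico m n : Set ℤ) := fun _ hx =>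
  localAlg_mono (fun _ hj => Finset.mem_coe.mpr (Finset.mem_Ico.mpr ⟨hj.1, hj.2⟩))
    (mem_localAlg_inter (h1 hx) (h2 hx))

/-- The image of `A_X` under an automorphism. -/
def imgAlg (a : c.Alg ≃⋆ₐ[ℂ] c.Alg) (X : Set ℤ) : StarSubalgebra ℂ c.Alg :=
  (c.localAlg X).comap (a.symm : c.Alg →⋆ₐ[ℂ] c.Alg)

theorem mem_imgAlg {a : c.Alg ≃⋆ₐ[ℂ] c.Alg} {X : Set ℤ} {x : c.Alg} :
    x ∈ imgAlg a X ↔ a.symm x ∈ c.localAlg X := Iff.rfl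

theorem apply_mem_imgAlg {a : c.Alg ≃⋆ₐ[ℂ] c.Alg} {X : Set ℤ} {x : c.Alg} :
    a x ∈ imgAlg a X ↔ x ∈ c.localAlg X := by
  rw [mem_imgAlg, a.symm_apply_apply]

theorem imgAlg_one (X : Set ℤ) : imgAlg (1 : c.Alg ≃⋆ₐ[ℂ] c.Alg) X = c.localAlg X := rfl

/-- Haag duality transported by the automorphism. -/
theorem mem_imgAlg_iff {a : c.Alg ≃⋆ₐ[ℂ] c.Alg} {X : Set ℤ} {x : c.Alg} :
    x ∈ imgAlg a X ↔ ∀ j ∉ X, ∀ M, Commute (a (site j M)) x := by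
  rw [mem_imgAlg, mem_localAlg_iff]
  refine forall_congr' fun j => forall_congr' fun _ => forall_congr' fun M => ⟨fun h => ?_,
    fun h => ?_⟩
  · simpa using h.map a
  · simpa using h.map a.symm

theorem commute_imgAlg {a : c.Alg ≃⋆ₐ[ℂ] c.Alg} {X Y : Set ℤ} (hXY : Disjoint X Y) {x y : c.Alg}
    (hx : x ∈ imgAlg a X) (hy : y ∈ imgAlg a Y) : Commute x y := by
  simpa using (commute_localAlg hXY hx hy).map a

theorem commute_imgAlg_of_sites {a : c.Alg ≃⋆ₐ[ℂ] c.Alg} {X : Set ℤ} {z : c.Alg}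
    (h : ∀ j ∈ X, ∀ M, Commute (a (site j M)) z) {x : c.Alg} (hx : x ∈ imgAlg a X) :
    Commute x z := by
  have := commute_of_localAlg (a : c.Alg →⋆ₐ[ℂ] c.Alg) h hx
  change Commute (a (a.symm x)) z at this
  rwa [a.apply_symm_apply] at this

theorem disjoint_Ici_Iio (m : ℤ) : Disjoint (Set.Ici m) (Set.Iio m) :=
  Set.disjoint_left.mpr fun _ (h : m ≤ _) h' => not_lt.mpr h h'

/-- The automorphism and its inverse have range at most `R`. -/
def RangeBoth (a : c.Alg ≃⋆ₐ[ℂ] c.Alg) (R : ℕ) : Prop := HasRange a R ∧ HasRange a.symm R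

theorem fatten_Ici (m : ℤ) (R : ℕ) : fatten (Set.Ici m) R ⊆ Set.Ici (m - R) := by
  rintro j ⟨i, hi, hij⟩
  rw [abs_le] at hij
  simp only [Set.mem_Ici] at *
  omega

theorem fatten_Iio (m : ℤ) (R : ℕ) : fatten (Set.Iio m) R ⊆ Set.Iio (m + R) := by
  rintro j ⟨i, hi, hij⟩
  rw [abs_le] at hij
  simp only [Set.mem_Iio] at *
  omega

theorem HasRange.apply_Ici {a : c.Alg ≃⋆ₐ[ℂ] c.Alg} {R : ℕ} (h : HasRange a R) {m n : ℤ}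
    (hmn : n + R ≤ m) {x : c.Alg} (hx : x ∈ c.localAlg (Set.Ici m)) :
    a x ∈ c.localAlg (Set.Ici n) :=
  localAlg_mono ((fatten_Ici m R).trans (Set.Ici_subset_Ici.mpr (by omega))) (h _ _ hx)

theorem HasRange.apply_Iio {a : c.Alg ≃⋆ₐ[ℂ] c.Alg} {R : ℕ} (h : HasRange a R) {m n : ℤ}
    (hmn : m + R ≤ n) {x : c.Alg} (hx : x ∈ c.localAlg (Set.Iio m)) :
    a x ∈ c.localAlg (Set.Iio n) :=
  localAlg_mono ((fatten_Iio m R).trans (Set.Iio_subset_Iio (by omega))) (h _ _ hx)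

section HalfLine

variable {a : c.Alg ≃⋆ₐ[ℂ] c.Alg} {R : ℕ} (ha : RangeBoth a R)
include ha

theorem RangeBoth.symm : RangeBoth a.symm R := ⟨ha.2, ha.1⟩

theorem RangeBoth.localAlg_Ici_le {m n : ℤ} (h : m + R ≤ n) :
    c.localAlg (Set.Ici n) ≤ imgAlg a (Set.Ici m) := fun _ hx => ha.2.apply_Ici h hx

theorem RangeBoth.localAlg_Iio_le {m n : ℤ} (h : n + R ≤ m) :
    c.localAlg (Set.Iio n) ≤ imgAlg a (Set.Iio m) := fun _ hx => ha.2.apply_Iio h hx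

theorem RangeBoth.imgAlg_Ici_le {m n : ℤ} (h : n + R ≤ m) :
    imgAlg a (Set.Ici m) ≤ c.localAlg (Set.Ici n) := fun x hx => by
  have := ha.1.apply_Ici h (mem_imgAlg.mp hx)
  rwa [a.apply_symm_apply] at this

theorem RangeBoth.imgAlg_Iio_le {m n : ℤ} (h : m + R ≤ n) :
    imgAlg a (Set.Iio m) ≤ c.localAlg (Set.Iio n) := fun x hx => by
  have := ha.1.apply_Iio h (mem_imgAlg.mp hx)
  rwa [a.apply_symm_apply] at this

/-- The half-line algebra `a(A_{≥ m})` is generated by `a(A_{≥ m}) ∩ A_{< N}` and `A_{≥ N}`, in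
terms of commutants. -/
theorem RangeBoth.commute_of_commute {m N : ℤ} {z : c.Alg}
    (h1 : ∀ y ∈ imgAlg a (Set.Ici m) ⊓ c.localAlg (Set.Iio N), Commute y z)
    (h2 : ∀ y ∈ c.localAlg (Set.Ici N), Commute y z) (hN : m + R ≤ N) {x : c.Alg}
    (hx : x ∈ imgAlg a (Set.Ici m)) : Commute x z := by
  refine commute_imgAlg_of_sites (fun i hi M => ?_) hx
  -- The image of the site `i` lies in `A_{< i + R + 1}`, so in `A_{< N'}`. It is expanded over the
  -- matrix algebra `A_[N, N')`, whose coefficients then live below `N`. They remain in `a(A_{≥ m})`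
  -- because `m + R ≤ N` gives `A_{≥ N} ⊆ a(A_{≥ m})`.
  let N' : ℤ := max N (i + R + 1)
  obtain ⟨n, hn, Ψ, hΨ⟩ := exists_matrixHom_range_eq c (Finset.Ico N N')
  have hy1 : a (site i M) ∈ imgAlg a (Set.Ici m) := apply_mem_imgAlg.mpr (site_mem_localAlg hi M)
  have hy2 : a (site i M) ∈ c.localAlg (Set.Iio N') :=
    ha.1.apply_Iio (m := i + 1) (by simp only [N']; omega)
      (site_mem_localAlg (by simp) M)
  have hΨ1 : Ψ.range ≤ imgAlg a (Set.Ici m) := by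
    rw [hΨ]
    refine le_trans (localAlg_mono fun j hj => ?_) (ha.localAlg_Ici_le hN)
    exact (Finset.mem_Ico.mp hj).1
  have hΨ2 : Ψ.range ≤ c.localAlg (Set.Iio N') := by
    rw [hΨ]
    exact localAlg_mono fun j hj => (Finset.mem_Ico.mp hj).2
  rw [eq_sum_coeff Ψ (a (site i M))]
  refine Commute.sum_left _ _ _ fun p _ => Commute.sum_left _ _ _ fun q _ =>
    Commute.mul_left (h2 _ ?_) (h1 _ ⟨coeff_mem Ψ hΨ1 hy1 p q, ?_⟩)
  · have h3 : Ψ (Matrix.single p q 1) ∈ Ψ.range := ⟨_, rfl⟩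
    rw [hΨ] at h3
    exact localAlg_mono (fun j hj => (Finset.mem_Ico.mp hj).1) h3
  · refine mem_localAlg_iff.mpr fun j hj K => ?_
    by_cases hj' : j < N'
    · have h3 : site j K ∈ Ψ.range := by
        rw [hΨ]
        refine site_mem_localAlg (Finset.mem_coe.mpr (Finset.mem_Ico.mpr ⟨?_, hj'⟩)) K
        simpa using hj
      obtain ⟨K', hK'⟩ := h3
      rw [← hK']
      exact commute_coeff Ψ p q _ K'
    · exact mem_localAlg_iff.mp (coeff_mem Ψ hΨ2 hy2 p q) j (by simpa using hj') K

/-- The finite-dimensional algebra `a(A_{≥ m}) ∩ A_{< N}` is a full matrix algebra. -/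
theorem RangeBoth.exists_matrixHom {m N : ℤ} (hN : m + R ≤ N) :
    ∃ n : ℕ, 0 < n ∧ ∃ Ψ : Matrix (Fin n) (Fin n) ℂ →⋆ₐ[ℂ] c.Alg,
      Ψ.range = imgAlg a (Set.Ici m) ⊓ c.localAlg (Set.Iio N) := by
  have hle : imgAlg a (Set.Ici m) ⊓ c.localAlg (Set.Iio N) ≤
      c.localAlg (Finset.Ico (m - R) N : Set ℤ) :=
    le_localAlg_Ico (fun _ hw => ha.imgAlg_Ici_le (by omega) hw.1) inf_le_right
  have hfd := finiteDimensional_of_le_localAlg _ hle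
  refine exists_matrixHom_range_eq_of_center (imgAlg a (Set.Ici m) ⊓ c.localAlg (Set.Iio N))
    fun z hz hzc => ?_
  -- A central `z` commutes with `a(A_{≥ m})`. As a member of this algebra it also commutes with
  -- `a(A_{< m})`, so it is a scalar.
  have h1 : ∀ x ∈ imgAlg a (Set.Ici m), Commute x z := fun x hx =>
    ha.commute_of_commute hzc (fun y hy => commute_localAlg (disjoint_Ici_Iio N) hy hz.2) hN hx
  have h2 : ∀ j M, Commute (a (site j M)) z := fun j M => by
    by_cases hj : j ∈ Set.Ici m
    · exact h1 _ (apply_mem_imgAlg.mpr (site_mem_localAlg hj M))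
    · exact mem_imgAlg_iff.mp hz.1 j hj M
  have h3 : z ∈ imgAlg a ∅ := mem_imgAlg_iff.mpr fun j _ M => h2 j M
  obtain ⟨r, hr⟩ := localAlg_empty (mem_imgAlg.mp h3)
  refine ⟨r, ?_⟩
  rw [← a.apply_symm_apply z, hr]
  exact AlgHomClass.commutes a r

end HalfLine

/-! ### The index of finite order automorphisms -/

/-- The automorphism `z` carries one intersection onto the other. This translation invariance is the
source of the multiplicativity of the index. -/
theorem finrank_imgAlg_mul (z x y : c.Alg ≃⋆ₐ[ℂ] c.Alg) (X Y : Set ℤ) :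
    Module.finrank ℂ (imgAlg (z * x) X ⊓ imgAlg (z * y) Y : StarSubalgebra ℂ c.Alg) =
      Module.finrank ℂ (imgAlg x X ⊓ imgAlg y Y : StarSubalgebra ℂ c.Alg) := by
  let e : (imgAlg (z * x) X ⊓ imgAlg (z * y) Y : StarSubalgebra ℂ c.Alg) ≃ₗ[ℂ]
      (imgAlg x X ⊓ imgAlg y Y : StarSubalgebra ℂ c.Alg) :=
    { toFun := fun w => ⟨z.symm w, w.2⟩
      invFun := fun w => ⟨z w, by
        have h1 : x.symm w ∈ c.localAlg X := w.2.1
        have h2 : y.symm w ∈ c.localAlg Y := w.2.2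
        constructor
        · change x.symm (z.symm (z w)) ∈ c.localAlg X
          rwa [z.symm_apply_apply]
        · change y.symm (z.symm (z w)) ∈ c.localAlg Y
          rwa [z.symm_apply_apply]⟩
      map_add' := fun v w => Subtype.ext (map_add z.symm (v : c.Alg) (w : c.Alg))
      map_smul' := fun r w => Subtype.ext (map_smul z.symm r (w : c.Alg))
      left_inv := fun w => Subtype.ext (z.apply_symm_apply w)
      right_inv := fun w => Subtype.ext (z.symm_apply_apply w) }
  exact e.finrank_eq

/-- The intersection of `x(A_{≥ m})` and `y(A_{< m + 2R})` factors at `m + R` into the tensor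
product of `x(A_{≥ m}) ∩ A_{< m + R}` and `A_{≥ m + R} ∩ y(A_{< m + 2R})`. The dimension `k` of the
second factor does not involve `x`. The two shifts by `R` ensure `A_{≥ m + R} ⊆ x(A_{≥ m})` and
`A_{< m + R} ⊆ y(A_{< m + 2R})`. -/
theorem exists_finrank_eq_mul {y : c.Alg ≃⋆ₐ[ℂ] c.Alg} {R : ℕ} (hy : RangeBoth y R) (m : ℤ) :
    ∃ k : ℕ, 0 < k ∧ ∀ x : c.Alg ≃⋆ₐ[ℂ] c.Alg, RangeBoth x R →
      Module.finrank ℂ (imgAlg x (Set.Ici m) ⊓ imgAlg y (Set.Iio (m + 2 * R)) :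
        StarSubalgebra ℂ c.Alg) =
      k * Module.finrank ℂ (imgAlg x (Set.Ici m) ⊓ c.localAlg (Set.Iio (m + R)) :
        StarSubalgebra ℂ c.Alg) := by
  obtain ⟨n, hn, Ψ, hΨ⟩ := hy.symm.exists_matrixHom (m := m + R) (N := m + 2 * R) (by omega)
  refine ⟨n ^ 2, by positivity, fun x hx => ?_⟩
  have hmemΨ : ∀ w, w ∈ ((y : c.Alg →⋆ₐ[ℂ] c.Alg).comp Ψ).range ↔
      w ∈ c.localAlg (Set.Ici (m + R)) ∧ w ∈ imgAlg y (Set.Iio (m + 2 * R)) := by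
    intro w
    have h1 : w ∈ ((y : c.Alg →⋆ₐ[ℂ] c.Alg).comp Ψ).range ↔ y.symm w ∈ Ψ.range := by
      constructor
      · rintro ⟨M, rfl⟩
        exact ⟨M, (y.symm_apply_apply _).symm⟩
      · rintro ⟨M, hM⟩
        exact ⟨M, (congrArg y hM).trans (y.apply_symm_apply w)⟩
    rw [h1, hΨ]
    refine and_congr ?_ Iff.rfl
    change y (y.symm w) ∈ c.localAlg (Set.Ici (m + R)) ↔ w ∈ c.localAlg (Set.Ici (m + R))
    rw [y.apply_symm_apply]
  have hle : (imgAlg x (Set.Ici m) ⊓ imgAlg y (Set.Iio (m + 2 * R)) : StarSubalgebra ℂ c.Alg) ≤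
      c.localAlg (Finset.Ico (m - R) (m + 3 * R) : Set ℤ) :=
    le_localAlg_Ico (fun w hw => hx.imgAlg_Ici_le (by omega) hw.1)
      (fun w hw => hy.imgAlg_Iio_le (by omega) hw.2)
  have := finiteDimensional_of_le_localAlg _ hle
  have h := finrank_eq_card_sq_mul ((y : c.Alg →⋆ₐ[ℂ] c.Alg).comp Ψ)
    (imgAlg x (Set.Ici m) ⊓ imgAlg y (Set.Iio (m + 2 * R)))
    (imgAlg x (Set.Ici m) ⊓ c.localAlg (Set.Iio (m + R)))
    (fun w hw => ⟨hx.localAlg_Ici_le le_rfl ((hmemΨ w).mp hw).1, ((hmemΨ w).mp hw).2⟩)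
    (fun w => by
      constructor
      · rintro ⟨h1, h2⟩
        refine ⟨⟨h1, hy.localAlg_Iio_le (by omega) h2⟩, fun M => ?_⟩
        exact commute_localAlg (disjoint_Ici_Iio _) ((hmemΨ _).mp ⟨M, rfl⟩).1 h2
      · rintro ⟨⟨h1, h2⟩, h3⟩
        refine ⟨h1, ?_⟩
        -- Commuting with the finite-dimensional second factor and with `y(A_{≥ m + 2R})` implies
        -- commuting with all of `A_{≥ m + R}`. This is seen after applying `y.symm`.
        have h4 : ∀ v ∈ imgAlg y.symm (Set.Ici (m + R)), Commute v (y.symm w) := fun v hv => by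
          refine hy.symm.commute_of_commute (N := m + 2 * R) (fun u hu => ?_) (fun u hu => ?_)
            (by omega) hv
          · rw [← hΨ] at hu
            obtain ⟨M, rfl⟩ := hu
            have := (h3 M).map y.symm
            change Commute (y.symm (y (Ψ M))) (y.symm w) at this
            rwa [y.symm_apply_apply] at this
          · exact commute_localAlg (disjoint_Ici_Iio _) hu h2
        refine mem_localAlg_iff.mpr fun j hj M => ?_
        have h5 := h4 (y.symm (site j M)) (apply_mem_imgAlg.mpr
          (site_mem_localAlg (by simpa using hj) M))
        simpa using h5.map y)
  rwa [Fintype.card_fin] at h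

end SpinChain

/-! ### Triviality of the index for symmetries of finite groups. -/

section Index

variable {G : Type*} [Group G] {c : SpinChain} {α : Symm G c} {R : ℕ}

/-- The inverse of `α g` is `α g⁻¹`, which obeys the same range bound. -/
theorem Symm.RangeLE.rangeBoth (hα : α.RangeLE R) (g : G) : RangeBoth (α g) R := by
  refine ⟨hα g, ?_⟩
  have h := hα g⁻¹
  rwa [map_inv] at h

/-- Symmetries of finite groups have trivial index. -/
theorem Symm.RangeLE.finrank_eq [Finite G] (hα : α.RangeLE R) (m : ℤ) (g : G) :
    Module.finrank ℂ (imgAlg (α g) (Set.Ici m) ⊓ c.localAlg (Set.Iio (m + R)) :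
      StarSubalgebra ℂ c.Alg) =
    Module.finrank ℂ (c.localAlg (Finset.Ico m (m + R) : Set ℤ)) := by
  let u : G → ℕ := fun x => Module.finrank ℂ
    (imgAlg (α x) (Set.Ici m) ⊓ c.localAlg (Set.Iio (m + R)) : StarSubalgebra ℂ c.Alg)
  have hu1 : u 1 = Module.finrank ℂ (c.localAlg (Finset.Ico m (m + R) : Set ℤ)) := by
    have : (imgAlg (α 1) (Set.Ici m) ⊓ c.localAlg (Set.Iio (m + R)) : StarSubalgebra ℂ c.Alg) =
        c.localAlg (Finset.Ico m (m + R) : Set ℤ) := by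
      rw [map_one, imgAlg_one]
      refine le_antisymm (le_localAlg_Ico inf_le_left inf_le_right) (le_inf ?_ ?_)
      · exact localAlg_mono fun j hj => (Finset.mem_Ico.mp hj).1
      · exact localAlg_mono fun j hj => (Finset.mem_Ico.mp hj).2
    exact congrArg (fun B : StarSubalgebra ℂ c.Alg => Module.finrank ℂ B) this
  have hu1pos : 0 < u 1 := by
    rw [hu1]
    have := finiteDimensional_localAlg (c := c) (Finset.Ico m (m + R))
    exact Module.finrank_pos
  rw [← hu1]
  choose t ht0 ht using fun y : G => exists_finrank_eq_mul (hα.rangeBoth y) m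
  -- Both sides are the dimension of one intersection, before and after translation by `α z`.
  have hshift : ∀ z x y : G, t (z * y) * u (z * x) = t y * u x := fun z x y => by
    rw [← ht y (α x) (hα.rangeBoth x), ← ht (z * y) (α (z * x)) (hα.rangeBoth _), map_mul, map_mul,
      finrank_imgAlg_mul]
  -- Taking `z = g ^ k` and `y = z⁻¹`, once with `x = g` and once with `x = 1`, and eliminating `t
  -- z⁻¹`, shows that the ratio `u (g ^ k) / u 1` gains a factor `u g / u 1` at each step.
  have hstep : ∀ k : ℕ, u (g ^ (k + 1)) * u 1 = u (g ^ k) * u g := fun k => by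
    have h1 := hshift (g ^ k) g (g ^ k)⁻¹
    have h2 := hshift (g ^ k) 1 (g ^ k)⁻¹
    rw [mul_inv_cancel, ← pow_succ] at h1
    rw [mul_inv_cancel, mul_one] at h2
    refine Nat.eq_of_mul_eq_mul_left (ht0 1) ?_
    calc t 1 * (u (g ^ (k + 1)) * u 1) = t 1 * u (g ^ (k + 1)) * u 1 := by ring
      _ = t (g ^ k)⁻¹ * u 1 * u g := by rw [h1]; ring
      _ = _ := by rw [← h2]; ring
  have hpow : ∀ k : ℕ, u (g ^ k) * u 1 ^ k = u 1 * u g ^ k := by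
    intro k
    induction k with
    | zero => simp
    | succ k ih =>
      calc u (g ^ (k + 1)) * u 1 ^ (k + 1) = u (g ^ (k + 1)) * u 1 * u 1 ^ k := by ring
        _ = u (g ^ k) * u 1 ^ k * u g := by rw [hstep]; ring
        _ = _ := by rw [ih]; ring
  -- At the order of `g` the ratio returns to one, so `u g` and `u 1` have equal powers and
  -- coincide.
  have hfin := hpow (orderOf g)
  rw [pow_orderOf_eq_one] at hfin
  have h1 := Nat.eq_of_mul_eq_mul_left hu1pos hfin
  exact (Nat.pow_left_injective (orderOf_pos g).ne' h1).symm

end Index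

namespace SpinChain

variable {c : SpinChain}

/-! ### Gluing automorphisms -/

/-- The observables supported in `[b, ∞)` which commute with `a(A_{≥ m})`. -/
def boundaryAlg (a : c.Alg ≃⋆ₐ[ℂ] c.Alg) (b m : ℤ) : StarSubalgebra ℂ c.Alg :=
  c.localAlg (Set.Ici b) ⊓ imgAlg a (Set.Iio m)

section Boundary

variable {a : c.Alg ≃⋆ₐ[ℂ] c.Alg} {R : ℕ} (ha : RangeBoth a R) {b m : ℤ}
include ha

/-- A reduction to finite dimension: an element of `A_{< m + R}` commutes with `A_{≥ m + R}` anyway,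
so commuting with `a(A_{≥ m}) ∩ A_{< m + R}` is enough to commute with `a(A_{≥ m})`. -/
theorem RangeBoth.mem_boundaryAlg_iff {x : c.Alg} : x ∈ boundaryAlg a b m ↔
    x ∈ c.localAlg (Finset.Ico b (m + R) : Set ℤ) ∧
      ∀ y ∈ imgAlg a (Set.Ici m) ⊓ c.localAlg (Set.Iio (m + R)), Commute y x := by
  constructor
  · rintro ⟨h1, h2⟩
    refine ⟨?_, fun y hy => commute_imgAlg (disjoint_Ici_Iio m) hy.1 h2⟩
    refine le_localAlg_Ico (B := boundaryAlg a b m) inf_le_left ?_ ⟨h1, h2⟩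
    exact fun y hy => ha.imgAlg_Iio_le le_rfl hy.2
  · rintro ⟨h1, h2⟩
    refine ⟨localAlg_mono (fun j hj => (Finset.mem_Ico.mp hj).1) h1, ?_⟩
    refine mem_imgAlg_iff.mpr fun j hj M => ?_
    refine ha.commute_of_commute (m := m) h2 (fun y hy => ?_) le_rfl
      (apply_mem_imgAlg.mpr (site_mem_localAlg (by simpa using hj) M))
    exact commute_localAlg (disjoint_Ici_Iio _) hy
      (localAlg_mono (fun j hj => (Finset.mem_Ico.mp hj).2) h1)

/-- The local part of `a'(A_{≥ m})` below `m + R` is the image of observables in `[m, m + 2R)`,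
since the inverse spreads by at most `R`. This locality of the boundary algebra is behind the local
computability of the anomaly. -/
theorem RangeBoth.boundaryAlg_le_of_eq {a' : c.Alg ≃⋆ₐ[ℂ] c.Alg} (ha' : RangeBoth a' R)
    (h : ∀ x ∈ c.localAlg (Finset.Ico m (m + 2 * R) : Set ℤ), a x = a' x) :
    boundaryAlg a b m ≤ boundaryAlg a' b m := by
  intro w hw
  rw [ha.mem_boundaryAlg_iff] at hw
  rw [ha'.mem_boundaryAlg_iff]
  refine ⟨hw.1, fun y hy => hw.2 y ⟨?_, hy.2⟩⟩
  have h1 : a'.symm y ∈ c.localAlg (Set.Ici m) := mem_imgAlg.mp hy.1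
  have h2 : a'.symm y ∈ c.localAlg (Set.Iio (m + 2 * R)) := ha'.2.apply_Iio (by omega) hy.2
  have h3 := h (a'.symm y)
    (localAlg_mono (fun j hj => Finset.mem_coe.mpr (Finset.mem_Ico.mpr ⟨hj.1, hj.2⟩))
      (mem_localAlg_inter h1 h2))
  rw [a'.apply_symm_apply] at h3
  rw [← h3]
  exact apply_mem_imgAlg.mpr h1

/-- Observables near the cut are generated by the boundary algebra and
`a(A_{≥ m}) ∩ A_{< m + R}`. -/
theorem RangeBoth.mem_of_boundaryAlg_le (hb : b + R ≤ m) {S : StarSubalgebra ℂ c.Alg}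
    (h1 : boundaryAlg a b m ≤ S) (h2 : imgAlg a (Set.Ici m) ⊓ c.localAlg (Set.Iio (m + R)) ≤ S)
    {x : c.Alg} (hx : x ∈ c.localAlg (Finset.Ico b (m + R) : Set ℤ)) : x ∈ S := by
  obtain ⟨n, hn, Ψ, hΨ⟩ := ha.exists_matrixHom (m := m) le_rfl
  have hle : Ψ.range ≤ c.localAlg (Finset.Ico b (m + R) : Set ℤ) := by
    rw [hΨ]
    exact le_localAlg_Ico (fun y hy => ha.imgAlg_Ici_le hb hy.1) inf_le_right
  rw [eq_sum_coeff Ψ x]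
  refine sum_mem fun p _ => sum_mem fun q _ => mul_mem (h2 (hΨ ▸ ⟨_, rfl⟩)) (h1 ?_)
  rw [ha.mem_boundaryAlg_iff]
  refine ⟨coeff_mem Ψ hle hx p q, fun y hy => ?_⟩
  rw [← hΨ] at hy
  obtain ⟨M, rfl⟩ := hy
  exact commute_coeff Ψ p q x M

omit ha in
theorem finrank_range_matrixHom {n : ℕ} (hn : 0 < n) (Ψ : Matrix (Fin n) (Fin n) ℂ →⋆ₐ[ℂ] c.Alg) :
    Module.finrank ℂ Ψ.range = n ^ 2 := by
  have : Nonempty (Fin n) := ⟨⟨0, hn⟩⟩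
  have h1 : Function.Injective Ψ := RingHom.injective (Ψ : Matrix (Fin n) (Fin n) ℂ →+* c.Alg)
  have h2 := LinearMap.finrank_range_of_inj (f := Ψ.toAlgHom.toLinearMap) h1
  rw [Module.finrank_matrix] at h2
  simp only [Module.finrank_self, Fintype.card_fin, mul_one] at h2
  rw [sq]
  exact h2

/-- If the index is trivial, then the sites in `[b, m)` can be identified with the boundary
algebra. -/
theorem RangeBoth.exists_boundaryHom (hb : b + R ≤ m)
    (hidx : Module.finrank ℂ (imgAlg a (Set.Ici m) ⊓ c.localAlg (Set.Iio (m + R)) :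
      StarSubalgebra ℂ c.Alg) = Module.finrank ℂ (c.localAlg (Finset.Ico m (m + R) : Set ℤ))) :
    ∃ θ : c.localAlg (Finset.Ico b m : Set ℤ) →⋆ₐ[ℂ] c.Alg, θ.range = boundaryAlg a b m := by
  obtain ⟨n, hn, Ψ, hΨ⟩ := ha.exists_matrixHom (m := m) le_rfl
  obtain ⟨n₁, hn₁, Ψ₁, hΨ₁⟩ := exists_matrixHom_range_eq c (Finset.Ico m (m + R))
  obtain ⟨k₀, hk₀, Ψ₀, hΨ₀⟩ := exists_matrixHom_range_eq c (Finset.Ico b m)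
  have hnn : n ^ 2 = n₁ ^ 2 := by
    rw [← finrank_range_matrixHom hn Ψ, ← finrank_range_matrixHom hn₁ Ψ₁, hΨ, hΨ₁, hidx]
  have hfd := finiteDimensional_localAlg (c := c) (Finset.Ico b (m + R))
  have hBle : boundaryAlg a b m ≤ c.localAlg (Finset.Ico b (m + R) : Set ℤ) := fun x hx =>
    (ha.mem_boundaryAlg_iff.mp hx).1
  have hfd' := finiteDimensional_of_le_localAlg _ hBle
  -- A central element of the boundary algebra commutes with the boundary algebra and with `a(A_{≥
  -- m}) ∩ A_{< m + R}`. These generate `A_[b, m + R)`, so it is a scalar.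
  obtain ⟨k, hk, Φ, hΦ⟩ :=
    exists_matrixHom_range_eq_of_center (boundaryAlg a b m) fun z hz hzc => by
    refine exists_eq_algebraMap_of_commute fun j M => ?_
    have hz' := ha.mem_boundaryAlg_iff.mp hz
    by_cases hj : j ∈ (Finset.Ico b (m + R) : Set ℤ)
    · have h1 := ha.mem_of_boundaryAlg_le (S := StarSubalgebra.centralizer ℂ {z}) hb
        (fun y hy => by
          rw [StarSubalgebra.mem_centralizer_iff]
          rintro _ rfl
          refine ⟨(hzc y hy).symm, ?_⟩
          have := congrArg star (hzc _ (star_mem hy)).eq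
          simpa using this)
        (fun y hy => by
          rw [StarSubalgebra.mem_centralizer_iff]
          rintro _ rfl
          refine ⟨(hz'.2 y hy).symm, ?_⟩
          have := congrArg star (hz'.2 _ (star_mem hy)).eq
          simpa using this) (site_mem_localAlg hj M)
      rw [StarSubalgebra.mem_centralizer_iff] at h1
      exact (h1 z rfl).1.symm
    · exact mem_localAlg_iff.mp hz'.1 j hj M
  -- The algebra `A_[b, m + R)` is factored in two ways: as `a(A_{≥ m}) ∩ A_{< m + R}` tensored with
  -- the boundary algebra, and as `A_[m, m + R)` tensored with `A_[b, m)`. The first factors have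
  -- equal dimension by hypothesis, hence so do the second ones.
  have hY : Module.finrank ℂ (c.localAlg (Finset.Ico b (m + R) : Set ℤ)) = n ^ 2 * k ^ 2 := by
    rw [← finrank_range_matrixHom hk Φ, hΦ]
    have := finrank_eq_card_sq_mul Ψ (c.localAlg (Finset.Ico b (m + R) : Set ℤ))
      (boundaryAlg a b m) (by
        rw [hΨ]
        exact le_localAlg_Ico (fun y hy => ha.imgAlg_Ici_le hb hy.1) inf_le_right)
      (fun x => by
        rw [ha.mem_boundaryAlg_iff, ← hΨ]
        refine and_congr_right fun _ => ⟨fun h M => h _ ⟨M, rfl⟩, ?_⟩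
        rintro h _ ⟨M, rfl⟩
        exact h M)
    rwa [Fintype.card_fin] at this
  have hY' : Module.finrank ℂ (c.localAlg (Finset.Ico b (m + R) : Set ℤ)) = n₁ ^ 2 * k₀ ^ 2 := by
    rw [← finrank_range_matrixHom hk₀ Ψ₀, hΨ₀]
    have := finrank_eq_card_sq_mul Ψ₁ (c.localAlg (Finset.Ico b (m + R) : Set ℤ))
      (c.localAlg (Finset.Ico b m : Set ℤ)) (by
        rw [hΨ₁]
        exact localAlg_mono (Finset.coe_subset.mpr (Finset.Ico_subset_Ico_left (by omega))))
      (fun x => by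
        constructor
        · intro hx
          refine ⟨localAlg_mono (Finset.coe_subset.mpr
            (Finset.Ico_subset_Ico_right (by omega))) hx, fun M => ?_⟩
          have h1 : Ψ₁ M ∈ Ψ₁.range := ⟨M, rfl⟩
          rw [hΨ₁] at h1
          refine commute_localAlg ?_ h1 hx
          rw [Finset.disjoint_coe]
          exact (Finset.Ico_disjoint_Ico_consecutive b m (m + R)).symm
        · rintro ⟨h1, h2⟩
          refine mem_localAlg_iff.mpr fun j hj M => ?_
          by_cases hj' : j ∈ (Finset.Ico b (m + R) : Set ℤ)
          · have h3 : site j M ∈ Ψ₁.range := by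
              rw [hΨ₁]
              refine site_mem_localAlg ?_ M
              simp only [Finset.coe_Ico, Set.mem_Ico] at hj hj' ⊢
              omega
            obtain ⟨M', hM'⟩ := h3
            rw [← hM']
            exact h2 M'
          · exact mem_localAlg_iff.mp h1 j hj' M)
    rwa [Fintype.card_fin] at this
  have hkk : k = k₀ := by
    rw [hY, hnn] at hY'
    exact Nat.pow_left_injective two_ne_zero
      (Nat.eq_of_mul_eq_mul_left (by positivity) hY')
  subst hkk
  rw [← hΨ₀]
  have : Nonempty (Fin k) := ⟨⟨0, hk⟩⟩
  have h1 : Function.Injective Ψ₀ := RingHom.injective (Ψ₀ : Matrix (Fin k) (Fin k) ℂ →+* c.Alg)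
  let e : Matrix (Fin k) (Fin k) ℂ ≃⋆ₐ[ℂ] Ψ₀.range := StarAlgEquiv.ofInjective Ψ₀ h1
  refine ⟨Φ.comp (e.symm : Ψ₀.range →⋆ₐ[ℂ] Matrix (Fin k) (Fin k) ℂ), ?_⟩
  rw [← hΦ]
  refine le_antisymm ?_ ?_
  · rintro _ ⟨x, rfl⟩
    exact ⟨e.symm x, rfl⟩
  · rintro _ ⟨M, rfl⟩
    exact ⟨e M, congrArg Φ (e.symm_apply_apply M)⟩

omit ha in
-- The homomorphism `θ` lives only on a local algebra. The preimage of `T` is finite-dimensional,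
-- hence closed, and contains the generators, so `T` itself need not be closed.
theorem range_le_of_sites {C : Type*} [CStarAlgebra C] {S : Finset ℤ}
    (θ : c.localAlg (S : Set ℤ) →⋆ₐ[ℂ] C) (T : StarSubalgebra ℂ C)
    (h : ∀ j (hj : j ∈ (S : Set ℤ)), ∀ M, θ ⟨site j M, site_mem_localAlg hj M⟩ ∈ T) :
    θ.range ≤ T := by
  let B := (T.comap θ).map (c.localAlg (S : Set ℤ)).subtype
  have hfd : FiniteDimensional ℂ (Subalgebra.toSubmodule B.toSubalgebra) :=
    finiteDimensional_of_le_localAlg (B := B) S (by rintro _ ⟨w, _, rfl⟩; exact w.2)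
  have hle : c.localAlg (S : Set ℤ) ≤ B := by
    refine StarSubalgebra.topologicalClosure_minimal (StarAlgebra.adjoin_le
      (Set.iUnion₂_subset fun j hj => ?_))
      (Submodule.closed_of_finiteDimensional (Subalgebra.toSubmodule B.toSubalgebra))
    rintro _ ⟨M, rfl⟩
    exact ⟨⟨site j M, site_mem_localAlg hj M⟩, h j hj M, rfl⟩
  rintro _ ⟨y, rfl⟩
  obtain ⟨w, hw, hwy⟩ := hle y.2
  have : w = y := Subtype.ext hwy
  rw [← this]
  exact hw

/-- The automorphism which is the identity on the sites below `b`, the given homomorphism `θ` on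
`[b, m)`, and `a` on the sites above `m`. -/
theorem RangeBoth.exists_glue (hb : b + R ≤ m)
    (θ : c.localAlg (Finset.Ico b m : Set ℤ) →⋆ₐ[ℂ] c.Alg) (hθ : θ.range = boundaryAlg a b m) :
    ∃ ρ : c.Alg ≃⋆ₐ[ℂ] c.Alg, (∀ j < b, ∀ M, ρ (site j M) = site j M) ∧
      (∀ j (hj : j ∈ (Finset.Ico b m : Set ℤ)), ∀ M,
        ρ (site j M) = θ ⟨site j M, site_mem_localAlg hj M⟩) ∧
      ∀ j ≥ m, ∀ M, ρ (site j M) = a (site j M) := by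
  classical
  obtain ⟨φ, hφ1, hφ2, hφ3⟩ : ∃ φ : ∀ j, c.OnSite j →⋆ₐ[ℂ] c.Alg,
      (∀ j, j < b → ∀ M, φ j M = site j M) ∧
      (∀ j (hj : j ∈ (Finset.Ico b m : Set ℤ)), ∀ M,
        φ j M = θ ⟨site j M, site_mem_localAlg hj M⟩) ∧
      ∀ j, m ≤ j → ∀ M, φ j M = a (site j M) := by
    refine ⟨fun j => if hj : j ∈ (Finset.Ico b m : Set ℤ) then
      θ.comp (StarAlgHom.codRestrict (site j) _ (site_mem_localAlg hj))
      else if j < b then site j else (a : c.Alg →⋆ₐ[ℂ] c.Alg).comp (site j),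
      fun j hj M => ?_, fun j hj M => ?_, fun j hj M => ?_⟩
    · have : j ∉ (Finset.Ico b m : Set ℤ) := by
        simp only [Finset.coe_Ico, Set.mem_Ico]; omega
      simp only [dif_neg this, if_pos hj]
    · simp only [dif_pos hj]
      rfl
    · have : j ∉ (Finset.Ico b m : Set ℤ) := by
        simp only [Finset.coe_Ico, Set.mem_Ico]; omega
      simp only [dif_neg this, if_neg (show ¬ j < b by omega)]
      rfl
  have hIco : ∀ j, b ≤ j → j < m → j ∈ (Finset.Ico b m : Set ℤ) := fun j h1 h2 =>
    Finset.mem_coe.mpr (Finset.mem_Ico.mpr ⟨h1, h2⟩)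
  have hm1 : ∀ j, j < b → ∀ M, φ j M ∈ c.localAlg (Set.Iio b) := fun j hj M => by
    rw [hφ1 j hj]; exact site_mem_localAlg (Set.mem_Iio.mpr hj) M
  have hm2 : ∀ j (_ : j ∈ (Finset.Ico b m : Set ℤ)), ∀ M, φ j M ∈ boundaryAlg a b m :=
    fun j hj M => by rw [hφ2 j hj, ← hθ]; exact ⟨_, rfl⟩
  have hm3 : ∀ j, m ≤ j → ∀ M, φ j M ∈ imgAlg a (Set.Ici m) := fun j hj M => by
    rw [hφ3 j hj]; exact apply_mem_imgAlg.mpr (site_mem_localAlg (Set.mem_Ici.mpr hj) M)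
  -- The boundary algebra lies above `b` and commutes with `a(A_{≥ m})`, and `b + R ≤ m` keeps
  -- `a(A_{≥ m})` above `b`. Hence the three pieces commute with one another.
  have hlt : ∀ i j, i < j → ∀ M N, Commute (φ i M) (φ j N) := fun i j hij M N => by
    rcases lt_or_ge i b with hi | hi
    · have h1 := hm1 i hi M
      rcases lt_or_ge j b with hj | hj
      · rw [hφ1 i hi, hφ1 j hj]; exact site_comm hij.ne M N
      · rcases lt_or_ge j m with hj' | hj'
        · exact (commute_localAlg (disjoint_Ici_Iio b)
            (hm2 j (hIco j hj hj') N).1 h1).symm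
        · exact (commute_localAlg (disjoint_Ici_Iio b)
            (ha.imgAlg_Ici_le hb (hm3 j hj' N)) h1).symm
    · rcases lt_or_ge i m with hi' | hi'
      · have h1 := hm2 i (hIco i hi hi') M
        rcases lt_or_ge j m with hj' | hj'
        · rw [hφ2 i (hIco i hi hi'), hφ2 j (hIco j (by omega) hj')]
          have h2 : Commute (⟨site i M, site_mem_localAlg (hIco i hi hi') M⟩ :
              c.localAlg (Finset.Ico b m : Set ℤ))
              ⟨site j N, site_mem_localAlg (hIco j (by omega) hj') N⟩ :=
            Subtype.ext (site_comm hij.ne M N).eq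
          exact h2.map θ
        · exact (commute_imgAlg (disjoint_Ici_Iio m) (hm3 j hj' N) h1.2).symm
      · rw [hφ3 i hi', hφ3 j (by omega)]
        exact (site_comm hij.ne M N).map a
  have hcomm : ∀ i j, i ≠ j → ∀ M N, Commute (φ i M) (φ j N) := fun i j hij M N => by
    rcases lt_or_gt_of_ne hij with h | h
    · exact hlt i j h M N
    · exact (hlt j i h N M).symm
  obtain ⟨f, hf⟩ := exists_lift φ hcomm
  have hcl : IsClosed (f.range : Set c.Alg) := (isometry_hom f).isClosedEmbedding.isClosed_range
  have hr1 : imgAlg a (Set.Ici m) ≤ f.range := fun x hx => by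
    have h1 := hom_localAlg_mem (a : c.Alg →⋆ₐ[ℂ] c.Alg) (Set.Ici m) f.range hcl
      (fun j hj M => ⟨site j M, (hf j M).trans (hφ3 j hj M)⟩) (mem_imgAlg.mp hx)
    change a (a.symm x) ∈ f.range at h1
    rwa [a.apply_symm_apply] at h1
  have hr2 : boundaryAlg a b m ≤ f.range := hθ ▸ range_le_of_sites θ f.range
    fun j hj M => ⟨site j M, (hf j M).trans (hφ2 j hj M)⟩
  -- Only surjectivity is at stake. Sites in `[b, m + R)` are generated by the boundary algebra and
  -- `a(A_{≥ m})`, and sites from `m + R` on already lie in `a(A_{≥ m})`.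
  have hbij : Function.Bijective f := bijective_hom f fun j M => by
    rcases lt_or_ge j b with hj | hj
    · exact ⟨site j M, (hf j M).trans (hφ1 j hj M)⟩
    · rcases lt_or_ge j (m + R) with hj' | hj'
      · exact ha.mem_of_boundaryAlg_le hb hr2 (inf_le_left.trans hr1)
          (site_mem_localAlg (by simp [hj, hj']) M)
      · exact hr1 (ha.localAlg_Ici_le le_rfl (site_mem_localAlg (Set.mem_Ici.mpr hj') M))
  exact ⟨StarAlgEquiv.ofBijective f hbij, fun j hj M => (hf j M).trans (hφ1 j hj M),
    fun j hj M => (hf j M).trans (hφ2 j hj M), fun j hj M => (hf j M).trans (hφ3 j hj M)⟩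

end Boundary

end SpinChain

namespace Symm

variable {G : Type*} [Group G] {c : SpinChain} {α : Symm G c} {R : ℕ}

/-! ### Right restrictions -/

theorem exists_rangeLE [Finite G] (α : Symm G c) : ∃ R, α.RangeLE R := by
  choose r hr using α.isQCA
  obtain ⟨R, hR⟩ := (Set.finite_range r).bddAbove
  exact ⟨R, fun g => (hr g).mono (hR ⟨g, rfl⟩)⟩

theorem isRightRestriction_of_sites {j : ℤ} {L : ℕ} {ρ : G → (c.Alg ≃⋆ₐ[ℂ] c.Alg)}
    (h1 : ∀ g, ∀ i ≥ j + L, ∀ M, ρ g (site i M) = α g (site i M))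
    (h2 : ∀ g, ∀ i < j - L, ∀ M, ρ g (site i M) = site i M) : α.IsRightRestriction j L ρ :=
  fun g => ⟨fun _ hx => aut_eq_on_localAlg (fun i hi M => h1 g i hi M) hx,
    fun _ hx => aut_eq_on_localAlg (g := (1 : c.Alg ≃⋆ₐ[ℂ] c.Alg)) (fun i hi M => h2 g i hi M) hx⟩

theorem IsRightRestriction.mono {j j' : ℤ} {L L' : ℕ} {ρ : G → (c.Alg ≃⋆ₐ[ℂ] c.Alg)}
    (h : α.IsRightRestriction j L ρ) (h1 : j + L ≤ j' + L') (h2 : j' - L' ≤ j - L) :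
    α.IsRightRestriction j' L' ρ := fun g =>
  ⟨fun x hx => (h g).1 x (localAlg_mono (Set.Ici_subset_Ici.mpr h1) hx),
    fun x hx => (h g).2 x (localAlg_mono (Set.Iio_subset_Iio h2) hx)⟩

theorem RangeLE.exists_boundaryHom [Finite G] (hα : α.RangeLE R) {b m : ℤ} (hb : b + R ≤ m) :
    ∃ θ : G → (c.localAlg (Finset.Ico b m : Set ℤ) →⋆ₐ[ℂ] c.Alg),
      ∀ g, (θ g).range = boundaryAlg (α g) b m := by
  choose θ hθ using fun g => (hα.rangeBoth g).exists_boundaryHom hb (hα.finrank_eq m g)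
  exact ⟨θ, hθ⟩

theorem RangeLE.exists_isRightRestriction [Finite G] (hα : α.RangeLE R) (j : ℤ) :
    ∃ ρ, α.IsRightRestriction j (2 * R) ρ := by
  -- The gluing needs only `b + R ≤ m`. The window is placed symmetrically about `j`, which gives
  -- defect size `2 * R`.
  obtain ⟨θ, hθ⟩ := hα.exists_boundaryHom (b := j - 2 * R) (m := j + 2 * R) (by omega)
  choose ρ h1 _ h3 using fun g => (hα.rangeBoth g).exists_glue (by omega) (θ g) (hθ g)
  exact ⟨ρ, isRightRestriction_of_sites (fun g i hi M => h3 g i (by push_cast at hi; omega) M)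
    (fun g i hi M => h1 g i (by push_cast at hi; omega) M)⟩

section Restriction

variable {j : ℤ} {L : ℕ} {ρ : G → (c.Alg ≃⋆ₐ[ℂ] c.Alg)}

theorem IsRightRestriction.symm_apply_left (h : α.IsRightRestriction j L ρ) (g : G) {x : c.Alg}
    (hx : x ∈ c.localAlg (Set.Iio (j - L))) : (ρ g).symm x = x := by
  rw [StarAlgEquiv.symm_apply_eq, (h g).2 x hx]

theorem apply_inv_apply (α : Symm G c) (g : G) (x : c.Alg) : α g (α g⁻¹ x) = x := by
  rw [← StarAlgEquiv.mul_apply, ← map_mul, mul_inv_cancel, map_one]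
  rfl

/-- The extra `R` ensures that `α g⁻¹ x` still lies where `ρ g` agrees with `α g`. It accounts for
the asymmetric support of the fusion operators. -/
theorem IsRightRestriction.symm_apply_right (h : α.IsRightRestriction j L ρ) (hα : α.RangeLE R)
    (g : G) {x : c.Alg} (hx : x ∈ c.localAlg (Set.Ici (j + L + R))) :
    (ρ g).symm x = α g⁻¹ x := by
  rw [StarAlgEquiv.symm_apply_eq, (h g).1 _ ((hα g⁻¹).apply_Ici le_rfl hx), apply_inv_apply]

theorem IsRightRestriction.fusion_apply_left (h : α.IsRightRestriction j L ρ) (g k : G) {x : c.Alg}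
    (hx : x ∈ c.localAlg (Set.Iio (j - L))) : (ρ g * ρ k * (ρ (g * k))⁻¹) x = x := by
  rw [StarAlgEquiv.mul_apply, StarAlgEquiv.mul_apply, StarAlgEquiv.aut_inv,
    h.symm_apply_left _ hx, (h k).2 x hx, (h g).2 x hx]

theorem IsRightRestriction.fusion_apply_right (h : α.IsRightRestriction j L ρ) (hα : α.RangeLE R)
    (g k : G) {x : c.Alg} (hx : x ∈ c.localAlg (Set.Ici (j + L + R))) :
    (ρ g * ρ k * (ρ (g * k))⁻¹) x = x := by
  have h1 : α k (α (g * k)⁻¹ x) = α g⁻¹ x := by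
    rw [← StarAlgEquiv.mul_apply, ← map_mul, mul_inv_rev, mul_inv_cancel_left]
  rw [StarAlgEquiv.mul_apply, StarAlgEquiv.mul_apply, StarAlgEquiv.aut_inv,
    h.symm_apply_right hα _ hx, (h k).1 _ ((hα _).apply_Ici le_rfl hx), h1,
    (h g).1 _ ((hα _).apply_Ici le_rfl hx), apply_inv_apply]

/-- To the left of the window the restrictions are trivial, and to its right they multiply like `α`.
The defect of multiplicativity is therefore a local automorphism, which is inner. -/
theorem IsRightRestriction.exists_fusion (h : α.IsRightRestriction j L ρ) (hα : α.RangeLE R) :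
    ∃ F, IsFusion ρ F ∧
      ∀ g k, (F g k : c.Alg) ∈ c.localAlg (Set.Icc (j - L) (j + L + R)) := by
  have h1 : ∀ g k, ∃ U : unitary c.Alg,
      (U : c.Alg) ∈ c.localAlg (Finset.Icc (j - L) (j + L + R) : Set ℤ) ∧
        ρ g * ρ k * (ρ (g * k))⁻¹ = Ad U := fun g k =>
    exists_eq_Ad _ _ fun i hi M => by
      rw [Finset.mem_Icc] at hi
      rcases lt_or_ge i (j - L) with hi' | hi'
      · exact h.fusion_apply_left g k (site_mem_localAlg (Set.mem_Iio.mpr hi') M)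
      · exact h.fusion_apply_right hα g k (site_mem_localAlg (Set.mem_Ici.mpr (by omega)) M)
  choose F hF1 hF2 using h1
  refine ⟨F, fun g k => ?_, fun g k => ?_⟩
  · rw [← hF2, inv_mul_cancel_right]
  · rw [← Finset.coe_Icc]
    exact hF1 g k

/-- Two right restrictions of the same symmetry differ by inner automorphisms. -/
theorem IsRightRestriction.exists_eq_Ad_mul {ρ' : G → (c.Alg ≃⋆ₐ[ℂ] c.Alg)}
    (h : α.IsRightRestriction j L ρ) (h' : α.IsRightRestriction j L ρ') (hα : α.RangeLE R) :
    ∃ V : G → unitary c.Alg, ρ' = fun g => Ad (V g) * ρ g := by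
  have h1 : ∀ g, ∃ U : unitary c.Alg,
      (U : c.Alg) ∈ c.localAlg (Finset.Icc (j - L) (j + L + R) : Set ℤ) ∧
        ρ' g * (ρ g)⁻¹ = Ad U := fun g =>
    exists_eq_Ad _ _ fun i hi M => by
      rw [Finset.mem_Icc] at hi
      rw [StarAlgEquiv.mul_apply, StarAlgEquiv.aut_inv]
      rcases lt_or_ge i (j - L) with hi' | hi'
      · have hm := site_mem_localAlg (Set.mem_Iio.mpr hi') M
        rw [h.symm_apply_left _ hm, (h' g).2 _ hm]
      · have hm : site i M ∈ c.localAlg (Set.Ici (j + L + R)) :=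
          site_mem_localAlg (Set.mem_Ici.mpr (by omega)) M
        rw [h.symm_apply_right hα _ hm, (h' g).1 _ ((hα _).apply_Ici le_rfl hm), apply_inv_apply]
  choose V _ hV using h1
  refine ⟨V, funext fun g => ?_⟩
  rw [← hV, inv_mul_cancel_right]

end Restriction

/-! ### The class of the phases is well defined -/

/-- `ω` is obtained from some right restriction of `α` and fusion operators of it. -/
def HasPhase (α : Symm G c) (ω : G → G → G → Circle) : Prop :=
  ∃ (j : ℤ) (L : ℕ) (ρ : G → (c.Alg ≃⋆ₐ[ℂ] c.Alg)) (F : G → G → unitary c.Alg),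
    α.IsRightRestriction j L ρ ∧ IsFusion ρ F ∧ IsFusionPhase ρ F ω

theorem HasPhase.isThreeCocycle {ω : G → G → G → Circle} (h : α.HasPhase ω) : IsThreeCocycle ω := by
  obtain ⟨_, _, _, _, _, hF, hω⟩ := h
  exact hω.isThreeCocycle hF

theorem exists_hasPhase [Finite G] (α : Symm G c) : ∃ ω, α.HasPhase ω := by
  obtain ⟨R, hR⟩ := α.exists_rangeLE
  obtain ⟨ρ, hρ⟩ := hR.exists_isRightRestriction 0
  obtain ⟨F, hF, _⟩ := hρ.exists_fusion hR
  obtain ⟨ω, hω, _⟩ := hF.existsUnique_phase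
  exact ⟨ω, 0, 2 * R, ρ, F, hρ, hF, hω⟩

theorem HasPhase.exists_cobounds [Finite G] {ω ω' : G → G → G → Circle} (h : α.HasPhase ω)
    (h' : α.HasPhase ω') : ∃ lam, Cobounds lam ω ω' := by
  obtain ⟨R, hR⟩ := α.exists_rangeLE
  obtain ⟨j, L, ρ, F, hρ, hF, hω⟩ := h
  obtain ⟨j', L', ρ', F', hρ', hF', hω'⟩ := h'
  -- A common window about `j`, large enough to contain both defect regions.
  have h1 := hρ.mono (j' := j) (L' := L + L' + (j - j').natAbs) (by omega) (by omega)
  have h2 := hρ'.mono (j' := j) (L' := L + L' + (j - j').natAbs) (by omega) (by omega)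
  obtain ⟨V, rfl⟩ := h1.exists_eq_Ad_mul h2 hR
  obtain ⟨F'', hF'', hω''⟩ := exists_fusion_of_Ad_mul hF hω V
  exact _root_.exists_cobounds hF'' hω'' hF' hω'

/-! ### Local computability -/

/-- Both symmetries are cut with the same identification `θ` of `[j - 2R, m)` with their common
boundary algebra. The restrictions then agree on everything left of the end of the interval, so the
same fusion operators serve both and yield the same phases. -/
theorem exists_hasPhase_of_eq_on_Icc [Finite G] {β : Symm G c} (hα : α.RangeLE R)
    (hβ : β.RangeLE R) {a : ℤ}
    (h : ∀ g, ∀ x ∈ c.localAlg (Set.Icc a (a + 8 * R)), α g x = β g x) :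
    ∃ ω, α.HasPhase ω ∧ β.HasPhase ω := by
  -- The cut sits at the middle of the interval. Fusion operators are supported in `[j - 2R, j +
  -- 3R]`, and `j + 3R = a + 7R`, so `N` is the first site to their right. The first site beyond the
  -- interval is `N + R`.
  set j : ℤ := a + 4 * R with hj
  set m : ℤ := j + 2 * R with hm
  set N : ℤ := a + 7 * R + 1 with hN
  obtain ⟨θ, hθ⟩ := hα.exists_boundaryHom (b := j - 2 * R) (m := m) (by omega)
  have hθ' : ∀ g, (θ g).range = boundaryAlg (β g) (j - 2 * R) m := fun g => by
    have hle : (Finset.Ico m (m + 2 * R) : Set ℤ) ⊆ Set.Icc a (a + 8 * R) := fun i hi => by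
      simp only [Finset.coe_Ico, Set.mem_Ico, Set.mem_Icc] at hi ⊢
      omega
    rw [hθ]
    exact le_antisymm
      ((hα.rangeBoth g).boundaryAlg_le_of_eq (hβ.rangeBoth g)
        fun x hx => h g x (localAlg_mono hle hx))
      ((hβ.rangeBoth g).boundaryAlg_le_of_eq (hα.rangeBoth g)
        fun x hx => (h g x (localAlg_mono hle hx)).symm)
  choose ρ h1 h2 h3 using fun g => (hα.rangeBoth g).exists_glue (by omega) (θ g) (hθ g)
  choose σ k1 k2 k3 using fun g => (hβ.rangeBoth g).exists_glue (by omega) (θ g) (hθ' g)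
  have hρ : α.IsRightRestriction j (2 * R) ρ :=
    isRightRestriction_of_sites (fun g i hi M => h3 g i (by push_cast at hi; omega) M)
      (fun g i hi M => h1 g i (by push_cast at hi; omega) M)
  have hσ : β.IsRightRestriction j (2 * R) σ :=
    isRightRestriction_of_sites (fun g i hi M => k3 g i (by push_cast at hi; omega) M)
      (fun g i hi M => k1 g i (by push_cast at hi; omega) M)
  have hρσ : ∀ g, ∀ x ∈ c.localAlg (Set.Iio (N + R)), ρ g x = σ g x := fun g x hx => by
    refine aut_eq_on_localAlg (fun i hi M => ?_) hx
    rw [Set.mem_Iio] at hi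
    rcases lt_or_ge i (j - 2 * R) with hi' | hi'
    · rw [h1 g i hi', k1 g i hi']
    · rcases lt_or_ge i m with him | him
      · have hIco : i ∈ (Finset.Ico (j - 2 * R) m : Set ℤ) :=
          Finset.mem_coe.mpr (Finset.mem_Ico.mpr ⟨hi', him⟩)
        rw [h2 g i hIco, k2 g i hIco]
      · rw [h3 g i him, k3 g i him]
        exact h g _ (site_mem_localAlg (Set.mem_Icc.mpr (by omega)) M)
  have hsymm : ∀ g, ∀ x ∈ c.localAlg (Set.Iio N), (ρ g).symm x ∈ c.localAlg (Set.Iio (N + R)) := by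
    intro g x hx
    refine mem_localAlg_iff.mpr fun i hi M => ?_
    rw [Set.mem_Iio, not_lt] at hi
    have hmem : ρ g (site i M) ∈ c.localAlg (Set.Ici N) := by
      rw [h3 g i (by omega)]
      exact (hα g).apply_Ici (m := N + R) le_rfl (site_mem_localAlg (Set.mem_Ici.mpr hi) M)
    simpa using (commute_localAlg (disjoint_Ici_Iio N) hmem hx).map (ρ g).symm
  -- Bounding the two factors one after the other would cost `2R`. On the right, however, `ρ k * (ρ
  -- (g * k))⁻¹` acts like `α g⁻¹`, so the spread is only `R`. In the commutator argument the site
  -- is written as `ρ k (α k⁻¹ (site i M))`.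
  have hmul : ∀ g k, ∀ x ∈ c.localAlg (Set.Iio N),
      ρ k ((ρ (g * k)).symm x) ∈ c.localAlg (Set.Iio (N + R)) := by
    intro g k x hx
    refine mem_localAlg_iff.mpr fun i hi M => ?_
    rw [Set.mem_Iio, not_lt] at hi
    have hs : site i M ∈ c.localAlg (Set.Ici (N + R)) := site_mem_localAlg (Set.mem_Ici.mpr hi) M
    have hv : α k⁻¹ (site i M) ∈ c.localAlg (Set.Ici N) := (hα _).apply_Ici le_rfl hs
    have hv' : α k⁻¹ (site i M) ∈ c.localAlg (Set.Ici (j + (2 * R : ℕ))) :=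
      localAlg_mono (Set.Ici_subset_Ici.mpr (by push_cast; omega)) hv
    have e1 : ρ k (α k⁻¹ (site i M)) = site i M := by rw [(hρ k).1 _ hv', apply_inv_apply]
    have e2 : ρ (g * k) (α k⁻¹ (site i M)) = α g (site i M) := by
      rw [(hρ _).1 _ hv', ← StarAlgEquiv.mul_apply, ← map_mul, mul_inv_cancel_right]
    have hmem : ρ (g * k) (α k⁻¹ (site i M)) ∈ c.localAlg (Set.Ici N) := by
      rw [e2]; exact (hα g).apply_Ici le_rfl hs
    have hc := ((commute_localAlg (disjoint_Ici_Iio N) hmem hx).map (ρ (g * k)).symm).map (ρ k)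
    rwa [(ρ (g * k)).symm_apply_apply, e1] at hc
  have hχ : ∀ g k, ∀ x ∈ c.localAlg (Set.Iio N),
      (ρ g * ρ k * (ρ (g * k))⁻¹) x = (σ g * σ k * (σ (g * k))⁻¹) x := by
    intro g k x hx
    have e1 : (σ (g * k)).symm x = (ρ (g * k)).symm x := by
      rw [StarAlgEquiv.symm_apply_eq, ← hρσ _ _ (hsymm _ x hx), (ρ (g * k)).apply_symm_apply]
    simp only [StarAlgEquiv.mul_apply, StarAlgEquiv.aut_inv]
    rw [e1, ← hρσ k _ (hsymm _ x hx), hρσ g _ (hmul g k x hx)]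
  obtain ⟨F, hF, hFm⟩ := hρ.exists_fusion hα
  have hFN : ∀ g k, (F g k : c.Alg) ∈ c.localAlg (Set.Iio N) := fun g k =>
    localAlg_mono (fun i hi => by
      simp only [Set.mem_Icc, Set.mem_Iio] at hi ⊢
      push_cast at hi
      omega) (hFm g k)
  -- Left of `N` the defects of multiplicativity of `ρ` and `σ` agree. From `N` on the defect of `σ`
  -- is the identity, and so is `Ad (F g k)` because of the support of `F`.
  have hF' : IsFusion σ F := fun g k => by
    rw [← mul_inv_eq_iff_eq_mul]
    refine aut_ext fun i M => ?_
    rcases lt_or_ge i N with hi | hi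
    · rw [← hχ g k _ (site_mem_localAlg (Set.mem_Iio.mpr hi) M), hF, mul_inv_cancel_right]
    · rw [hσ.fusion_apply_right hβ g k (site_mem_localAlg
        (Set.mem_Ici.mpr (by push_cast; omega)) M), Unitary.conjStarAlgAut_apply,
        commute_localAlg (disjoint_Ici_Iio N).symm (hFN g k)
          (site_mem_localAlg (Set.mem_Ici.mpr hi) M), mul_assoc,
        Unitary.mul_star_self_of_mem (F g k).2, mul_one]
  obtain ⟨ω, hω, _⟩ := hF.existsUnique_phase
  refine ⟨ω, ⟨j, 2 * R, ρ, F, hρ, hF, hω⟩, ⟨j, 2 * R, σ, F, hσ, hF', fun f g k => ?_⟩⟩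
  -- The phase relation involves the restriction only through its value on `F g k`, where `ρ` and
  -- `σ` agree.
  rw [← hρσ f _ (localAlg_mono (Set.Iio_subset_Iio (by omega)) (hFN g k))]
  exact hω f g k

end Symm

/-! ### Decoupled symmetries -/

section Decoupled

theorem SpinChain.BlockPartition.add_le (P : BlockPartition) (a : ℤ) (n : ℕ) :
    P.left a + n ≤ P.left (a + n) := by
  induction n with
  | zero => simp
  | succ n ih =>
    have h := P.strictMono (show a + n < a + (n + 1 : ℕ) by push_cast; omega)
    push_cast at h ⊢
    omega

/-- A strictly increasing integer sequence is unbounded in both directions, so there is a last block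
starting at or before `i`. -/
theorem SpinChain.BlockPartition.exists_mem_block (P : BlockPartition) (i : ℤ) :
    ∃ a, i ∈ P.block a := by
  have hb : ∀ a, P.left a ≤ i → a ≤ |i - P.left 0| := fun a ha => by
    by_contra! hcon
    have h0 : 0 ≤ |i - P.left 0| := abs_nonneg _
    obtain ⟨n, rfl⟩ := Int.eq_ofNat_of_zero_le (show 0 ≤ a by omega)
    have h1 := P.add_le 0 n
    have h2 := le_abs_self (i - P.left 0)
    rw [zero_add] at h1
    omega
  have hne : P.left (-(|i - P.left 0|)) ≤ i := by
    obtain ⟨n, hn⟩ := Int.eq_ofNat_of_zero_le (abs_nonneg (i - P.left 0))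
    have h1 := P.add_le (-n) n
    have h2 := neg_abs_le (i - P.left 0)
    rw [hn] at h2 ⊢
    rw [neg_add_cancel] at h1
    omega
  obtain ⟨a, ha, hmax⟩ := Int.exists_greatest_of_bdd (P := fun a => P.left a ≤ i) ⟨_, hb⟩ ⟨_, hne⟩
  refine ⟨a, ha, ?_⟩
  by_contra! hcon
  have := hmax (a + 1) hcon
  omega

variable {G : Type*} [Group G] {c : SpinChain} {α : Symm G c}

/-- If every `α g` preserves the half-line algebra, then the sharp cut, `α g` on the right and the
identity on the left, is again a homomorphism in `g`. All fusion operators can be taken to be one.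
-/
theorem Symm.hasPhase_one_of_apply_mem {j : ℤ}
    (h : ∀ g, ∀ i ≥ j, ∀ M, α g (site i M) ∈ c.localAlg (Set.Ici j)) :
    α.HasPhase fun _ _ _ => 1 := by
  classical
  have hα : ∀ g, ∀ x ∈ c.localAlg (Set.Ici j), α g x ∈ c.localAlg (Set.Ici j) := fun g x hx =>
    hom_localAlg_mem (α g : c.Alg →⋆ₐ[ℂ] c.Alg) (Set.Ici j) _ (isClosed_localAlg _)
      (fun i hi M => h g i hi M) hx
  have hex : ∀ g, ∃ ρ : c.Alg ≃⋆ₐ[ℂ] c.Alg, (∀ i < j, ∀ M, ρ (site i M) = site i M) ∧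
      ∀ i ≥ j, ∀ M, ρ (site i M) = α g (site i M) := fun g => by
    obtain ⟨φ, hφ1, hφ2⟩ : ∃ φ : ∀ i, c.OnSite i →⋆ₐ[ℂ] c.Alg,
        (∀ i < j, ∀ M, φ i M = site i M) ∧ ∀ i ≥ j, ∀ M, φ i M = α g (site i M) := by
      refine ⟨fun i => if i < j then site i else (α g : c.Alg →⋆ₐ[ℂ] c.Alg).comp (site i),
        fun i hi M => by simp only [if_pos hi], fun i hi M => ?_⟩
      simp only [if_neg (not_lt.mpr hi)]
      rfl
    have hlt : ∀ i k, i < k → ∀ M N, Commute (φ i M) (φ k N) := fun i k hik M N => by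
      rcases lt_or_ge i j with hi | hi
      · rw [hφ1 i hi]
        rcases lt_or_ge k j with hk | hk
        · rw [hφ1 k hk]; exact site_comm hik.ne M N
        · rw [hφ2 k hk]
          exact commute_localAlg (disjoint_Ici_Iio j).symm
            (site_mem_localAlg (Set.mem_Iio.mpr hi) M) (h g k hk N)
      · rw [hφ2 i hi, hφ2 k (show k ≥ j by omega)]
        exact (site_comm hik.ne M N).map (α g)
    have hcomm : ∀ i k, i ≠ k → ∀ M N, Commute (φ i M) (φ k N) := fun i k hik M N => by
      rcases lt_or_gt_of_ne hik with hik | hik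
      · exact hlt i k hik M N
      · exact (hlt k i hik N M).symm
    obtain ⟨f, hf⟩ := exists_lift φ hcomm
    have hbij : Function.Bijective f := bijective_hom f fun i M => by
      rcases lt_or_ge i j with hi | hi
      · exact ⟨site i M, (hf i M).trans (hφ1 i hi M)⟩
      -- Surjectivity uses that `α g⁻¹` also preserves the half-line algebra, on which `f` agrees
      -- with `α g`.
      · refine ⟨α g⁻¹ (site i M), ?_⟩
        have h1 : f (α g⁻¹ (site i M)) = (α g : c.Alg →⋆ₐ[ℂ] c.Alg) (α g⁻¹ (site i M)) :=
          eq_on_localAlg (fun k hk N => (hf k N).trans (hφ2 k hk N)) (h g⁻¹ i hi M)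
        exact h1.trans (Symm.apply_inv_apply α g _)
    exact ⟨StarAlgEquiv.ofBijective f hbij, fun i hi M => (hf i M).trans (hφ1 i hi M),
      fun i hi M => (hf i M).trans (hφ2 i hi M)⟩
  choose ρ h1 h2 using hex
  have hres : α.IsRightRestriction j 0 ρ := Symm.isRightRestriction_of_sites
    (fun g i hi M => h2 g i (by simpa using hi) M) (fun g i hi M => h1 g i (by simpa using hi) M)
  refine ⟨j, 0, ρ, fun _ _ => 1, hres, fun g k => ?_, ?_⟩
  · have h1' : Ad (1 : unitary c.Alg) = 1 := map_one _
    rw [h1', one_mul]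
    refine aut_ext fun i M => ?_
    rw [StarAlgEquiv.mul_apply]
    rcases lt_or_ge i j with hi | hi
    · rw [h1 _ i hi, h1 _ i hi, h1 _ i hi]
    · rw [h2 _ i hi, h2 _ i hi, map_mul, StarAlgEquiv.mul_apply]
      exact (hres g).1 _ (by simpa using h k i hi M)
  · rw [isFusionPhase_iff]
    intro f g k
    simp

theorem SpinChain.IsBlockPartitionedOn.apply_mem {P : BlockPartition} {b : c.Alg ≃⋆ₐ[ℂ] c.Alg}
    (hb : IsBlockPartitionedOn P b) (a : ℤ) {x : c.Alg} (hx : x ∈ c.localAlg (P.block a)) :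
    b x ∈ c.localAlg (P.block a) := by
  obtain ⟨U, hU⟩ := hb
  rw [(hU a).2 x hx, Unitary.conjStarAlgAut_apply]
  exact mul_mem (mul_mem (hU a).1 hx) (star_mem (hU a).1)

/-- A cut between two blocks is respected by the symmetry. -/
theorem Symm.IsDecoupled.hasPhase_one (h : α.IsDecoupled) : α.HasPhase fun _ _ _ => 1 := by
  obtain ⟨P, hP⟩ := h
  refine Symm.hasPhase_one_of_apply_mem (j := P.left 0) fun g i hi M => ?_
  obtain ⟨a, ha⟩ := P.exists_mem_block i
  refine localAlg_mono (fun k hk => ?_) ((hP g).apply_mem a (site_mem_localAlg ha M))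
  have h1 : P.left 0 < P.left (a + 1) := lt_of_le_of_lt hi ha.2
  have h2 : 0 < a + 1 := P.strictMono.lt_iff_lt.mp h1
  exact (P.strictMono.monotone (show 0 ≤ a by omega)).trans hk.1

theorem fatten_zero (X : Set ℤ) : fatten X 0 = X := by
  ext j
  constructor
  · rintro ⟨i, hi, hij⟩
    have h : j - i = 0 := abs_nonpos_iff.mp (by simpa using hij)
    rwa [sub_eq_zero.mp h]
  · exact fun hj => ⟨j, hj, by simp⟩

theorem Symm.RangeLE.hasPhase_one (h : α.RangeLE 0) : α.HasPhase fun _ _ _ => 1 := by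
  refine Symm.hasPhase_one_of_apply_mem (j := 0) fun g i hi M => ?_
  have h1 := h g (Set.Ici 0) (site i M) (site_mem_localAlg (Set.mem_Ici.mpr hi) M)
  rwa [fatten_zero] at h1

end Decoupled

/-! ### Stacking -/

section Stacking

variable {c c' : SpinChain}

theorem stack_site_mem {C : Type*} [CStarAlgebra C] (f : (c.stack c').Alg →⋆ₐ[ℂ] C)
    (S : StarSubalgebra ℂ C) {j : ℤ} (hl : ∀ M, f (inl c c' (site j M)) ∈ S)
    (hr : ∀ M, f (inr c c' (site j M)) ∈ S) (M : (c.stack c').OnSite j) : f (site j M) ∈ S := by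
  rw [Matrix.matrix_eq_sum_single M]
  simp only [map_sum]
  refine sum_mem fun p _ => sum_mem fun q _ => ?_
  have h1 : Matrix.single p q (M p q) = M p q • Matrix.single p q (1 : ℂ) := by simp
  rw [h1, map_smul, map_smul, single_eq_kron (stackIndex c c' j), map_mul, map_mul, ← inl_site,
    ← inr_site]
  exact StarSubalgebra.smul_mem _ (mul_mem (hl _) (hr _)) _

theorem stack_site_eq {C : Type*} [CStarAlgebra C] {f g : (c.stack c').Alg →⋆ₐ[ℂ] C} {j : ℤ}
    (hl : ∀ M, f (inl c c' (site j M)) = g (inl c c' (site j M)))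
    (hr : ∀ M, f (inr c c' (site j M)) = g (inr c c' (site j M))) (M : (c.stack c').OnSite j) :
    f (site j M) = g (site j M) := by
  have : f.comp (site (c := c.stack c') j) = g.comp (site (c := c.stack c') j) := by
    refine matrixHom_ext fun p q => ?_
    rw [StarAlgHom.comp_apply, StarAlgHom.comp_apply, single_eq_kron (stackIndex c c' j), map_mul,
      map_mul, map_mul, ← inl_site, ← inr_site, hl, hr]
  exact DFunLike.congr_fun this M

theorem inl_mem_localAlg {X : Set ℤ} {x : c.Alg} (hx : x ∈ c.localAlg X) :
    inl c c' x ∈ (c.stack c').localAlg X :=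
  hom_localAlg_mem (inl c c') X _ (isClosed_localAlg _)
    (fun _ hj M => by rw [inl_site]; exact site_mem_localAlg hj _) hx

theorem inr_mem_localAlg {X : Set ℤ} {x : c'.Alg} (hx : x ∈ c'.localAlg X) :
    inr c c' x ∈ (c.stack c').localAlg X :=
  hom_localAlg_mem (inr c c') X _ (isClosed_localAlg _)
    (fun _ hj M => by rw [inr_site]; exact site_mem_localAlg hj _) hx

theorem mapU_inl_inr_commute (U : unitary c.Alg) (V : unitary c'.Alg) :
    mapU (inr c c') V * mapU (inl c c') U = mapU (inl c c') U * mapU (inr c c') V :=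
  Subtype.ext (inl_inr_commute (U : c.Alg) (V : c'.Alg)).eq.symm

theorem Ad_inl_mul_inr_apply_inl (U : unitary c.Alg) (V : unitary c'.Alg) (x : c.Alg) :
    Ad (mapU (inl c c') U * mapU (inr c c') V) (inl c c' x) = inl c c' (Ad U x) := by
  have h : Ad (mapU (inr c c') V) (inl c c' x) = inl c c' x := by
    rw [Unitary.conjStarAlgAut_apply, coe_mapU, ← (inl_inr_commute x (V : c'.Alg)).eq, mul_assoc,
      ← coe_mapU, Unitary.mul_star_self_of_mem (mapU (inr c c') V).2, mul_one]
  rw [Ad_mul, StarAlgEquiv.mul_apply, h, Unitary.conjStarAlgAut_apply,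
    Unitary.conjStarAlgAut_apply, map_mul, map_mul, map_star]
  rfl

theorem Ad_inl_mul_inr_apply_inr (U : unitary c.Alg) (V : unitary c'.Alg) (x : c'.Alg) :
    Ad (mapU (inl c c') U * mapU (inr c c') V) (inr c c' x) = inr c c' (Ad V x) := by
  have h : Ad (mapU (inl c c') U) (inr c c' x) = inr c c' x := by
    rw [Unitary.conjStarAlgAut_apply, coe_mapU, (inl_inr_commute (U : c.Alg) x).eq, mul_assoc,
      ← coe_mapU, Unitary.mul_star_self_of_mem (mapU (inl c c') U).2, mul_one]
  rw [← mapU_inl_inr_commute, Ad_mul, StarAlgEquiv.mul_apply, h, Unitary.conjStarAlgAut_apply,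
    Unitary.conjStarAlgAut_apply, map_mul, map_mul, map_star]
  rfl

theorem autU_stackAut_inl (a : c.Alg ≃⋆ₐ[ℂ] c.Alg) (b : c'.Alg ≃⋆ₐ[ℂ] c'.Alg) (U : unitary c.Alg) :
    autU (stackAut a b) (mapU (inl c c') U) = mapU (inl c c') (autU a U) :=
  Subtype.ext (stackAut_inl a b (U : c.Alg))

theorem autU_stackAut_inr (a : c.Alg ≃⋆ₐ[ℂ] c.Alg) (b : c'.Alg ≃⋆ₐ[ℂ] c'.Alg)
    (U : unitary c'.Alg) :
    autU (stackAut a b) (mapU (inr c c') U) = mapU (inr c c') (autU b U) :=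
  Subtype.ext (stackAut_inr a b (U : c'.Alg))

variable {G : Type*} [Group G] {α : Symm G c} {β : Symm G c'}

theorem Symm.IsRightRestriction.stack {j : ℤ} {L : ℕ} {ρ : G → (c.Alg ≃⋆ₐ[ℂ] c.Alg)}
    {σ : G → (c'.Alg ≃⋆ₐ[ℂ] c'.Alg)} (hρ : α.IsRightRestriction j L ρ)
    (hσ : β.IsRightRestriction j L σ) :
    (α.stack β).IsRightRestriction j L fun g => stackAut (ρ g) (σ g) := by
  refine Symm.isRightRestriction_of_sites (fun g i hi => ?_) (fun g i hi => ?_)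
  · refine stack_site_eq (c := c) (c' := c')
      (f := ((stackAut (ρ g) (σ g) : (c.stack c').Alg ≃⋆ₐ[ℂ] (c.stack c').Alg) :
        (c.stack c').Alg →⋆ₐ[ℂ] (c.stack c').Alg))
      (g := ((stackAut (α g) (β g) : (c.stack c').Alg ≃⋆ₐ[ℂ] (c.stack c').Alg) :
        (c.stack c').Alg →⋆ₐ[ℂ] (c.stack c').Alg)) (fun M => ?_) (fun M => ?_)
    · change stackAut _ _ _ = stackAut _ _ _
      rw [stackAut_inl, stackAut_inl, (hρ g).1 _ (site_mem_localAlg (Set.mem_Ici.mpr hi) M)]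
    · change stackAut _ _ _ = stackAut _ _ _
      rw [stackAut_inr, stackAut_inr, (hσ g).1 _ (site_mem_localAlg (Set.mem_Ici.mpr hi) M)]
  · refine stack_site_eq (c := c) (c' := c')
      (f := ((stackAut (ρ g) (σ g) : (c.stack c').Alg ≃⋆ₐ[ℂ] (c.stack c').Alg) :
        (c.stack c').Alg →⋆ₐ[ℂ] (c.stack c').Alg))
      (g := StarAlgHom.id ℂ (c.stack c').Alg) (fun M => ?_) (fun M => ?_)
    · change stackAut _ _ _ = inl c c' _
      rw [stackAut_inl, (hρ g).2 _ (site_mem_localAlg (Set.mem_Iio.mpr hi) M)]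
    · change stackAut _ _ _ = inr c c' _
      rw [stackAut_inr, (hσ g).2 _ (site_mem_localAlg (Set.mem_Iio.mpr hi) M)]

/-- After passing to a common window the restrictions and fusion operators are tensored. The two
tensor factors commute, so the phases multiply. -/
theorem Symm.HasPhase.stack {ω ω' : G → G → G → Circle} (h : α.HasPhase ω) (h' : β.HasPhase ω') :
    (α.stack β).HasPhase fun f g h => ω f g h * ω' f g h := by
  obtain ⟨j, L, ρ, F, hρ, hF, hω⟩ := h
  obtain ⟨j', L', σ, F', hσ, hF', hω'⟩ := h'
  have h1 := hρ.mono (j' := j) (L' := L + L' + (j - j').natAbs) (by omega) (by omega)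
  have h2 := hσ.mono (j' := j) (L' := L + L' + (j - j').natAbs) (by omega) (by omega)
  refine ⟨j, _, _, fun g h => mapU (inl c c') (F g h) * mapU (inr c c') (F' g h), h1.stack h2,
    fun g h => ?_, ?_⟩
  · refine stackAut_ext (fun x => ?_) (fun y => ?_)
    · simp only [StarAlgEquiv.mul_apply, stackAut_inl]
      rw [Ad_inl_mul_inr_apply_inl]
      exact congrArg (inl c c') (DFunLike.congr_fun (hF g h) x)
    · simp only [StarAlgEquiv.mul_apply, stackAut_inr]
      rw [Ad_inl_mul_inr_apply_inr]
      exact congrArg (inr c c') (DFunLike.congr_fun (hF' g h) y)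
  · rw [isFusionPhase_iff] at *
    intro f g h
    have key : ∀ (a b : unitary c.Alg) (a' b' : unitary c'.Alg),
        mapU (inl c c') a * mapU (inr c c') a' * (mapU (inl c c') b * mapU (inr c c') b') =
          mapU (inl c c') (a * b) * mapU (inr c c') (a' * b') := fun a b a' b' => by
      rw [map_mul, map_mul, mul_assoc, ← mul_assoc (mapU (inr c c') a'), mapU_inl_inr_commute]
      simp only [mul_assoc]
    rw [map_mul (autU _), autU_stackAut_inl, autU_stackAut_inr, key, key, hω, hω',
      map_mul (mapU (inl c c')) (phase _ _), map_mul (mapU (inr c c')) (phase _ _), mapU_phase,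
      mapU_phase, map_mul (phase _), mul_assoc, mul_phase_mul, mul_assoc]

end Stacking

/-! ### Conjugation -/

section Conjugation

variable {G : Type*} [Group G] {c c' : SpinChain}

/-- The whole structure is transported along `ψ`, and scalars are unaffected. Supports are compared
after applying `ψ`, so only the spread `r` of `ψ` enters, and it is absorbed into the defect size.
-/
theorem Symm.HasPhase.conj {α : Symm G c} {α' : Symm G c'} {ω : G → G → G → Circle}
    (h : α.HasPhase ω) (ψ : c'.Alg ≃⋆ₐ[ℂ] c.Alg) {r : ℕ}
    (hψ : ∀ X, ∀ x ∈ c'.localAlg X, ψ x ∈ c.localAlg (fatten X r))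
    (hα : ∀ g x, ψ (α' g x) = α g (ψ x)) : α'.HasPhase ω := by
  obtain ⟨j, L, ρ, F, hρ, hF, hω⟩ := h
  refine ⟨j, L + r, fun g => (ψ.trans (ρ g)).trans ψ.symm,
    fun g h => mapU (ψ.symm : c.Alg →⋆ₐ[ℂ] c'.Alg) (F g h),
    fun g => ⟨fun x hx => ?_, fun x hx => ?_⟩,
    fun g h => ?_, fun f g h => ?_⟩
  · change ψ.symm (ρ g (ψ x)) = α' g x
    rw [StarAlgEquiv.symm_apply_eq, hα]
    refine (hρ g).1 _ (localAlg_mono ?_ (hψ _ x hx))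
    refine (fatten_Ici _ r).trans (Set.Ici_subset_Ici.mpr ?_)
    push_cast
    omega
  · change ψ.symm (ρ g (ψ x)) = x
    rw [StarAlgEquiv.symm_apply_eq]
    refine (hρ g).2 _ (localAlg_mono ?_ (hψ _ x hx))
    refine (fatten_Iio _ r).trans (Set.Iio_subset_Iio ?_)
    push_cast
    omega
  · ext x
    change ψ.symm (ρ g (ψ (ψ.symm (ρ h (ψ x))))) = Ad _ (ψ.symm (ρ (g * h) (ψ x)))
    rw [ψ.apply_symm_apply]
    have h1 := DFunLike.congr_fun (hF g h) (ψ x)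
    rw [StarAlgEquiv.mul_apply, StarAlgEquiv.mul_apply, Unitary.conjStarAlgAut_apply] at h1
    rw [h1, Unitary.conjStarAlgAut_apply, map_mul, map_mul, map_star]
    rfl
  · have h1 := congrArg ψ.symm (hω f g h)
    rw [map_smul, map_mul, map_mul] at h1
    change ψ.symm _ * ψ.symm _ = _ • (ψ.symm (ρ f (ψ (ψ.symm (F g h : c.Alg)))) * ψ.symm _)
    rw [ψ.apply_symm_apply]
    exact h1

end Conjugation

/-! ### On-site isomorphisms -/

namespace SpinChain

section OnSite

variable {c c' c'' : SpinChain}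

theorem IsOnSiteIso.apply_mem {φ : c.Alg ≃⋆ₐ[ℂ] c'.Alg} (hφ : IsOnSiteIso φ) {X : Set ℤ}
    {x : c.Alg} (hx : x ∈ c.localAlg X) : φ x ∈ c'.localAlg X :=
  hom_localAlg_mem (φ : c.Alg →⋆ₐ[ℂ] c'.Alg) X _ (isClosed_localAlg _)
    (fun j hj M => localAlg_mono (Set.singleton_subset_iff.mpr hj)
      ((hφ j _).mpr (site_mem_localAlg (Set.mem_singleton j) M))) hx

theorem IsOnSiteIso.symm {φ : c.Alg ≃⋆ₐ[ℂ] c'.Alg} (hφ : IsOnSiteIso φ) :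
    IsOnSiteIso φ.symm := fun j x => by
  rw [← hφ j (φ.symm x), φ.apply_symm_apply]

theorem IsOnSiteIso.trans {φ : c.Alg ≃⋆ₐ[ℂ] c'.Alg} {ψ : c'.Alg ≃⋆ₐ[ℂ] c''.Alg}
    (hφ : IsOnSiteIso φ) (hψ : IsOnSiteIso ψ) : IsOnSiteIso (φ.trans ψ) := fun j x =>
  (hψ j (φ x)).trans (hφ j x)

theorem isOnSiteIso_one : IsOnSiteIso (1 : c.Alg ≃⋆ₐ[ℂ] c.Alg) :=
  fun _ _ => Iff.rfl

theorem isOnSiteIso_of_sites {φ : c.Alg ≃⋆ₐ[ℂ] c'.Alg}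
    (h1 : ∀ j M, φ (site j M) ∈ c'.localAlg {j})
    (h2 : ∀ j M, φ.symm (site j M) ∈ c.localAlg {j}) : IsOnSiteIso φ := fun j x => by
  have h3 : ∀ y ∈ c.localAlg {j}, φ y ∈ c'.localAlg {j} := fun y hy =>
    hom_localAlg_mem (φ : c.Alg →⋆ₐ[ℂ] c'.Alg) {j} _ (isClosed_localAlg _)
      (fun i hi M => by obtain rfl := hi; exact h1 i M) hy
  have h4 : ∀ y ∈ c'.localAlg {j}, φ.symm y ∈ c.localAlg {j} := fun y hy =>
    hom_localAlg_mem (φ.symm : c'.Alg →⋆ₐ[ℂ] c.Alg) {j} _ (isClosed_localAlg _)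
      (fun i hi M => by obtain rfl := hi; exact h2 i M) hy
  exact ⟨fun hx => by simpa using h4 _ hx, h3 x⟩

end OnSite

/-! ### Finite depth quantum circuits -/

section Circuits

variable {c c' : SpinChain}

theorem HasRange.mul {a b : c.Alg ≃⋆ₐ[ℂ] c.Alg} {r s : ℕ} (ha : HasRange a r) (hb : HasRange b s) :
    HasRange (a * b) (r + s) := fun X x hx => by
  refine localAlg_mono ?_ (ha _ _ (hb X x hx))
  rintro k ⟨j, ⟨i, hi, hij⟩, hjk⟩
  have h := abs_sub_le k j i
  exact ⟨i, hi, by push_cast; omega⟩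

theorem IsBlockPartitioned.isQCA {b : c.Alg ≃⋆ₐ[ℂ] c.Alg} (h : IsBlockPartitioned b) :
    IsQCA b := by
  obtain ⟨P, hP⟩ := h
  obtain ⟨K, hK⟩ := P.bounded
  -- Sites of one block differ by less than the bound `K` on the block lengths.
  refine ⟨K.toNat, fun X x hx => ?_⟩
  refine hom_localAlg_mem (b : c.Alg →⋆ₐ[ℂ] c.Alg) X _ (isClosed_localAlg _) (fun i hi M => ?_) hx
  obtain ⟨a, ha⟩ := P.exists_mem_block i
  refine localAlg_mono (Y := fatten X K.toNat) (fun k hk => ⟨i, hi, ?_⟩)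
    (hP.apply_mem a (site_mem_localAlg ha M))
  have h1 := hK a
  have h2 := ha.1
  have h3 := ha.2
  have h4 := hk.1
  have h5 := hk.2
  rw [abs_le]
  omega

theorem IsBlockPartitioned.inv {b : c.Alg ≃⋆ₐ[ℂ] c.Alg} (h : IsBlockPartitioned b) :
    IsBlockPartitioned b⁻¹ := by
  obtain ⟨P, U, hU⟩ := h
  refine ⟨P, fun a => (U a)⁻¹, fun a => ⟨star_mem (hU a).1, fun x hx => ?_⟩⟩
  have h1 : Ad (U a)⁻¹ x ∈ c.localAlg (P.block a) := by
    rw [Unitary.conjStarAlgAut_apply]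
    exact mul_mem (mul_mem (star_mem (hU a).1) hx) (star_mem (star_mem (hU a).1))
  rw [StarAlgEquiv.aut_inv, StarAlgEquiv.symm_apply_eq, (hU a).2 _ h1, Ad_inv,
    ← StarAlgEquiv.mul_apply, mul_inv_cancel]
  rfl

theorem IsBlockPartitioned.conj {b : c.Alg ≃⋆ₐ[ℂ] c.Alg} (h : IsBlockPartitioned b)
    {φ : c.Alg ≃⋆ₐ[ℂ] c'.Alg} (hφ : IsOnSiteIso φ) :
    IsBlockPartitioned ((φ.symm.trans b).trans φ) := by
  obtain ⟨P, U, hU⟩ := h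
  refine ⟨P, fun a => mapU (φ : c.Alg →⋆ₐ[ℂ] c'.Alg) (U a), fun a =>
    ⟨hφ.apply_mem (hU a).1, fun x hx => ?_⟩⟩
  change φ (b (φ.symm x)) = _
  rw [(hU a).2 _ (hφ.symm.apply_mem hx), Unitary.conjStarAlgAut_apply,
    Unitary.conjStarAlgAut_apply, map_mul, map_mul, map_star, φ.apply_symm_apply]
  rfl

/-- The block unitaries are `U_a ⊗ 1`, which act trivially on the second chain. -/
theorem IsBlockPartitioned.stackAut_one {b : c.Alg ≃⋆ₐ[ℂ] c.Alg} (h : IsBlockPartitioned b) :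
    IsBlockPartitioned (stackAut b (1 : c'.Alg ≃⋆ₐ[ℂ] c'.Alg)) := by
  obtain ⟨P, U, hU⟩ := h
  refine ⟨P, fun a => mapU (inl c c') (U a), fun a => ⟨inl_mem_localAlg (hU a).1, fun x hx =>
    aut_eq_on_localAlg (fun i hi => ?_) hx⟩⟩
  refine stack_site_eq (c := c) (c' := c')
    (f := ((stackAut b 1 : (c.stack c').Alg ≃⋆ₐ[ℂ] (c.stack c').Alg) :
        (c.stack c').Alg →⋆ₐ[ℂ] (c.stack c').Alg))
    (g := ((Ad (mapU (inl c c') (U a)) : (c.stack c').Alg ≃⋆ₐ[ℂ] (c.stack c').Alg) :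
        (c.stack c').Alg →⋆ₐ[ℂ] (c.stack c').Alg)) (fun M => ?_) (fun M => ?_)
  · change stackAut _ _ _ = Ad _ _
    have h1 := Ad_inl_mul_inr_apply_inl (c' := c') (U a) 1 (site i M)
    rw [map_one, mul_one] at h1
    rw [stackAut_inl, h1, (hU a).2 _ (site_mem_localAlg hi M)]
  · change stackAut _ _ _ = Ad _ _
    have h1 := Ad_inl_mul_inr_apply_inr (c := c) (c' := c') (U a) 1 (site i M)
    rw [map_one, mul_one] at h1
    rw [stackAut_inr, h1, Unitary.conjStarAlgAut_apply]
    simp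

theorem IsBlockPartitioned.isFDQC {b : c.Alg ≃⋆ₐ[ℂ] c.Alg} (h : IsBlockPartitioned b) :
    IsFDQC b := ⟨[b], by simpa using h, by simp⟩

theorem isFDQC_one : IsFDQC (1 : c.Alg ≃⋆ₐ[ℂ] c.Alg) := ⟨[], by simp, by simp⟩

theorem IsFDQC.mul {a b : c.Alg ≃⋆ₐ[ℂ] c.Alg} (ha : IsFDQC a) (hb : IsFDQC b) :
    IsFDQC (a * b) := by
  obtain ⟨l, hl, rfl⟩ := ha
  obtain ⟨l', hl', rfl⟩ := hb
  refine ⟨l ++ l', fun a h => ?_, by rw [List.prod_append]⟩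
  rcases List.mem_append.mp h with h | h
  exacts [hl a h, hl' a h]

theorem IsFDQC.induction {p : (c.Alg ≃⋆ₐ[ℂ] c.Alg) → Prop} (h1 : p 1)
    (hmul : ∀ a b, IsBlockPartitioned a → p b → p (a * b)) {a : c.Alg ≃⋆ₐ[ℂ] c.Alg}
    (ha : IsFDQC a) : p a := by
  obtain ⟨l, hl, rfl⟩ := ha
  induction l with
  | nil => exact h1
  | cons a l ih =>
    rw [List.prod_cons]
    exact hmul _ _ (hl a List.mem_cons_self) (ih fun b hb => hl b (List.mem_cons_of_mem a hb))

theorem IsFDQC.isQCA {a : c.Alg ≃⋆ₐ[ℂ] c.Alg} (ha : IsFDQC a) : IsQCA a := by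
  refine ha.induction (p := IsQCA) ⟨0, fun X x hx => ?_⟩ fun a b ha hb => ?_
  · rw [fatten_zero]
    exact hx
  · obtain ⟨r, hr⟩ := ha.isQCA
    obtain ⟨s, hs⟩ := hb
    exact ⟨r + s, hr.mul hs⟩

theorem IsFDQC.inv {a : c.Alg ≃⋆ₐ[ℂ] c.Alg} (ha : IsFDQC a) : IsFDQC a⁻¹ := by
  refine ha.induction (p := fun a => IsFDQC a⁻¹) ?_ fun a b ha hb => ?_
  · rw [inv_one]
    exact isFDQC_one
  · rw [mul_inv_rev]
    exact hb.mul ha.inv.isFDQC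

theorem IsFDQC.conj {a : c.Alg ≃⋆ₐ[ℂ] c.Alg} (ha : IsFDQC a) {φ : c.Alg ≃⋆ₐ[ℂ] c'.Alg}
    (hφ : IsOnSiteIso φ) : IsFDQC ((φ.symm.trans a).trans φ) := by
  refine ha.induction (p := fun a => IsFDQC ((φ.symm.trans a).trans φ)) ?_ fun a b ha hb => ?_
  · have h : (φ.symm.trans (1 : c.Alg ≃⋆ₐ[ℂ] c.Alg)).trans φ = 1 := by
      ext x
      exact φ.apply_symm_apply x
    rw [h]
    exact isFDQC_one
  · have h : (φ.symm.trans (a * b)).trans φ =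
        ((φ.symm.trans a).trans φ) * ((φ.symm.trans b).trans φ) := by
      ext x
      change φ (a (b (φ.symm x))) = φ (a (φ.symm (φ (b (φ.symm x)))))
      rw [φ.symm_apply_apply]
    rw [h]
    exact (ha.conj hφ).isFDQC.mul hb

theorem IsFDQC.stackAut_one {a : c.Alg ≃⋆ₐ[ℂ] c.Alg} (ha : IsFDQC a) :
    IsFDQC (stackAut a (1 : c'.Alg ≃⋆ₐ[ℂ] c'.Alg)) := by
  refine ha.induction (p := fun a => IsFDQC (stackAut a (1 : c'.Alg ≃⋆ₐ[ℂ] c'.Alg))) ?_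
    fun a b ha hb => ?_
  · have h : stackAut (1 : c.Alg ≃⋆ₐ[ℂ] c.Alg) (1 : c'.Alg ≃⋆ₐ[ℂ] c'.Alg) = 1 :=
      stackAut_ext (fun x => stackAut_inl _ _ _) (fun y => stackAut_inr _ _ _)
    rw [h]
    exact isFDQC_one
  · have h : stackAut (a * b) (1 : c'.Alg ≃⋆ₐ[ℂ] c'.Alg) = stackAut a 1 * stackAut b 1 :=
      stackAut_ext
        (fun x => by
          rw [StarAlgEquiv.mul_apply, stackAut_inl, stackAut_inl, stackAut_inl,
            StarAlgEquiv.mul_apply])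
        (fun y => by
          rw [StarAlgEquiv.mul_apply, stackAut_inr, stackAut_inr, stackAut_inr]
          rfl)
    rw [h]
    exact ha.stackAut_one.isFDQC.mul hb

end Circuits

end SpinChain

/-! ### Equivalence of symmetries -/

namespace Symm

section Equivalence

variable {G : Type*} [Group G] {c c' c'' : SpinChain}

theorem equivalent_iff {α' : Symm G c'} {α : Symm G c} : α'.Equivalent α ↔
    ∃ φ : c'.Alg ≃⋆ₐ[ℂ] c.Alg, IsOnSiteIso φ ∧ ∃ γ : c.Alg ≃⋆ₐ[ℂ] c.Alg, IsFDQC γ ∧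
      ∀ g x, γ (φ (α' g x)) = α g (γ (φ x)) := by
  refine exists_congr fun φ => and_congr_right fun _ => exists_congr fun γ =>
    and_congr_right fun _ => forall_congr' fun g => forall_congr' fun x => ?_
  rw [StarAlgEquiv.aut_inv, eq_comm, StarAlgEquiv.symm_apply_eq, eq_comm]

theorem Equivalent.of_isOnSiteIso {α' : Symm G c'} {α : Symm G c} {φ : c'.Alg ≃⋆ₐ[ℂ] c.Alg}
    (hφ : IsOnSiteIso φ) (h : ∀ g x, φ (α' g x) = α g (φ x)) : α'.Equivalent α :=
  equivalent_iff.mpr ⟨φ, hφ, 1, isFDQC_one, h⟩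

theorem Equivalent.refl (α : Symm G c) : α.Equivalent α :=
  .of_isOnSiteIso isOnSiteIso_one fun _ _ => rfl

theorem Equivalent.symm {α' : Symm G c'} {α : Symm G c} (h : α'.Equivalent α) :
    α.Equivalent α' := by
  rw [equivalent_iff] at h
  obtain ⟨φ, hφ, γ, hγ, h⟩ := h
  -- The inverse circuit has to be carried back to the other chain by the on-site isomorphism.
  refine equivalent_iff.mpr ⟨φ.symm, hφ.symm, _, hγ.inv.conj hφ.symm, fun g x => ?_⟩
  change φ.symm (γ.symm (φ (φ.symm _))) = α' g (φ.symm (γ.symm (φ (φ.symm x))))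
  rw [φ.apply_symm_apply, φ.apply_symm_apply, StarAlgEquiv.symm_apply_eq,
    StarAlgEquiv.symm_apply_eq, h, φ.apply_symm_apply, γ.apply_symm_apply]

theorem Equivalent.trans {α'' : Symm G c''} {α' : Symm G c'} {α : Symm G c}
    (h : α''.Equivalent α') (h' : α'.Equivalent α) : α''.Equivalent α := by
  rw [equivalent_iff] at h h'
  obtain ⟨φ, hφ, γ, hγ, h⟩ := h
  obtain ⟨φ', hφ', γ', hγ', h'⟩ := h'
  -- The first circuit is moved to the last chain by `φ'` and then followed by the second one.
  refine equivalent_iff.mpr ⟨_, hφ.trans hφ', _, hγ'.mul (hγ.conj hφ'), fun g x => ?_⟩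
  change γ' (φ' (γ (φ'.symm (φ' (φ _))))) = α g (γ' (φ' (γ (φ'.symm (φ' (φ x))))))
  rw [φ'.symm_apply_apply, φ'.symm_apply_apply, h, h']

theorem HasPhase.of_equivalent {α : Symm G c} {α' : Symm G c'} {ω : G → G → G → Circle}
    (hω : α.HasPhase ω) (h : α'.Equivalent α) : α'.HasPhase ω := by
  rw [equivalent_iff] at h
  obtain ⟨φ, hφ, γ, hγ, h⟩ := h
  obtain ⟨r, hr⟩ := hγ.isQCA
  exact hω.conj (φ.trans γ) (fun X x hx => hr X _ (hφ.apply_mem hx)) h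

end Equivalence

end Symm

/-! ### Isomorphisms of stacks -/

section StackIso

variable {c c' d : SpinChain}

theorem SpinChain.exists_isOnSiteIso {f : c.Alg →⋆ₐ[ℂ] c'.Alg} {g : c'.Alg →⋆ₐ[ℂ] c.Alg}
    (hgf : g.comp f = StarAlgHom.id ℂ c.Alg) (hfg : f.comp g = StarAlgHom.id ℂ c'.Alg)
    (hf : ∀ j M, f (site j M) ∈ c'.localAlg {j}) (hg : ∀ j M, g (site j M) ∈ c.localAlg {j}) :
    ∃ φ : c.Alg ≃⋆ₐ[ℂ] c'.Alg, IsOnSiteIso φ ∧ (φ : c.Alg →⋆ₐ[ℂ] c'.Alg) = f :=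
  ⟨StarAlgEquiv.ofStarAlgHom f g hgf hfg, isOnSiteIso_of_sites hf hg, rfl⟩

/-- Closure of `S` under the star makes the commutation relations on the two tensor factors pass to
the star algebra that they generate. -/
theorem SpinChain.commute_of_inl_inr {C : Type*} [CStarAlgebra C] (f : (c.stack d).Alg →⋆ₐ[ℂ] C)
    {S : Set C} (hS : ∀ y ∈ S, star y ∈ S) (hl : ∀ x, ∀ y ∈ S, Commute (f (inl c d x)) y)
    (hr : ∀ x, ∀ y ∈ S, Commute (f (inr c d x)) y) (x : (c.stack d).Alg) {y : C} (hy : y ∈ S) :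
    Commute (f x) y := by
  refine commute_of_sites f y (fun j M => ?_) x
  have h : f (site j M) ∈ StarSubalgebra.centralizer ℂ S := by
    refine stack_site_mem f _ (fun M => ?_) (fun M => ?_) M <;>
      rw [StarSubalgebra.mem_centralizer_iff] <;> intro z hz
    · exact ⟨(hl _ z hz).symm, (hl _ _ (hS z hz)).symm⟩
    · exact ⟨(hr _ z hz).symm, (hr _ _ (hS z hz)).symm⟩
  rw [StarSubalgebra.mem_centralizer_iff] at h
  exact (h y hy).1.symm

theorem SpinChain.exists_stackCongr {φ : c.Alg ≃⋆ₐ[ℂ] c'.Alg} (hφ : IsOnSiteIso φ)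
    (d : SpinChain) : ∃ ψ : (c.stack d).Alg ≃⋆ₐ[ℂ] (c'.stack d).Alg, IsOnSiteIso ψ ∧
      (∀ x, ψ (inl c d x) = inl c' d (φ x)) ∧ ∀ y, ψ (inr c d y) = inr c' d y := by
  have key : ∀ {c c' : SpinChain} {φ : c.Alg ≃⋆ₐ[ℂ] c'.Alg}, IsOnSiteIso φ →
      ∃ f : (c.stack d).Alg →⋆ₐ[ℂ] (c'.stack d).Alg, (∀ j M, f (site j M) ∈
        (c'.stack d).localAlg {j}) ∧ (∀ x, f (inl c d x) = inl c' d (φ x)) ∧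
        ∀ y, f (inr c d y) = inr c' d y := by
    intro c c' φ hφ
    obtain ⟨f, hf1, hf2⟩ : ∃ f : (c.stack d).Alg →⋆ₐ[ℂ] (c'.stack d).Alg,
        (∀ x, f (inl c d x) = inl c' d (φ x)) ∧ ∀ y, f (inr c d y) = inr c' d y :=
      ⟨stackLift ((inl c' d).comp (φ : c.Alg →⋆ₐ[ℂ] c'.Alg)) (inr c' d)
        fun _ _ => inl_inr_commute _ _, fun x => stackLift_inl _ _ _ x,
        fun y => stackLift_inr _ _ _ y⟩
    refine ⟨f, fun j M => stack_site_mem _ _ (fun M => ?_) (fun M => ?_) M, hf1, hf2⟩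
    · rw [hf1]
      exact inl_mem_localAlg (hφ.apply_mem (site_mem_localAlg (Set.mem_singleton j) M))
    · rw [hf2]
      exact inr_mem_localAlg (site_mem_localAlg (Set.mem_singleton j) M)
  obtain ⟨f, hf, hf1, hf2⟩ := key hφ
  obtain ⟨g, hg, hg1, hg2⟩ := key hφ.symm
  obtain ⟨ψ, hψ, rfl⟩ := exists_isOnSiteIso (f := f) (g := g)
    (stack_hom_ext
      (fun x => by rw [StarAlgHom.comp_apply, hf1, hg1, φ.symm_apply_apply]; rfl)
      (fun y => by rw [StarAlgHom.comp_apply, hf2, hg2]; rfl))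
    (stack_hom_ext
      (fun x => by rw [StarAlgHom.comp_apply, hg1, hf1, φ.apply_symm_apply]; rfl)
      (fun y => by rw [StarAlgHom.comp_apply, hg2, hf2]; rfl)) hf hg
  exact ⟨ψ, hψ, hf1, hf2⟩

theorem SpinChain.exists_stackComm (c d : SpinChain) :
    ∃ ψ : (c.stack d).Alg ≃⋆ₐ[ℂ] (d.stack c).Alg, IsOnSiteIso ψ ∧
      (∀ x, ψ (inl c d x) = inr d c x) ∧ ∀ y, ψ (inr c d y) = inl d c y := by
  have key : ∀ c d : SpinChain, ∃ f : (c.stack d).Alg →⋆ₐ[ℂ] (d.stack c).Alg,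
      (∀ j M, f (site j M) ∈ (d.stack c).localAlg {j}) ∧ (∀ x, f (inl c d x) = inr d c x) ∧
        ∀ y, f (inr c d y) = inl d c y := by
    intro c d
    refine ⟨stackLift (inr d c) (inl d c) fun _ _ => (inl_inr_commute _ _).symm,
      fun j M => stack_site_mem _ _ (fun M => ?_) (fun M => ?_) M,
      fun x => stackLift_inl _ _ _ x, fun y => stackLift_inr _ _ _ y⟩
    · rw [stackLift_inl]
      exact inr_mem_localAlg (site_mem_localAlg (Set.mem_singleton j) M)
    · rw [stackLift_inr]
      exact inl_mem_localAlg (site_mem_localAlg (Set.mem_singleton j) M)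
  obtain ⟨f, hf, hf1, hf2⟩ := key c d
  obtain ⟨g, hg, hg1, hg2⟩ := key d c
  obtain ⟨ψ, hψ, rfl⟩ := exists_isOnSiteIso (f := f) (g := g)
    (stack_hom_ext
      (fun x => by rw [StarAlgHom.comp_apply, hf1, hg2]; rfl)
      (fun y => by rw [StarAlgHom.comp_apply, hf2, hg1]; rfl))
    (stack_hom_ext
      (fun x => by rw [StarAlgHom.comp_apply, hg1, hf2]; rfl)
      (fun y => by rw [StarAlgHom.comp_apply, hg2, hf1]; rfl)) hf hg
  exact ⟨ψ, hψ, hf1, hf2⟩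

/-- Both directions come from the universal property of the stack. They are mutually inverse because
their composites fix each of the three tensor factors. -/
theorem SpinChain.exists_stackAssoc (c d e : SpinChain) :
    ∃ ψ : ((c.stack d).stack e).Alg ≃⋆ₐ[ℂ] (c.stack (d.stack e)).Alg, IsOnSiteIso ψ ∧
      (∀ x, ψ (inl (c.stack d) e (inl c d x)) = inl c (d.stack e) x) ∧
      (∀ x, ψ (inl (c.stack d) e (inr c d x)) = inr c (d.stack e) (inl d e x)) ∧
      ∀ x, ψ (inr (c.stack d) e x) = inr c (d.stack e) (inr d e x) := by
  obtain ⟨f₀, hf1, hf2⟩ : ∃ f : (c.stack d).Alg →⋆ₐ[ℂ] (c.stack (d.stack e)).Alg,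
      (∀ x, f (inl c d x) = inl c (d.stack e) x) ∧
      ∀ x, f (inr c d x) = inr c (d.stack e) (inl d e x) :=
    ⟨stackLift (inl c (d.stack e)) ((inr c (d.stack e)).comp (inl d e))
      fun _ _ => inl_inr_commute _ _, fun x => stackLift_inl _ _ _ x,
      fun x => stackLift_inr _ _ _ x⟩
  obtain ⟨g₀, hg1, hg2⟩ : ∃ g : (d.stack e).Alg →⋆ₐ[ℂ] ((c.stack d).stack e).Alg,
      (∀ x, g (inl d e x) = inl (c.stack d) e (inr c d x)) ∧
      ∀ x, g (inr d e x) = inr (c.stack d) e x :=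
    ⟨stackLift ((inl (c.stack d) e).comp (inr c d)) (inr (c.stack d) e)
      fun _ _ => inl_inr_commute _ _, fun x => stackLift_inl _ _ _ x,
      fun x => stackLift_inr _ _ _ x⟩
  have hfc : ∀ x y, Commute (f₀ x) (((inr c (d.stack e)).comp (inr d e)) y) := fun x y =>
    commute_of_inl_inr f₀ (S := Set.range ((inr c (d.stack e)).comp (inr d e)))
      (by rintro _ ⟨y, rfl⟩; exact ⟨star y, map_star _ _⟩)
      (by rintro x _ ⟨y, rfl⟩; rw [hf1]; exact inl_inr_commute _ _)
      (by rintro x _ ⟨y, rfl⟩; rw [hf2]; exact (inl_inr_commute _ _).map _) x ⟨y, rfl⟩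
  have hgc : ∀ x y, Commute (((inl (c.stack d) e).comp (inl c d)) x) (g₀ y) := fun x y =>
    (commute_of_inl_inr g₀ (S := Set.range ((inl (c.stack d) e).comp (inl c d)))
      (by rintro _ ⟨y, rfl⟩; exact ⟨star y, map_star _ _⟩)
      (by rintro x _ ⟨y, rfl⟩; rw [hg1]; exact (inl_inr_commute _ _).symm.map _)
      (by rintro x _ ⟨y, rfl⟩; rw [hg2]; exact (inl_inr_commute _ _).symm) y ⟨x, rfl⟩).symm
  obtain ⟨f, hf, hf'⟩ : ∃ f : ((c.stack d).stack e).Alg →⋆ₐ[ℂ] (c.stack (d.stack e)).Alg,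
      (∀ x, f (inl (c.stack d) e x) = f₀ x) ∧
      ∀ x, f (inr (c.stack d) e x) = inr c (d.stack e) (inr d e x) :=
    ⟨stackLift f₀ _ hfc, fun x => stackLift_inl _ _ _ x, fun x => stackLift_inr _ _ _ x⟩
  obtain ⟨g, hg, hg'⟩ : ∃ g : (c.stack (d.stack e)).Alg →⋆ₐ[ℂ] ((c.stack d).stack e).Alg,
      (∀ x, g (inl c (d.stack e) x) = inl (c.stack d) e (inl c d x)) ∧
      ∀ x, g (inr c (d.stack e) x) = g₀ x :=
    ⟨stackLift _ g₀ hgc, fun x => stackLift_inl _ _ _ x, fun x => stackLift_inr _ _ _ x⟩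
  have hgf₀ : (g.comp f).comp (inl (c.stack d) e) = inl (c.stack d) e :=
    stack_hom_ext
      (fun x => by
        rw [StarAlgHom.comp_apply, StarAlgHom.comp_apply, hf, hf1, hg])
      (fun x => by
        rw [StarAlgHom.comp_apply, StarAlgHom.comp_apply, hf, hf2, hg', hg1])
  have hfg₀ : (f.comp g).comp (inr c (d.stack e)) = inr c (d.stack e) :=
    stack_hom_ext
      (fun x => by
        rw [StarAlgHom.comp_apply, StarAlgHom.comp_apply, hg', hg1, hf, hf2])
      (fun x => by
        rw [StarAlgHom.comp_apply, StarAlgHom.comp_apply, hg', hg2, hf'])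
  have hf_site : ∀ j M, f (site j M) ∈ (c.stack (d.stack e)).localAlg {j} := fun j M => by
    refine stack_site_mem f _ (fun M => ?_) (fun M => ?_) M
    · rw [hf]
      refine stack_site_mem f₀ _ (fun M => ?_) (fun M => ?_) M
      · rw [hf1]
        exact inl_mem_localAlg (site_mem_localAlg (Set.mem_singleton j) M)
      · rw [hf2]
        exact inr_mem_localAlg (inl_mem_localAlg (site_mem_localAlg (Set.mem_singleton j) M))
    · rw [hf']
      exact inr_mem_localAlg (inr_mem_localAlg (site_mem_localAlg (Set.mem_singleton j) M))
  have hg_site : ∀ j M, g (site j M) ∈ ((c.stack d).stack e).localAlg {j} := fun j M => by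
    refine stack_site_mem g _ (fun M => ?_) (fun M => ?_) M
    · rw [hg]
      exact inl_mem_localAlg (inl_mem_localAlg (site_mem_localAlg (Set.mem_singleton j) M))
    · rw [hg']
      refine stack_site_mem g₀ _ (fun M => ?_) (fun M => ?_) M
      · rw [hg1]
        exact inl_mem_localAlg (inr_mem_localAlg (site_mem_localAlg (Set.mem_singleton j) M))
      · rw [hg2]
        exact inr_mem_localAlg (site_mem_localAlg (Set.mem_singleton j) M)
  obtain ⟨ψ, hψ, rfl⟩ := exists_isOnSiteIso (f := f) (g := g)
    (stack_hom_ext (fun x => DFunLike.congr_fun hgf₀ x)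
      (fun x => by rw [StarAlgHom.comp_apply, hf', hg', hg2]; rfl))
    (stack_hom_ext (fun x => by rw [StarAlgHom.comp_apply, hg, hf, hf1]; rfl)
      (fun x => DFunLike.congr_fun hfg₀ x)) hf_site hg_site
  exact ⟨ψ, hψ, fun x => (hf _).trans (hf1 x), fun x => (hf _).trans (hf2 x), hf'⟩

end StackIso

/-! ### Stable equivalence -/

section StableEquivalence

theorem SpinChain.stack_intertwine {c d : SpinChain} {C : Type*} [CStarAlgebra C]
    (ψ : (c.stack d).Alg →⋆ₐ[ℂ] C) (a : (c.stack d).Alg →⋆ₐ[ℂ] (c.stack d).Alg)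
    (b : C →⋆ₐ[ℂ] C) (hl : ∀ x, ψ (a (inl c d x)) = b (ψ (inl c d x)))
    (hr : ∀ x, ψ (a (inr c d x)) = b (ψ (inr c d x))) (x : (c.stack d).Alg) :
    ψ (a x) = b (ψ x) :=
  DFunLike.congr_fun (stack_hom_ext (f := ψ.comp a) (g := b.comp ψ) hl hr) x

variable {G : Type*} [Group G] {c c' d e : SpinChain}

namespace Symm

theorem stack_inl (α : Symm G c) (β : Symm G d) (g : G) (x : c.Alg) :
    α.stack β g (inl c d x) = inl c d (α g x) := stackAut_inl _ _ _

theorem stack_inr (α : Symm G c) (β : Symm G d) (g : G) (x : d.Alg) :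
    α.stack β g (inr c d x) = inr c d (β g x) := stackAut_inr _ _ _

theorem Equivalent.stack_right {α : Symm G c} {α' : Symm G c'} (h : α.Equivalent α')
    (β : Symm G d) : (α.stack β).Equivalent (α'.stack β) := by
  rw [equivalent_iff] at h ⊢
  obtain ⟨φ, hφ, γ, hγ, h⟩ := h
  obtain ⟨ψ, hψ, h1, h2⟩ := exists_stackCongr hφ d
  refine ⟨ψ, hψ, _, hγ.stackAut_one (c' := d), fun g => stack_intertwine
    ((ψ.trans (stackAut γ 1) : (c.stack d).Alg ≃⋆ₐ[ℂ] (c'.stack d).Alg) :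
      (c.stack d).Alg →⋆ₐ[ℂ] (c'.stack d).Alg)
    (α.stack β g : (c.stack d).Alg →⋆ₐ[ℂ] (c.stack d).Alg)
    (α'.stack β g : (c'.stack d).Alg →⋆ₐ[ℂ] (c'.stack d).Alg) (fun x => ?_) (fun x => ?_)⟩
  · change stackAut γ 1 (ψ (α.stack β g (inl c d x))) =
      α'.stack β g (stackAut γ 1 (ψ (inl c d x)))
    rw [stack_inl, h1, h1, stackAut_inl, stackAut_inl, stack_inl, h]
  · change stackAut γ 1 (ψ (α.stack β g (inr c d x))) =
      α'.stack β g (stackAut γ 1 (ψ (inr c d x)))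
    rw [stack_inr, h2, h2, stackAut_inr, stackAut_inr, stack_inr]
    rfl

theorem equivalent_stack_comm (α : Symm G c) (β : Symm G d) :
    (α.stack β).Equivalent (β.stack α) := by
  obtain ⟨ψ, hψ, h1, h2⟩ := exists_stackComm c d
  refine .of_isOnSiteIso hψ fun g => stack_intertwine
    (ψ : (c.stack d).Alg →⋆ₐ[ℂ] (d.stack c).Alg)
    (α.stack β g : (c.stack d).Alg →⋆ₐ[ℂ] (c.stack d).Alg)
    (β.stack α g : (d.stack c).Alg →⋆ₐ[ℂ] (d.stack c).Alg) (fun x => ?_) (fun x => ?_)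
  · change ψ (α.stack β g (inl c d x)) = β.stack α g (ψ (inl c d x))
    rw [stack_inl, h1, h1, stack_inr]
  · change ψ (α.stack β g (inr c d x)) = β.stack α g (ψ (inr c d x))
    rw [stack_inr, h2, h2, stack_inl]

theorem equivalent_stack_assoc (α : Symm G c) (β : Symm G d) (δ : Symm G e) :
    ((α.stack β).stack δ).Equivalent (α.stack (β.stack δ)) := by
  obtain ⟨ψ, hψ, h1, h2, h3⟩ := exists_stackAssoc c d e
  refine .of_isOnSiteIso hψ fun g => stack_intertwine
    (ψ : ((c.stack d).stack e).Alg →⋆ₐ[ℂ] (c.stack (d.stack e)).Alg)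
    ((α.stack β).stack δ g : ((c.stack d).stack e).Alg →⋆ₐ[ℂ] ((c.stack d).stack e).Alg)
    (α.stack (β.stack δ) g : (c.stack (d.stack e)).Alg →⋆ₐ[ℂ] (c.stack (d.stack e)).Alg)
    (fun x => ?_) (fun x => ?_)
  · change ψ ((α.stack β).stack δ g (inl _ e x)) = α.stack (β.stack δ) g (ψ (inl _ e x))
    rw [stack_inl]
    refine stack_intertwine
      ((ψ : ((c.stack d).stack e).Alg →⋆ₐ[ℂ] (c.stack (d.stack e)).Alg).comp (inl (c.stack d) e))
      (α.stack β g : (c.stack d).Alg →⋆ₐ[ℂ] (c.stack d).Alg)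
      (α.stack (β.stack δ) g : (c.stack (d.stack e)).Alg →⋆ₐ[ℂ] (c.stack (d.stack e)).Alg)
      (fun x => ?_) (fun x => ?_) x
    · change ψ (inl _ e (α.stack β g (inl c d x))) =
        α.stack (β.stack δ) g (ψ (inl _ e (inl c d x)))
      rw [stack_inl, h1, h1, stack_inl]
    · change ψ (inl _ e (α.stack β g (inr c d x))) =
        α.stack (β.stack δ) g (ψ (inl _ e (inr c d x)))
      rw [stack_inr, h2, h2, stack_inr, stack_inl]
  · change ψ ((α.stack β).stack δ g (inr _ e x)) = α.stack (β.stack δ) g (ψ (inr _ e x))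
    rw [stack_inr, h3, h3, stack_inr, stack_inr]

theorem Equivalent.stack_left {α : Symm G c} {α' : Symm G c'} (h : α.Equivalent α')
    (β : Symm G d) : (β.stack α).Equivalent (β.stack α') :=
  ((equivalent_stack_comm β α).trans (h.stack_right β)).trans (equivalent_stack_comm α' β)

theorem equivalent_stack_right_comm (α : Symm G c) (β : Symm G d) (δ : Symm G e) :
    ((α.stack β).stack δ).Equivalent ((α.stack δ).stack β) :=
  ((equivalent_stack_assoc α β δ).trans ((equivalent_stack_comm β δ).stack_left α)).trans
    (equivalent_stack_assoc α δ β).symm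

theorem RangeLE.stack {α : Symm G c} {β : Symm G d} {R : ℕ} (hα : α.RangeLE R)
    (hβ : β.RangeLE R) : (α.stack β).RangeLE R := fun g => (hα g).stackAut (hβ g)

variable (G) in
/-- The trivial symmetry on the spin chain with one-dimensional sites. -/
def trivialSymm : AllSymm G :=
  ⟨⟨fun _ => 1, fun _ => one_pos, 1, fun _ => le_rfl⟩, 1,
    fun _ => ⟨0, fun X x hx => by rw [fatten_zero]; exact hx⟩⟩

variable (G) in
theorem rangeLE_trivialSymm : (trivialSymm G).2.RangeLE 0 :=
  fun _ X x hx => by rw [fatten_zero]; exact hx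

end Symm

open Symm

/-- Stacking both sides with the same range-zero symmetry preserves equivalence. -/
theorem Symm.Equivalent.stableEquiv {α : Symm G c} {α' : Symm G c'} (h : α.Equivalent α') :
    StableEquiv ⟨c, α⟩ ⟨c', α'⟩ :=
  ⟨trivialSymm G, trivialSymm G, rangeLE_trivialSymm G, rangeLE_trivialSymm G, h.stack_right _⟩

theorem StableEquiv.symm {α α' : AllSymm G} (h : StableEquiv α α') : StableEquiv α' α := by
  obtain ⟨β, β', hβ, hβ', h⟩ := h
  exact ⟨β', β, hβ', hβ, h.symm⟩

theorem StableEquiv.trans {α α' α'' : AllSymm G} (h : StableEquiv α α')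
    (h' : StableEquiv α' α'') : StableEquiv α α'' := by
  obtain ⟨β, β', hβ, hβ', h⟩ := h
  obtain ⟨δ, δ', hδ, hδ', h'⟩ := h'
  -- The chain of equivalences is `α ⊗ (β ⊗ δ)`, `(α' ⊗ β') ⊗ δ`, `(α' ⊗ δ) ⊗ β'`, `(α'' ⊗ δ') ⊗
  -- β'`, `α'' ⊗ (δ' ⊗ β')`.
  refine ⟨⟨_, β.2.stack δ.2⟩, ⟨_, δ'.2.stack β'.2⟩, hβ.stack hδ, hδ'.stack hβ', ?_⟩
  exact ((((equivalent_stack_assoc _ _ _).symm.trans (h.stack_right δ.2)).trans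
    (equivalent_stack_right_comm _ _ _)).trans (h'.stack_right β'.2)).trans
      (equivalent_stack_assoc _ _ _)

theorem stableEquiv_equivalence : Equivalence (StableEquiv (G := G)) :=
  ⟨fun α => (Equivalent.refl α.2).stableEquiv, .symm, .trans⟩

theorem StableEquiv.stack_right {α α' : AllSymm G} (h : StableEquiv α α') (δ : AllSymm G) :
    StableEquiv ⟨_, α.2.stack δ.2⟩ ⟨_, α'.2.stack δ.2⟩ := by
  obtain ⟨β, β', hβ, hβ', h⟩ := h
  exact ⟨β, β', hβ, hβ', ((equivalent_stack_right_comm _ _ _).trans (h.stack_right δ.2)).trans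
    (equivalent_stack_right_comm _ _ _)⟩

theorem StableEquiv.stack_left {α α' : AllSymm G} (h : StableEquiv α α') (δ : AllSymm G) :
    StableEquiv ⟨_, δ.2.stack α.2⟩ ⟨_, δ.2.stack α'.2⟩ :=
  ((equivalent_stack_comm _ _).stableEquiv.trans (h.stack_right δ)).trans
    (equivalent_stack_comm _ _).stableEquiv

/-- By associativity `β` is absorbed into the range-zero ancilla of the other side. This makes the
trivial symmetry a unit. -/
theorem stableEquiv_stack_of_rangeLE_zero (α : AllSymm G) {β : AllSymm G} (hβ : β.2.RangeLE 0) :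
    StableEquiv ⟨_, α.2.stack β.2⟩ α :=
  ⟨trivialSymm G, ⟨_, β.2.stack (trivialSymm G).2⟩, rangeLE_trivialSymm G,
    hβ.stack (rangeLE_trivialSymm G), equivalent_stack_assoc _ _ _⟩

variable (G) in
/-- The commutative monoid of stable equivalence classes, under stacking. -/
abbrev stackMonoid : CommMonoid (Quot (StableEquiv (G := G))) where
  mul := Quot.map₂ (fun α β => ⟨α.1.stack β.1, α.2.stack β.2⟩)
    (fun δ _ _ h => h.stack_left δ) (fun _ _ δ h => h.stack_right δ)
  one := Quot.mk _ (trivialSymm G)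
  mul_assoc := by
    rintro ⟨α⟩ ⟨β⟩ ⟨δ⟩
    exact Quot.sound (equivalent_stack_assoc α.2 β.2 δ.2).stableEquiv
  one_mul := by
    rintro ⟨α⟩
    exact Quot.sound ((equivalent_stack_comm _ _).stableEquiv.trans
      (stableEquiv_stack_of_rangeLE_zero α (rangeLE_trivialSymm G)))
  mul_one := by
    rintro ⟨α⟩
    exact Quot.sound (stableEquiv_stack_of_rangeLE_zero α (rangeLE_trivialSymm G))
  mul_comm := by
    rintro ⟨α⟩ ⟨β⟩
    exact Quot.sound (equivalent_stack_comm α.2 β.2).stableEquiv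

end StableEquivalence

/-! ### The anomaly -/

section Anomaly

variable {G : Type} [Group G] [Finite G]

/-- The class in `H³(G, U(1))` of the phases of a symmetry. -/
def anomaly (α : AllSymm G) : H3 G :=
  cocycleClass _ (α.2.exists_hasPhase.choose_spec.isThreeCocycle)

theorem Symm.HasPhase.cocycleClass_eq {c : SpinChain} {α : Symm G c} {ω : G → G → G → Circle}
    (h : α.HasPhase ω) (hω : IsThreeCocycle ω) : cocycleClass ω hω = anomaly ⟨c, α⟩ := by
  obtain ⟨lam, hlam⟩ := h.exists_cobounds α.exists_hasPhase.choose_spec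
  exact cocycleClass_eq_of_cobounds _ _ hlam

theorem isAnomaly_anomaly : IsAnomaly (anomaly (G := G)) :=
  fun _ _ j L ρ F _ hω h hF hp => Symm.HasPhase.cocycleClass_eq ⟨j, L, ρ, F, h, hF, hp⟩ hω

/-- Uniqueness rests on existence: every symmetry has at least one restriction with fusion operators
and phases, and these fix the value of `Ω`. -/
theorem IsAnomaly.eq_anomaly {Ω : AllSymm G → H3 G} (h : IsAnomaly Ω) : Ω = anomaly := by
  funext ⟨c, α⟩
  obtain ⟨ω, hω⟩ := α.exists_hasPhase
  rw [← hω.cocycleClass_eq hω.isThreeCocycle]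
  obtain ⟨j, L, ρ, F, hρ, hF, hp⟩ := hω
  exact (h c α j L ρ F ω _ hρ hF hp).symm

theorem anomaly_eq_of_hasPhase {c d : SpinChain} {α : Symm G c} {β : Symm G d}
    {ω : G → G → G → Circle} (hα : α.HasPhase ω) (hβ : β.HasPhase ω) :
    anomaly ⟨c, α⟩ = anomaly ⟨d, β⟩ := by
  rw [← hα.cocycleClass_eq hα.isThreeCocycle, hβ.cocycleClass_eq]

theorem anomaly_eq_one {c : SpinChain} {α : Symm G c} (h : α.HasPhase fun _ _ _ => 1) :
    anomaly ⟨c, α⟩ = 1 := by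
  rw [← h.cocycleClass_eq h.isThreeCocycle]
  exact cocycleClass_one _ fun _ _ _ => rfl

theorem anomaly_stack {c d : SpinChain} (α : Symm G c) (β : Symm G d) :
    anomaly ⟨c.stack d, α.stack β⟩ = anomaly ⟨c, α⟩ * anomaly ⟨d, β⟩ := by
  obtain ⟨ω, hω⟩ := α.exists_hasPhase
  obtain ⟨ω', hω'⟩ := β.exists_hasPhase
  have h := hω.stack hω'
  rw [← hω.cocycleClass_eq hω.isThreeCocycle, ← hω'.cocycleClass_eq hω'.isThreeCocycle,
    ← h.cocycleClass_eq h.isThreeCocycle]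
  exact cocycleClass_mul _ _ _ fun _ _ _ => rfl

/-- Equivalent symmetries share a cocycle, the anomaly is multiplicative, and the range-zero
ancillas contribute the trivial class. -/
theorem StableEquiv.anomaly_eq {α α' : AllSymm G} (h : StableEquiv α α') :
    anomaly α = anomaly α' := by
  obtain ⟨β, β', hβ, hβ', h⟩ := h
  obtain ⟨ω, hω⟩ := (α'.2.stack β'.2).exists_hasPhase
  have h1 := anomaly_eq_of_hasPhase (hω.of_equivalent h) hω
  rwa [anomaly_stack, anomaly_stack, anomaly_eq_one hβ.hasPhase_one, mul_one,
    anomaly_eq_one hβ'.hasPhase_one, mul_one] at h1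

end Anomaly

end

/-! ### The proposition on the anomaly. -/

theorem mainTheorem3 {G : Type} [Group G] [Finite G] :
    -- right restrictions, fusion operators and their phases exist
    (∀ (c : SpinChain) (α : Symm G c) (R : ℕ), α.RangeLE R →
      ∀ j : ℤ, ∃ ρ, α.IsRightRestriction j (2 * R) ρ) ∧
    (∀ (c : SpinChain) (α : Symm G c) (R : ℕ), α.RangeLE R →
      ∀ (j : ℤ) (L : ℕ) (ρ : G → (c.Alg ≃⋆ₐ[ℂ] c.Alg)), α.IsRightRestriction j L ρ →
        (∃ F, IsFusion ρ F ∧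
          ∀ g h, (F g h : c.Alg) ∈ c.localAlg (Set.Icc (j - L) (j + L + R))) ∧
        ∀ F, IsFusion ρ F → ∃! ω, IsFusionPhase ρ F ω) ∧
    -- the phases form a 3-cocycle
    (∀ (c : SpinChain) (α : Symm G c) (j : ℤ) (L : ℕ) (ρ : G → (c.Alg ≃⋆ₐ[ℂ] c.Alg))
      (F : G → G → unitary c.Alg) (ω : G → G → G → Circle),
      α.IsRightRestriction j L ρ → IsFusion ρ F → IsFusionPhase ρ F ω → IsThreeCocycle ω) ∧
    -- their class is independent of all choices, which defines the anomaly `Ω`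
    ∃ Ω : AllSymm G → H3 G, IsAnomaly Ω ∧ (∀ Ω' : AllSymm G → H3 G, IsAnomaly Ω' → Ω' = Ω) ∧
      -- trivial on decoupled symmetries
      (∀ (c : SpinChain) (α : Symm G c), α.IsDecoupled → Ω ⟨c, α⟩ = 1) ∧
      -- locally computable
      (∀ (c : SpinChain) (α β : Symm G c) (R : ℕ), α.RangeLE R → β.RangeLE R →
        ∀ a : ℤ, (∀ g, ∀ x ∈ c.localAlg (Set.Icc a (a + 8 * R)), α g x = β g x) →
          Ω ⟨c, α⟩ = Ω ⟨c, β⟩) ∧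
      -- multiplicative under stacking
      (∀ (c c' : SpinChain) (α : Symm G c) (β : Symm G c'),
        Ω ⟨c.stack c', α.stack β⟩ = Ω ⟨c, α⟩ * Ω ⟨c', β⟩) ∧
      -- constant on stable equivalence classes
      (∀ α β : AllSymm G, StableEquiv α β → Ω α = Ω β) ∧
      -- it lifts to a homomorphism from the monoid of stable equivalence classes
      Equivalence (StableEquiv (G := G)) ∧
      ∃ _ : CommMonoid (Quot (StableEquiv (G := G))),
        (∀ α β : AllSymm G, Quot.mk StableEquiv α * Quot.mk StableEquiv β =
          Quot.mk StableEquiv ⟨α.1.stack β.1, α.2.stack β.2⟩) ∧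
        ∃ Φ : Quot (StableEquiv (G := G)) →* H3 G, ∀ α, Φ (Quot.mk StableEquiv α) = Ω α := by
  refine ⟨fun c α R hα j => hα.exists_isRightRestriction j,
    fun c α R hα j L ρ hρ => ⟨hρ.exists_fusion hα, fun F hF => hF.existsUnique_phase⟩,
    fun c α j L ρ F ω _ hF hω => hω.isThreeCocycle hF,
    anomaly, isAnomaly_anomaly, fun Ω' h => h.eq_anomaly,
    fun c α h => anomaly_eq_one h.hasPhase_one, fun c α β R hα hβ a h => ?_,
    fun c c' α β => anomaly_stack α β, fun α β h => h.anomaly_eq, stableEquiv_equivalence,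
    stackMonoid G, fun α β => rfl, ?_⟩
  · obtain ⟨ω, h1, h2⟩ := Symm.exists_hasPhase_of_eq_on_Icc hα hβ h
    exact anomaly_eq_of_hasPhase h1 h2
  · let _ := stackMonoid G
    refine ⟨MonoidHom.mk' (Quot.lift anomaly fun _ _ h => h.anomaly_eq) ?_, fun α => rfl⟩
    rintro ⟨α⟩ ⟨β⟩
    exact anomaly_stack α.2 β.2
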